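/- Let $n\ge 3$ and let $(M,g)$ be a smooth Riemannian $n$-manifold (possibly with boundary). Call a diffeomorphism $\Phi$ from an open set of $M$ onto an open set $U\subset\mathbb{R}^n$ with bounded complement an asymptotically flat coordinate system if: under $\Phi$ the infinity of $M$ corresponds to the infinity of $\mathbb{R}^n$ (a subset of $M$ has relatively compact complement if and only if its image contains the exterior of a ball; in particular $\Phi$ is defined outside a compact set); for some $p>\frac{n-2}{2}$ the metric coefficients in these coordinates satisfy $g_{ij}=\delta_{ij}+O(|x|^{-p})$ and $\partial_k g_{ij}=O(|x|^{-p-1})$ as $|x|\to\infty$; and the scalar curvature of $g$ is integrable near infinity. Then $(M,g)$ is asymptotically flat if it has such coordinates, and its ADM mass is $$\mathbf{m}_{\mathrm{ADM}}=\lim_{r\to\infty}\frac{1}{2(n-1)\omega_{n-1}}\int_{\{|x|=r\}}\sum_{i,j}\left(\partial_j g_{ij}-\partial_i g_{jj}\right)\frac{x^i}{|x|}\,dS,$$ where $\omega_{n-1}$ is the area of the unit sphere in $\mathbb{R}^n$. Let $(M,g)$ be asymptotically flat and assume that a neighborhood of infinity of $(M,g)$ is realized as a graph in $\mathbb{R}^{n+1}$: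 there are a smooth function $f:U\to\mathbb{R}$ on an open set $U\subset\mathbb{R}^n$ with bounded complement and an isometry from a neighborhood of infinity of $M$ onto $\{(x,f(x)):x\in U\}\subset\mathbb{R}^{n+1}$ with its induced metric, such that the graph coordinates $x\in U$ are asymptotically flat coordinates of $(M,g)$. Assume that for almost every $h\in\mathbb{R}$ the level set $\Sigma_h=\{x\in U: f(x)=h\}$ is bounded in $\mathbb{R}^n$ and strictly mean convex, that is, its mean curvature in $\mathbb{R}^n$ with respect to the unit normal $Df/|Df|$ (the outward normal of $\{f<h\}$), $$H_{\Sigma_h}=\operatorname{div}\left(\frac{Df}{|Df|}\right),$$ is positive (it suffices to assume this at the points of $\Sigma_h$ where $Df\neq0$; by Sard's theorem, for almost every $h$ these are all the points of $\Sigma_h$). Then the ADM mass of $(M,g)$ is well defined (the limit exists and has the same value in all asymptotically flat coordinate systems), and it is non-negative: $$\mathbf{m}_{\mathrm{ADM}}\ge 0 .$$ No sign condition on the scalar curvature is assumed. -/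

import Mathlib

open Set Filter Topology MeasureTheory Bornology
open scoped Manifold ContDiff

noncomputable section

namespace GraphMass

/-- Euclidean space `ℝⁿ`. -/
abbrev E (n : ℕ) : Type := EuclideanSpace ℝ (Fin n)

/-- The partial derivative `∂F/∂xᵏ` at `x`. -/
def pd {n : ℕ} (k : Fin n) (F : E n → ℝ) (x : E n) : ℝ :=
  fderiv ℝ F x (EuclideanSpace.single k 1)

/-! ### Scalar curvature of a metric given by its coefficients in coordinates -/

/-- Christoffel symbols
`Γᵏᵢⱼ = ½ gᵏˡ (∂ᵢ gⱼₗ + ∂ⱼ gᵢₗ - ∂ₗ gᵢⱼ)` of the coefficient matrix `G`. -/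
def christoffel {n : ℕ} (G : E n → Matrix (Fin n) (Fin n) ℝ) (k i j : Fin n) (x : E n) : ℝ :=
  (1 / 2) * ∑ l, (G x)⁻¹ k l *
    (pd i (fun y => G y j l) x + pd j (fun y => G y i l) x - pd l (fun y => G y i j) x)

/-- Ricci curvature
`Rᵢⱼ = ∂ₖ Γᵏᵢⱼ - ∂ⱼ Γᵏᵢₖ + Γᵏₖₗ Γˡᵢⱼ - Γᵏⱼₗ Γˡᵢₖ`. -/
def ricci {n : ℕ} (G : E n → Matrix (Fin n) (Fin n) ℝ) (i j : Fin n) (x : E n) : ℝ :=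
  ∑ k, (pd k (christoffel G k i j) x - pd j (christoffel G k i k) x +
    ∑ l, (christoffel G k k l x * christoffel G l i j x -
      christoffel G k j l x * christoffel G l i k x))

/-- Scalar curvature `R = gⁱʲ Rᵢⱼ`. -/
def scalarCurvature {n : ℕ} (G : E n → Matrix (Fin n) (Fin n) ℝ) (x : E n) : ℝ :=
  ∑ i, ∑ j, (G x)⁻¹ i j * ricci G i j x

/-! ### Asymptotically flat manifolds and the ADM mass -/

section Manifold

variable {n : ℕ} {H : Type*} [TopologicalSpace H] {I : ModelWithCorners ℝ (E n) H}
  {M : Type*} [TopologicalSpace M] [ChartedSpace H M] [IsManifold I ∞ M]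

/-- The coefficients `gᵢⱼ(x) = g(∂ᵢ, ∂ⱼ)` of the Riemannian metric `g` in the coordinates `Φ`,
as functions of `x ∈ Φ.target`. -/
def metricCoeff
    (g : Bundle.ContMDiffRiemannianMetric I ∞ (E n) (TangentSpace I : M → Type _))
    (Φ : OpenPartialHomeomorph M (E n)) (x : E n) : Matrix (Fin n) (Fin n) ℝ :=
  Matrix.of fun i j =>
    g.inner (Φ.symm x)
      (mfderiv 𝓘(ℝ, E n) I Φ.symm x (EuclideanSpace.single i (1 : ℝ) : E n))
      (mfderiv 𝓘(ℝ, E n) I Φ.symm x (EuclideanSpace.single j (1 : ℝ) : E n))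

/-- `Φ` is an asymptotically flat coordinate system (a structure at infinity) of `(M, g)`:
a diffeomorphism from a neighbourhood of infinity of `M` onto a neighbourhood of infinity of
`ℝⁿ` in which `gᵢⱼ = δᵢⱼ + O(|x|⁻ᵖ)` and `∂ₖ gᵢⱼ = O(|x|⁻ᵖ⁻¹)` for some `p > (n - 2) / 2`,
and the scalar curvature is integrable with respect to the Riemannian volume near infinity.
(No decay of second derivatives is needed for the mass to be well defined, so none is asked.) -/
structure IsAsymptoticallyFlatChart
    (g : Bundle.ContMDiffRiemannianMetric I ∞ (E n) (TangentSpace I : M → Type _))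
    (Φ : OpenPartialHomeomorph M (E n)) : Prop where
  contMDiffOn : ContMDiffOn I 𝓘(ℝ, E n) ∞ Φ Φ.source
  contMDiffOn_symm : ContMDiffOn 𝓘(ℝ, E n) I ∞ Φ.symm Φ.target
  /-- The complement of `Φ.target` in `ℝⁿ` is bounded. -/
  target_mem : Φ.target ∈ cobounded (E n)
  /-- Under `Φ`, the infinity of `ℝⁿ` is the infinity of `M`: a subset of `M` has relatively
  compact complement iff its image contains the exterior of a ball. In particular the complement
  of `Φ.source` is compact. -/
  map_cobounded : map Φ.symm (cobounded (E n)) = cocompact M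
  decay : ∃ p : ℝ, ((n : ℝ) - 2) / 2 < p ∧
    (∀ i j, (fun x => metricCoeff g Φ x i j - (1 : Matrix (Fin n) (Fin n) ℝ) i j)
      =O[cobounded (E n)] fun x => ‖x‖ ^ (-p)) ∧
    (∀ i j k, (fun x => pd k (fun y => metricCoeff g Φ y i j) x)
      =O[cobounded (E n)] fun x => ‖x‖ ^ (-p - 1))
  integrable_scalarCurvature : ∃ r : ℝ, IntegrableOn
    (fun x => scalarCurvature (metricCoeff g Φ) x * √(metricCoeff g Φ x).det) {x | r < ‖x‖}

/-- The area `ω_{n-1}` of the unit sphere of `ℝⁿ`. -/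
def sphereArea (n : ℕ) : ℝ :=
  (volume : Measure (E n)).toSphere.real univ

/-- `(2 (n - 1) ω_{n-1})⁻¹ ∫_{|x| = r} (∂ⱼ gᵢⱼ - ∂ᵢ gⱼⱼ) xⁱ / |x| dS`; the integral over the
sphere of radius `r` is written as an integral over the unit sphere. -/
def admFlux (G : E n → Matrix (Fin n) (Fin n) ℝ) (r : ℝ) : ℝ :=
  1 / (2 * ((n : ℝ) - 1) * sphereArea n) *
    (r ^ (n - 1) * ∫ ν : Metric.sphere (0 : E n) 1,
      (∑ i, ∑ j, (pd j (fun y => G y i j) (r • (ν : E n)) -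
        pd i (fun y => G y j j) (r • (ν : E n))) * (ν : E n) i)
      ∂(volume : Measure (E n)).toSphere)

/-- `(M, g)` is asymptotically flat with well-defined ADM mass `m`: asymptotically flat
coordinates exist, and in all of them the flux integrals converge to `m`. -/
def HasADMMass
    (g : Bundle.ContMDiffRiemannianMetric I ∞ (E n) (TangentSpace I : M → Type _))
    (m : ℝ) : Prop :=
  (∃ Φ : OpenPartialHomeomorph M (E n), IsAsymptoticallyFlatChart g Φ) ∧
  ∀ Φ : OpenPartialHomeomorph M (E n), IsAsymptoticallyFlatChart g Φ →
    Tendsto (admFlux (metricCoeff g Φ)) atTop (𝓝 m)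

/-! ### Graphs in `ℝⁿ⁺¹` and their level sets -/

/-- The Euclidean inner product of `ℝⁿ⁺¹ = ℝⁿ × ℝ`. -/
def euclideanInner {n : ℕ} (a b : E n × ℝ) : ℝ :=
  inner ℝ a.1 b.1 + a.2 * b.2

/-- The map `q ↦ (Φ q, f (Φ q))` into `ℝⁿ⁺¹ = ℝⁿ × ℝ`. It maps `Φ.source` onto the graph of `f`
over `Φ.target`, and `Φ` is this map followed by the projection to `ℝⁿ`. -/
def graphMap (Φ : OpenPartialHomeomorph M (E n)) (f : E n → ℝ) (q : M) : E n × ℝ :=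
  (Φ q, f (Φ q))

/-- The open subset `Φ.source` of `(M, g)` is realized as the graph of the smooth function
`f : Φ.target → ℝ` in `ℝⁿ⁺¹`, with graph coordinates `Φ`: the map `graphMap Φ f` is an isometric
embedding of `Φ.source`. -/
structure IsGraphRealization
    (g : Bundle.ContMDiffRiemannianMetric I ∞ (E n) (TangentSpace I : M → Type _))
    (Φ : OpenPartialHomeomorph M (E n)) (f : E n → ℝ) : Prop where
  contDiffOn : ContDiffOn ℝ ∞ f Φ.target
  isometric : ∀ q ∈ Φ.source, ∀ v w : TangentSpace I q,
    g.inner q v w =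
      euclideanInner (mfderiv I 𝓘(ℝ, E n × ℝ) (graphMap Φ f) q v)
        (mfderiv I 𝓘(ℝ, E n × ℝ) (graphMap Φ f) q w)

end Manifold

/-- The unit normal `Df / |Df|` of the level sets of `f`, pointing out of `{f < h}`. -/
def levelSetNormal {n : ℕ} (f : E n → ℝ) (x : E n) : E n :=
  ‖gradient f x‖⁻¹ • gradient f x

/-- The mean curvature `div (Df / |Df|)`, in `ℝⁿ`, of the level set of `f` through a point `x`
with `Df(x) ≠ 0`, with respect to the unit normal `Df / |Df|`. -/
def levelSetMeanCurvature {n : ℕ} (f : E n → ℝ) (x : E n) : ℝ :=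
  ∑ i, pd i (fun y => levelSetNormal f y i) x

/-- The level set `{x ∈ U | f x = h}` is a bounded subset of `ℝⁿ` and strictly mean convex as part
of the boundary of `{f < h}`: its mean curvature with respect to the normal pointing out of
`{f < h}` is positive at its regular points. (For almost every `h` there are no others, by Sard.) -/
def IsStrictlyMeanConvexLevelSet {n : ℕ} (U : Set (E n)) (f : E n → ℝ) (h : ℝ) : Prop :=
  IsBounded {x ∈ U | f x = h} ∧
  ∀ x ∈ U, f x = h → gradient f x ≠ 0 → 0 < levelSetMeanCurvature f x

end GraphMass

end

/-!
The mass of an asymptotically flat metric `g` on `ℝⁿ` is, up to the factor `1 / (2 (n - 1) ω)`, the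
integral over `ℝⁿ` of the divergence of the vector field `Vᵏ = √g (gⁱʲ Γᵏᵢⱼ - gⁱᵏ Γʲᵢⱼ)`
(`massField`): `V` agrees with the integrand of the ADM flux up to `O(|x|⁻²ᵖ⁻¹)`, and
`div V = R √g + O(|x|⁻²ᵖ⁻²)` is integrable (`IsAFMetric.tendsto_admFlux`). Neither fact needs decay
of second derivatives. Only the behaviour at infinity matters, so every asymptotically flat
coordinate system may be filled in to give a metric on `ℝⁿ` (`exists_isAFMetric`).

The mass does not depend on the coordinates (`IsEndIsometry.integral_divergence_eq`). A change `t`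
of asymptotically flat coordinates has second derivatives `O(|x|⁻ᵖ⁻¹)`, since these are determined
by the Christoffel symbols of the two metrics; so its Jacobian converges to an orthogonal matrix at
the rate `|x|⁻ᵖ` (`exists_limit_of_decays_pd`). Under `t`, the field `V` then transforms like a
vector field, up to `O(|x|⁻²ᵖ⁻¹)` and up to the divergence of an antisymmetric tensor. When `∫ div V` is
written as the limit of the pairings `-∫ V · Dη` with cutoff functions `η`, transported by `t`,
these two terms drop out.

For the graph of `f`, with metric `δᵢⱼ + fᵢ fⱼ`, one finds
`V = (Δf Df - D²f Df) / √(1 + |Df|²)`. Hence `V · Df` is a nonnegative multiple of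
`levelForm f = |Df|³ H`, where `H` is the mean curvature of the level set. Mean convexity of almost
all level sets gives `levelForm f ≥ 0` everywhere near infinity, because the values of `f` near a
regular point fill an interval (`levelForm_nonneg`). As almost all level sets are bounded and the
exterior of a ball is connected, `f` has a limit `L ∈ [-∞, ∞]` at infinity. By a comparison with
Gaussian barriers, `f ≤ L` near infinity, and `L ≠ -∞` (`le_limit_of_levelForm_nonneg`).

So the functions `ψ ∘ f`, with `ψ` decreasing and zero near `L`, may serve as cutoff functions
(`integral_divergence_massField_nonneg`): up to a fixed cutoff inside a ball,
`∫ (ψ ∘ f) div V = -∫ ψ'(f) V · Df ≥ 0`. In the limit `ψ → 1` this yields `∫ div V ≥ 0` over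
`{f < L}`, while on `{f = L}` the function `f` has a maximum, and `div V = (tr D²f)² - |D²f|² ≥ 0`
there. This argument replaces integration over the level sets; it needs neither Sard's theorem nor
the coarea formula.
-/

namespace GraphMass

variable {n : ℕ}

/-! ### Partial derivatives -/

lemma pd_add {k : Fin n} {u v : E n → ℝ} {x : E n} (hu : DifferentiableAt ℝ u x)
    (hv : DifferentiableAt ℝ v x) : pd k (fun y => u y + v y) x = pd k u x + pd k v x := by
  simp [pd, fderiv_fun_add hu hv]

lemma pd_sub {k : Fin n} {u v : E n → ℝ} {x : E n} (hu : DifferentiableAt ℝ u x)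
    (hv : DifferentiableAt ℝ v x) : pd k (fun y => u y - v y) x = pd k u x - pd k v x := by
  simp [pd, fderiv_fun_sub hu hv]

lemma pd_mul {k : Fin n} {u v : E n → ℝ} {x : E n} (hu : DifferentiableAt ℝ u x)
    (hv : DifferentiableAt ℝ v x) :
    pd k (fun y => u y * v y) x = u x * pd k v x + pd k u x * v x := by
  simp [pd, fderiv_fun_mul hu hv]
  ring

lemma pd_sum {ι : Type*} {s : Finset ι} {k : Fin n} {u : ι → E n → ℝ} {x : E n}
    (hu : ∀ i ∈ s, DifferentiableAt ℝ (u i) x) :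
    pd k (fun y => ∑ i ∈ s, u i y) x = ∑ i ∈ s, pd k (u i) x := by
  simp [pd, fderiv_fun_sum hu]

@[simp] lemma pd_const (k : Fin n) (c : ℝ) (x : E n) : pd k (fun _ => c) x = 0 := by
  simp [pd]

lemma pd_const_mul {k : Fin n} {u : E n → ℝ} {x : E n} (c : ℝ) (hu : DifferentiableAt ℝ u x) :
    pd k (fun y => c * u y) x = c * pd k u x := by
  rw [pd_mul (by fun_prop) hu]; simp

lemma pd_congr {k : Fin n} {u v : E n → ℝ} {x : E n} (h : u =ᶠ[𝓝 x] v) : pd k u x = pd k v x := by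
  simp [pd, h.fderiv_eq]

lemma pd_comp_real {k : Fin n} {F : ℝ → ℝ} {u : E n → ℝ} {x : E n}
    (hF : DifferentiableAt ℝ F (u x)) (hu : DifferentiableAt ℝ u x) :
    pd k (fun y => F (u y)) x = deriv F (u x) * pd k u x := by
  have := (hF.hasDerivAt.comp_hasFDerivAt x hu.hasFDerivAt).fderiv
  simp only [pd]
  rw [show (fun y => F (u y)) = F ∘ u from rfl, this]
  simp

lemma single_sum_eq (v : E n) : v = ∑ i, v i • (EuclideanSpace.single i (1 : ℝ) : E n) := by
  ext j
  simp [Finset.sum_apply, Pi.single_apply]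

/-- The derivative of `u` in the direction `v` is the sum of the `vᵢ ∂ᵢu`. -/
lemma fderiv_apply_eq_sum (u : E n → ℝ) (x v : E n) : fderiv ℝ u x v = ∑ i, v i * pd i u x := by
  conv_lhs => rw [single_sum_eq v]
  simp [pd, map_sum]

/-- Chain rule for a scalar function after a map of `ℝⁿ`. -/
lemma pd_comp {k : Fin n} {u : E n → ℝ} {t : E n → E n} {x : E n}
    (hu : DifferentiableAt ℝ u (t x)) (ht : DifferentiableAt ℝ t x) :
    pd k (fun y => u (t y)) x = ∑ q, pd q u (t x) * pd k (fun y => t y q) x := by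
  have h1 := fderiv_comp x hu ht
  simp only [pd]
  rw [show (fun y => u (t y)) = u ∘ t from rfl, h1, ContinuousLinearMap.comp_apply,
    fderiv_apply_eq_sum]
  refine Finset.sum_congr rfl fun q _ => ?_
  have h2 : HasFDerivAt (fun y => t y q)
      ((EuclideanSpace.proj q : E n →L[ℝ] ℝ).comp (fderiv ℝ t x)) x :=
    (EuclideanSpace.proj q : E n →L[ℝ] ℝ).hasFDerivAt.comp x ht.hasFDerivAt
  rw [h2.fderiv]
  simp [pd, mul_comm]

lemma contDiff_pd {u : E n → ℝ} (hu : ContDiff ℝ ∞ u) (k : Fin n) : ContDiff ℝ ∞ (pd k u) := by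
  have : ContDiff ℝ ∞ (fderiv ℝ u) := hu.fderiv_right (by simp)
  exact this.clm_apply contDiff_const

lemma contDiffAt_pd {u : E n → ℝ} {x : E n} (hu : ContDiffAt ℝ ∞ u x) (k : Fin n) :
    ContDiffAt ℝ ∞ (pd k u) x := by
  have : ContDiffAt ℝ ∞ (fderiv ℝ u) x := hu.fderiv_right (by simp)
  exact this.clm_apply contDiffAt_const

lemma continuous_pd {u : E n → ℝ} (hu : ContDiff ℝ 1 u) (k : Fin n) : Continuous (pd k u) :=
  (hu.continuous_fderiv (by simp)).clm_apply continuous_const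

lemma contDiff_coord {t : E n → E n} (ht : ContDiff ℝ ∞ t) (k : Fin n) :
    ContDiff ℝ ∞ (fun x => t x k) :=
  (EuclideanSpace.proj k : E n →L[ℝ] ℝ).contDiff.comp ht

lemma pd_pd_eq {u : E n → ℝ} {x : E n} (hu : ContDiffAt ℝ ∞ u x) (i j : Fin n) :
    pd i (pd j u) x = fderiv ℝ (fderiv ℝ u) x (EuclideanSpace.single i 1)
      (EuclideanSpace.single j 1) := by
  have h : DifferentiableAt ℝ (fderiv ℝ u) x :=
    (hu.fderiv_right (m := ∞) (by simp)).differentiableAt (by simp)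
  simp only [pd]
  change fderiv ℝ (fun y => fderiv ℝ u y (EuclideanSpace.single j 1)) x _ = _
  rw [fderiv_clm_apply h (by fun_prop)]
  simp

lemma pd_comm {u : E n → ℝ} {x : E n} (hu : ContDiffAt ℝ ∞ u x) (i j : Fin n) :
    pd i (pd j u) x = pd j (pd i u) x := by
  rw [pd_pd_eq hu, pd_pd_eq hu]
  have h2 : minSmoothness ℝ 2 ≤ ∞ := by
    rw [minSmoothness_of_isRCLikeNormedField]
    exact WithTop.coe_le_coe.2 le_top
  exact (hu.isSymmSndFDerivAt h2).eq _ _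

lemma hasCompactSupport_pd {u : E n → ℝ} (hc : HasCompactSupport u) (k : Fin n) :
    HasCompactSupport (pd k u) :=
  (hc.fderiv (𝕜 := ℝ)).comp_left
    (g := fun L : E n →L[ℝ] ℝ => L (EuclideanSpace.single k 1)) (by simp)

/-- Integration by parts; no boundary term as `u` has compact support. -/
lemma integral_mul_pd_eq_neg {u v : E n → ℝ} (hu : ContDiff ℝ 1 u) (hv : ContDiff ℝ 1 v)
    (hc : HasCompactSupport u) (k : Fin n) :
    ∫ x, u x * pd k v x = -∫ x, pd k u x * v x := by
  refine integral_mul_fderiv_eq_neg_fderiv_mul_of_integrable ?_ ?_ ?_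
    (fun x _ => hu.differentiable (by simp) x) (fun x _ => hv.differentiable (by simp) x)
  · exact ((continuous_pd hu k).mul hv.continuous).integrable_of_hasCompactSupport
      (hasCompactSupport_pd hc k).mul_right
  · exact (hu.continuous.mul (continuous_pd hv k)).integrable_of_hasCompactSupport hc.mul_right
  · exact (hu.continuous.mul hv.continuous).integrable_of_hasCompactSupport hc.mul_right

/-! ### Decay at infinity -/

/-- `u = O(|x|ˢ)` at infinity. -/
def Decays (s : ℝ) (u : E n → ℝ) : Prop := u =O[cobounded (E n)] fun x => ‖x‖ ^ s

lemma eventually_norm_gt (r : ℝ) : ∀ᶠ x : E n in cobounded (E n), r < ‖x‖ :=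
  tendsto_norm_cobounded_atTop.eventually (eventually_gt_atTop r)

/-- A property holds near infinity iff it holds outside some ball. -/
lemma eventually_cobounded_iff {P : E n → Prop} :
    (∀ᶠ x in cobounded (E n), P x) ↔ ∃ r : ℝ, 0 < r ∧ ∀ x, r < ‖x‖ → P x := by
  constructor
  · intro h
    rw [← comap_norm_atTop, eventually_comap] at h
    obtain ⟨r, hr⟩ := eventually_atTop.1 h
    exact ⟨max r 1, by positivity, fun x hx => hr _ ((le_max_left r 1).trans hx.le) x rfl⟩
  · rintro ⟨r, -, h⟩
    exact (eventually_norm_gt r).mono h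

/-- What holds near infinity holds near infinity on neighbourhoods. -/
lemma eventually_nhds_cobounded {P : E n → Prop} (h : ∀ᶠ x in cobounded (E n), P x) :
    ∀ᶠ x in cobounded (E n), ∀ᶠ y in 𝓝 x, P y := by
  obtain ⟨r, -, hr⟩ := eventually_cobounded_iff.1 h
  filter_upwards [eventually_norm_gt r] with x hx
  filter_upwards [continuous_norm.continuousAt.eventually (lt_mem_nhds hx)] with y hy using hr y hy

lemma eventually_pd_congr {u v : E n → ℝ} (h : u =ᶠ[cobounded (E n)] v) (k : Fin n) :
    pd k u =ᶠ[cobounded (E n)] pd k v :=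
  (eventually_nhds_cobounded h).mono fun _ hx => pd_congr hx

namespace Decays

variable {s t : ℝ} {u v : E n → ℝ}

lemma congr' (hu : Decays s u) (h : u =ᶠ[cobounded (E n)] v) : Decays s v :=
  Asymptotics.IsBigO.congr' hu h EventuallyEq.rfl

lemma mono (hu : Decays s u) (h : s ≤ t) : Decays t u := by
  refine Asymptotics.IsBigO.trans hu (Asymptotics.IsBigO.of_bound 1 ?_)
  filter_upwards [eventually_norm_gt 1] with x hx
  rw [one_mul, Real.norm_of_nonneg (by positivity), Real.norm_of_nonneg (by positivity)]
  exact Real.rpow_le_rpow_of_exponent_le hx.le h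

lemma add (hu : Decays s u) (hv : Decays s v) : Decays s (fun x => u x + v x) :=
  Asymptotics.IsBigO.add hu hv

lemma sub (hu : Decays s u) (hv : Decays s v) : Decays s (fun x => u x - v x) :=
  Asymptotics.IsBigO.sub hu hv

lemma const_mul (hu : Decays s u) (c : ℝ) : Decays s (fun x => c * u x) :=
  Asymptotics.IsBigO.const_mul_left hu c

lemma abs (hu : Decays s u) : Decays s (fun x => |u x|) :=
  Asymptotics.IsBigO.norm_left hu

lemma of_abs_le (hv : Decays s v) (h : ∀ᶠ x in cobounded (E n), |u x| ≤ |v x|) : Decays s u :=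
  (Asymptotics.IsBigO.of_bound 1 (by simpa using h)).trans hv

lemma mul (hu : Decays s u) (hv : Decays t v) : Decays (s + t) (fun x => u x * v x) := by
  refine (Asymptotics.IsBigO.mul hu hv).congr' EventuallyEq.rfl ?_
  filter_upwards [eventually_norm_gt 0] with x hx using (Real.rpow_add hx s t).symm

lemma mul' {r : ℝ} (hu : Decays s u) (hv : Decays t v) (h : s + t ≤ r) :
    Decays r (fun x => u x * v x) := (hu.mul hv).mono h

lemma sum {ι : Type*} {S : Finset ι} {u : ι → E n → ℝ} (hu : ∀ i ∈ S, Decays s (u i)) :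
    Decays s (fun x => ∑ i ∈ S, u i x) := by
  simpa [Decays, Finset.sum_fn] using Asymptotics.IsBigO.sum hu

lemma of_tendsto {c : ℝ} (h : Tendsto u (cobounded (E n)) (𝓝 c)) : Decays 0 u := by
  simpa [Decays] using h.isBigO_one ℝ

lemma tendsto_zero (hu : Decays s u) (hs : s < 0) : Tendsto u (cobounded (E n)) (𝓝 0) := by
  refine Asymptotics.IsBigO.trans_tendsto hu ?_
  have := (tendsto_rpow_neg_atTop (y := -s) (by linarith)).comp
    (tendsto_norm_cobounded_atTop (E := E n))
  simpa [Function.comp_def] using this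

lemma exists_bound (hu : Decays s u) :
    ∃ C r : ℝ, 0 < C ∧ 1 ≤ r ∧ ∀ x, r < ‖x‖ → |u x| ≤ C * ‖x‖ ^ s := by
  obtain ⟨C, hC, h⟩ := Asymptotics.IsBigO.exists_pos hu
  obtain ⟨r, -, hr⟩ := eventually_cobounded_iff.1 h.bound
  refine ⟨C, max r 1, hC, le_max_right _ _, fun x hx => ?_⟩
  have := hr x ((le_max_left _ _).trans_lt hx)
  rwa [Real.norm_eq_abs, Real.norm_of_nonneg (by positivity)] at this

lemma norm_rpow (s : ℝ) : Decays s (fun x : E n => ‖x‖ ^ s) := Asymptotics.isBigO_refl _ _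

/-- A bound in terms of `1 + |x|`, which has no singularity at the origin. -/
lemma exists_bound_one_add (hu : Decays s u) (hs : s ≤ 0) :
    ∃ C r : ℝ, 0 < C ∧ 1 ≤ r ∧ ∀ x, r < ‖x‖ → |u x| ≤ C * (1 + ‖x‖) ^ s := by
  obtain ⟨C, r, hC, hr, h⟩ := hu.exists_bound
  refine ⟨C * 2 ^ (-s), r, by positivity, hr, fun x hx => (h x hx).trans ?_⟩
  have hx0 : 1 < ‖x‖ := hr.trans_lt hx
  have h1 : (2 * ‖x‖) ^ s ≤ (1 + ‖x‖) ^ s :=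
    Real.rpow_le_rpow_of_nonpos (by positivity) (by linarith) hs
  rw [Real.mul_rpow (by norm_num) (by positivity)] at h1
  calc C * ‖x‖ ^ s = C * 2 ^ (-s) * (2 ^ s * ‖x‖ ^ s) := by
        rw [show C * 2 ^ (-s) * (2 ^ s * ‖x‖ ^ s) = C * ((2 : ℝ) ^ (-s) * 2 ^ s) * ‖x‖ ^ s by ring,
          ← Real.rpow_add (by norm_num)]
        simp
    _ ≤ _ := by gcongr

/-- A continuous function that decays faster than `|x|⁻ⁿ` is integrable. -/
lemma integrable (hu : Decays s u) (hs : s < -(n : ℝ)) (hc : Continuous u) : Integrable u := by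
  obtain ⟨C, r, hC, hr, h⟩ := hu.exists_bound_one_add
    (hs.le.trans (neg_nonpos.2 (Nat.cast_nonneg n)))
  have h1 : IntegrableOn u (Metric.closedBall 0 r) :=
    hc.continuousOn.integrableOn_compact (isCompact_closedBall _ _)
  have h2 : IntegrableOn u (Metric.closedBall 0 r)ᶜ := by
    have hi : Integrable (fun x : E n => C * (1 + ‖x‖) ^ (-(-s))) :=
      (integrable_one_add_norm (by simpa using by linarith)).const_mul C
    refine Integrable.mono' hi.integrableOn hc.aestronglyMeasurable ?_
    refine (ae_restrict_iff' Metric.isClosed_closedBall.measurableSet.compl).2 (ae_of_all _ ?_)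
    intro x hx
    simpa using h x (by simpa using hx)
  simpa using h1.union h2

end Decays

/-- Test functions sliding off to infinity do not see an integrand that decays fast enough: the
pairings of `b_R` with `w` tend to `0` if `b_R(x) = O(1/|x|)` uniformly in `R`, if `b_R` vanishes
on any given ball for large `R`, and if `w(x)/|x|` is integrable at infinity. -/
lemma tendsto_integral_mul_of_decays {s : ℝ} {w : E n → ℝ} {b : ℝ → E n → ℝ} {C ρ : ℝ}
    (hw : Decays s w) (hs : s - 1 < -(n : ℝ)) (hwc : Continuous w)
    (hbm : ∀ R, 0 < R → Continuous (b R))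
    (hb : ∀ R, 0 < R → ∀ x, ρ < ‖x‖ → |b R x| ≤ C * ‖x‖ ^ (-1 : ℝ))
    (hb0 : ∀ r : ℝ, ∀ᶠ R in atTop, ∀ x, ‖x‖ ≤ r → b R x = 0) :
    Tendsto (fun R => ∫ x, b R x * w x) atTop (𝓝 0) := by
  have hd : Decays (s - 1) (fun x => C * ‖x‖ ^ (-1 : ℝ) * w x) :=
    ((Decays.norm_rpow (-1)).const_mul C).mul' hw (by linarith)
  obtain ⟨K, r, hK, hr, h⟩ := hd.exists_bound_one_add
    (hs.le.trans (neg_nonpos.2 (Nat.cast_nonneg n)))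
  rw [show (0 : ℝ) = ∫ _ : E n, (0 : ℝ) by simp]
  refine tendsto_integral_filter_of_dominated_convergence
    (fun x => K * (1 + ‖x‖) ^ (-(-(s - 1)))) ?_ ?_ ?_ ?_
  · filter_upwards [eventually_gt_atTop 0] with R hR
    exact ((hbm R hR).mul hwc).aestronglyMeasurable
  · filter_upwards [eventually_gt_atTop 0, hb0 (max r ρ)] with R hR hR0
    refine ae_of_all _ fun x => ?_
    rcases le_or_gt ‖x‖ (max r ρ) with hx | hx
    · rw [hR0 x hx]
      simp only [zero_mul, norm_zero]
      positivity
    · rw [neg_neg]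
      refine le_trans ?_ (h x ((le_max_left _ _).trans_lt hx))
      rw [Real.norm_eq_abs, abs_mul, abs_mul]
      refine mul_le_mul_of_nonneg_right ?_ (abs_nonneg _)
      exact (hb R hR x ((le_max_right _ _).trans_lt hx)).trans (le_abs_self _)
  · exact (integrable_one_add_norm (by simpa using by linarith)).const_mul K
  · refine ae_of_all _ fun x => tendsto_const_nhds.congr' ?_
    filter_upwards [hb0 ‖x‖] with R hR
    simp [hR x le_rfl]

/-! ### Functions asymptotic to a constant -/

/-- `u` is smooth, `u = c + O(|x|⁻ᵖ)` and `∂u = O(|x|⁻ᵖ⁻¹)`. -/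
structure AsymptoticTo (p c : ℝ) (u : E n → ℝ) : Prop where
  smooth : ContDiff ℝ ∞ u
  sub : Decays (-p) (fun x => u x - c)
  pd : ∀ k, Decays (-p - 1) (pd k u)

namespace AsymptoticTo

variable {p c d : ℝ} {u v : E n → ℝ}

lemma differentiableAt (hu : AsymptoticTo p c u) {x : E n} : DifferentiableAt ℝ u x :=
  hu.smooth.differentiable (by simp) x

lemma mono {q : ℝ} (hu : AsymptoticTo p c u) (h : q ≤ p) : AsymptoticTo q c u :=
  ⟨hu.smooth, hu.sub.mono (by linarith), fun k => (hu.pd k).mono (by linarith)⟩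

lemma const (p c : ℝ) : AsymptoticTo p c (fun _ : E n => c) := by
  have h (s : ℝ) : Decays s (fun _ : E n => (0 : ℝ)) := Asymptotics.isBigO_zero _ _
  refine ⟨contDiff_const, by simpa using h _, fun k => ?_⟩
  rw [show GraphMass.pd k (fun _ : E n => c) = fun _ => 0 from funext fun x => pd_const k c x]
  exact h _

lemma tendsto (hu : AsymptoticTo p c u) (hp : 0 < p) : Tendsto u (cobounded (E n)) (𝓝 c) := by
  simpa using (hu.sub.tendsto_zero (by linarith)).add_const c

lemma decays_zero (hu : AsymptoticTo p c u) (hp : 0 < p) : Decays 0 u :=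
  Decays.of_tendsto (hu.tendsto hp)

lemma add (hu : AsymptoticTo p c u) (hv : AsymptoticTo p d v) :
    AsymptoticTo p (c + d) (fun x => u x + v x) where
  smooth := hu.smooth.add hv.smooth
  sub := (hu.sub.add hv.sub).congr' (.of_forall fun x => by simp only; ring)
  pd k := ((hu.pd k).add (hv.pd k)).congr'
    (.of_forall fun x => (pd_add hu.differentiableAt hv.differentiableAt).symm)

lemma mul (hp : 0 < p) (hu : AsymptoticTo p c u) (hv : AsymptoticTo p d v) :
    AsymptoticTo p (c * d) (fun x => u x * v x) where
  smooth := hu.smooth.mul hv.smooth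
  sub := by
    refine (((hu.decays_zero hp).mul' hv.sub (r := -p) (by simp)).add
      (hu.sub.const_mul d)).congr' (.of_forall fun x => ?_)
    simp only
    ring
  pd k := by
    refine (((hu.decays_zero hp).mul' (hv.pd k) (r := -p - 1) (by simp)).add
      ((hu.pd k).mul' (hv.decays_zero hp) (r := -p - 1) (by simp))).congr'
      (.of_forall fun x => ?_)
    rw [pd_mul hu.differentiableAt hv.differentiableAt]

lemma const_mul (hp : 0 < p) (hu : AsymptoticTo p c u) (a : ℝ) :
    AsymptoticTo p (a * c) (fun x => a * u x) :=
  mul hp (const p a) hu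

lemma sum {ι : Type*} {S : Finset ι} {c : ι → ℝ} {u : ι → E n → ℝ}
    (hu : ∀ i ∈ S, AsymptoticTo p (c i) (u i)) :
    AsymptoticTo p (∑ i ∈ S, c i) (fun x => ∑ i ∈ S, u i x) := by
  classical
  induction S using Finset.induction_on with
  | empty => simpa using const p 0
  | insert a S ha ih =>
    simp only [Finset.sum_insert ha]
    exact (hu a (by simp)).add (ih fun i hi => hu i (by simp [hi]))

lemma prod {ι : Type*} {S : Finset ι} {c : ι → ℝ} {u : ι → E n → ℝ} (hp : 0 < p)
    (hu : ∀ i ∈ S, AsymptoticTo p (c i) (u i)) :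
    AsymptoticTo p (∏ i ∈ S, c i) (fun x => ∏ i ∈ S, u i x) := by
  classical
  induction S using Finset.induction_on with
  | empty => simpa using const p 1
  | insert a S ha ih =>
    simp only [Finset.prod_insert ha]
    exact mul hp (hu a (by simp)) (ih fun i hi => hu i (by simp [hi]))

/-- Composition with a function that is smooth at the values of `u` and at their limit. -/
lemma comp (hp : 0 < p) (hu : AsymptoticTo p c u) {F : ℝ → ℝ}
    (hF : ∀ x, ContDiffAt ℝ ∞ F (u x)) (hc : ContDiffAt ℝ ∞ F c) :
    AsymptoticTo p (F c) (fun x => F (u x)) where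
  smooth := contDiff_iff_contDiffAt.2 fun x => (hF x).comp x hu.smooth.contDiffAt
  sub := ((hc.differentiableAt (by simp)).isBigO_sub.comp_tendsto (hu.tendsto hp)).trans hu.sub
  pd k := by
    have h1 : ContinuousAt (deriv F) c := by
      have : ContinuousAt (fun t => fderiv ℝ F t 1) c :=
        (hc.fderiv_right (m := 0) (by simp)).continuousAt.clm_apply continuousAt_const
      simpa using this
    have h2 : Decays 0 (fun x => deriv F (u x)) :=
      Decays.of_tendsto (h1.tendsto.comp (hu.tendsto hp))
    refine (h2.mul' (hu.pd k) (r := -p - 1) (by simp)).congr' (.of_forall fun x => ?_)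
    rw [pd_comp_real ((hF x).differentiableAt (by simp)) hu.differentiableAt]

lemma inv (hp : 0 < p) (hu : AsymptoticTo p c u) (h : ∀ x, u x ≠ 0) (hc : c ≠ 0) :
    AsymptoticTo p c⁻¹ (fun x => (u x)⁻¹) :=
  hu.comp hp (F := fun t => t⁻¹) (fun x => contDiffAt_inv ℝ (h x)) (contDiffAt_inv ℝ hc)

lemma sqrt (hp : 0 < p) (hu : AsymptoticTo p c u) (h : ∀ x, 0 < u x) (hc : 0 < c) :
    AsymptoticTo p (√c) (fun x => √(u x)) :=
  hu.comp hp (fun x => Real.contDiffAt_sqrt (h x).ne') (Real.contDiffAt_sqrt hc.ne')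

lemma det {m : Type*} [Fintype m] [DecidableEq m] (hp : 0 < p) {A : Matrix m m ℝ}
    {G : E n → Matrix m m ℝ} (h : ∀ i j, AsymptoticTo p (A i j) (fun x => G x i j)) :
    AsymptoticTo p A.det (fun x => (G x).det) := by
  simp only [Matrix.det_apply']
  exact sum fun σ _ => const_mul hp (prod hp fun i _ => h _ _) _

lemma matrix_inv {m : Type*} [Fintype m] [DecidableEq m] (hp : 0 < p) {A : Matrix m m ℝ}
    {G : E n → Matrix m m ℝ} (h : ∀ i j, AsymptoticTo p (A i j) (fun x => G x i j))
    (hG : ∀ x, (G x).det ≠ 0) (hA : A.det ≠ 0) (i j : m) :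
    AsymptoticTo p (A⁻¹ i j) (fun x => (G x)⁻¹ i j) := by
  simp only [Matrix.inv_def, Ring.inverse_eq_inv', Matrix.smul_apply, smul_eq_mul,
    Matrix.adjugate_apply]
  refine mul hp (inv hp (det hp h) hG hA) (det hp fun a b => ?_)
  by_cases hab : a = j
  · subst hab
    simpa using const p _
  · simpa [Matrix.updateRow_ne hab] using h a b

end AsymptoticTo

/-! ### The mass vector field of an asymptotically flat metric on `ℝⁿ` -/

/-- An asymptotically flat metric given by smooth coefficients on all of `ℝⁿ`, with decay
rate `p`. Only the positivity of the determinant is recorded, since positive definiteness is not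
needed. -/
structure IsAFMetric (p : ℝ) (G : E n → Matrix (Fin n) (Fin n) ℝ) : Prop where
  pos : 0 < p
  rate : ((n : ℝ) - 2) / 2 < p
  symm : ∀ x i j, G x i j = G x j i
  det_pos : ∀ x, 0 < (G x).det
  asymptotic : ∀ i j, AsymptoticTo p ((1 : Matrix (Fin n) (Fin n) ℝ) i j) (fun x => G x i j)
  integrable : Integrable fun x => scalarCurvature G x * √(G x).det

/-- `√g gⁱʲ` -/
noncomputable def densInv (G : E n → Matrix (Fin n) (Fin n) ℝ) (i j : Fin n) (x : E n) : ℝ :=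
  √(G x).det * (G x)⁻¹ i j

/-- The vector field `√g (gⁱʲ Γᵏᵢⱼ - gⁱᵏ Γʲᵢⱼ)`, whose divergence is `R √g` up to terms quadratic
in the first derivatives of the metric. -/
noncomputable def massField (G : E n → Matrix (Fin n) (Fin n) ℝ) (k : Fin n) (x : E n) : ℝ :=
  ∑ i, ∑ j, (densInv G i j x * christoffel G k i j x - densInv G i k x * christoffel G j i j x)

/-- The linearization `∂ⱼ gₖⱼ - ∂ₖ gⱼⱼ` of the mass vector field, the integrand of the ADM flux. -/
noncomputable def linearField (G : E n → Matrix (Fin n) (Fin n) ℝ) (k : Fin n) (x : E n) : ℝ :=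
  ∑ j, (pd j (fun y => G y k j) x - pd k (fun y => G y j j) x)

/-- The divergence of a vector field given by its components. -/
noncomputable def divergence (V : Fin n → E n → ℝ) (x : E n) : ℝ := ∑ k, pd k (V k) x

lemma continuous_divergence {V : Fin n → E n → ℝ} (hV : ∀ k, ContDiff ℝ 1 (V k)) :
    Continuous (divergence V) :=
  continuous_finsetSum _ fun k _ => continuous_pd (hV k) k

lemma contDiff_christoffel_of_inv {G : E n → Matrix (Fin n) (Fin n) ℝ}
    (hinv : ∀ i j, ContDiff ℝ ∞ (fun x => (G x)⁻¹ i j))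
    (hG : ∀ i j, ContDiff ℝ ∞ (fun x => G x i j)) (k i j : Fin n) :
    ContDiff ℝ ∞ (christoffel G k i j) :=
  contDiff_const.mul <| ContDiff.sum fun l _ => (hinv k l).mul
    (((contDiff_pd (hG _ _) _).add (contDiff_pd (hG _ _) _)).sub (contDiff_pd (hG _ _) _))

namespace IsAFMetric

variable {p : ℝ} {G : E n → Matrix (Fin n) (Fin n) ℝ}

lemma mono {q : ℝ} (hG : IsAFMetric p G) (hq : 0 < q) (hr : ((n : ℝ) - 2) / 2 < q) (h : q ≤ p) :
    IsAFMetric q G :=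
  ⟨hq, hr, hG.symm, hG.det_pos, fun i j => (hG.asymptotic i j).mono h, hG.integrable⟩

lemma asymptotic_inv (hG : IsAFMetric p G) (i j : Fin n) :
    AsymptoticTo p ((1 : Matrix (Fin n) (Fin n) ℝ) i j) (fun x => (G x)⁻¹ i j) := by
  simpa using AsymptoticTo.matrix_inv hG.pos hG.asymptotic (fun x => (hG.det_pos x).ne')
    (by simp) i j

lemma asymptotic_densInv (hG : IsAFMetric p G) (i j : Fin n) :
    AsymptoticTo p ((1 : Matrix (Fin n) (Fin n) ℝ) i j) (densInv G i j) := by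
  unfold densInv
  simpa using ((AsymptoticTo.det hG.pos hG.asymptotic).sqrt hG.pos hG.det_pos (by simp)).mul
    hG.pos (hG.asymptotic_inv i j)

lemma smooth (hG : IsAFMetric p G) (i j : Fin n) : ContDiff ℝ ∞ (fun x => G x i j) :=
  (hG.asymptotic i j).smooth

lemma decays_pd (hG : IsAFMetric p G) (i j k : Fin n) :
    Decays (-p - 1) (pd k (fun x => G x i j)) := (hG.asymptotic i j).pd k

lemma contDiff_christoffel (hG : IsAFMetric p G) (k i j : Fin n) :
    ContDiff ℝ ∞ (christoffel G k i j) :=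
  contDiff_christoffel_of_inv (fun k l => (hG.asymptotic_inv k l).smooth) hG.smooth k i j

/-- The Christoffel symbols agree to leading order with `½ (∂ᵢ gⱼₖ + ∂ⱼ gᵢₖ - ∂ₖ gᵢⱼ)`. -/
lemma decays_christoffel_sub (hG : IsAFMetric p G) (k i j : Fin n) :
    Decays (-2 * p - 1) (fun x => christoffel G k i j x - (1 / 2) *
      (pd i (fun y => G y j k) x + pd j (fun y => G y i k) x - pd k (fun y => G y i j) x)) := by
  have h : Decays (-2 * p - 1) (fun x => (1 / 2) * ∑ l,
      ((G x)⁻¹ k l - (1 : Matrix (Fin n) (Fin n) ℝ) k l) *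
      (pd i (fun y => G y j l) x + pd j (fun y => G y i l) x - pd l (fun y => G y i j) x)) := by
    refine (Decays.sum fun l _ => ?_).const_mul _
    exact (hG.asymptotic_inv k l).sub.mul' (((hG.decays_pd _ _ _).add (hG.decays_pd _ _ _)).sub
      (hG.decays_pd _ _ _)) (by linarith)
  refine h.congr' (.of_forall fun x => ?_)
  simp only [christoffel]
  rw [Finset.sum_congr rfl fun l _ => sub_mul _ _ _, Finset.sum_sub_distrib, mul_sub]
  congr 2
  simp [Matrix.one_apply]

lemma decays_christoffel (hG : IsAFMetric p G) (k i j : Fin n) :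
    Decays (-p - 1) (christoffel G k i j) := by
  refine (Decays.sum fun l _ => ?_).const_mul _
  exact ((hG.asymptotic_inv k l).decays_zero hG.pos).mul' (((hG.decays_pd _ _ _).add
    (hG.decays_pd _ _ _)).sub (hG.decays_pd _ _ _)) (by simp)

lemma contDiff_massField (hG : IsAFMetric p G) (k : Fin n) : ContDiff ℝ ∞ (massField G k) :=
  ContDiff.sum fun i _ => ContDiff.sum fun j _ =>
    ((hG.asymptotic_densInv i j).smooth.mul (hG.contDiff_christoffel k i j)).sub
      ((hG.asymptotic_densInv i k).smooth.mul (hG.contDiff_christoffel j i j))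

lemma contDiff_linearField (hG : IsAFMetric p G) (k : Fin n) : ContDiff ℝ ∞ (linearField G k) :=
  ContDiff.sum fun _ _ => (contDiff_pd (hG.smooth _ _) _).sub (contDiff_pd (hG.smooth _ _) _)

lemma decays_linearField (hG : IsAFMetric p G) (k : Fin n) : Decays (-p - 1) (linearField G k) :=
  Decays.sum fun _ _ => (hG.decays_pd _ _ _).sub (hG.decays_pd _ _ _)

/-- The mass vector field differs from its linearization by `O(|x|⁻²ᵖ⁻¹)`, which has no flux at
infinity because `2p + 2 > n`. -/
lemma decays_massField_sub (hG : IsAFMetric p G) (k : Fin n) :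
    Decays (-2 * p - 1) (fun x => massField G k x - linearField G k x) := by
  -- replace `√g gⁱʲ` by `δⁱʲ`, then the Christoffel symbols by their linearization
  have h1 : Decays (-2 * p - 1) (fun x => ∑ i, ∑ j,
      ((densInv G i j x - (1 : Matrix (Fin n) (Fin n) ℝ) i j) * christoffel G k i j x -
        (densInv G i k x - (1 : Matrix (Fin n) (Fin n) ℝ) i k) * christoffel G j i j x)) :=
    Decays.sum fun i _ => Decays.sum fun j _ =>
      ((hG.asymptotic_densInv i j).sub.mul' (hG.decays_christoffel k i j) (by linarith)).sub
      ((hG.asymptotic_densInv i k).sub.mul' (hG.decays_christoffel j i j) (by linarith))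
  have h2 : Decays (-2 * p - 1) (fun x => ∑ i, ((christoffel G k i i x - (1 / 2) *
      (pd i (fun y => G y i k) x + pd i (fun y => G y i k) x - pd k (fun y => G y i i) x)) -
      (christoffel G i k i x - (1 / 2) *
      (pd k (fun y => G y i i) x + pd i (fun y => G y k i) x - pd i (fun y => G y k i) x)))) :=
    Decays.sum fun i _ => (hG.decays_christoffel_sub k i i).sub (hG.decays_christoffel_sub i k i)
  refine (h1.add h2).congr' (.of_forall fun x => ?_)
  have hs (i : Fin n) : (fun y => G y i k) = fun y => G y k i := funext fun y => hG.symm y i k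
  simp only [massField, linearField, sub_mul, Finset.sum_sub_distrib, hs]
  have e1 : ∑ i, ∑ j, (1 : Matrix (Fin n) (Fin n) ℝ) i j * christoffel G k i j x =
      ∑ i, christoffel G k i i x := by simp [Matrix.one_apply]
  have e2 : ∑ i, ∑ j, (1 : Matrix (Fin n) (Fin n) ℝ) i k * christoffel G j i j x =
      ∑ i, christoffel G i k i x := by simp [Matrix.one_apply]
  have e3 : ∑ i, 1 / 2 * (pd i (fun y => G y k i) x + pd i (fun y => G y k i) x -
      pd k (fun y => G y i i) x) = ∑ i, pd i (fun y => G y k i) x -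
      ∑ i, 1 / 2 * pd k (fun y => G y i i) x := by
    rw [← Finset.sum_sub_distrib]
    exact Finset.sum_congr rfl fun i _ => by ring
  have e4 : ∑ i, 1 / 2 * (pd k (fun y => G y i i) x + pd i (fun y => G y k i) x -
      pd i (fun y => G y k i) x) = ∑ i, pd k (fun y => G y i i) x -
      ∑ i, 1 / 2 * pd k (fun y => G y i i) x := by
    rw [← Finset.sum_sub_distrib]
    exact Finset.sum_congr rfl fun i _ => by ring
  rw [e1, e2, e3, e4]
  ring

/-- The quadratic part of the scalar curvature density: `div V - R √g` for the mass vector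
field `V`. -/
lemma divergence_massField_sub (hG : IsAFMetric p G) (x : E n) :
    divergence (massField G) x - scalarCurvature G x * √(G x).det =
      ∑ k, ∑ i, ∑ j, (pd k (densInv G i j) x * christoffel G k i j x -
        pd k (densInv G i k) x * christoffel G j i j x) -
      ∑ i, ∑ j, densInv G i j x * ∑ k, ∑ l, (christoffel G k k l x * christoffel G l i j x -
        christoffel G k j l x * christoffel G l i k x) := by
  have dΓ (k i j : Fin n) : DifferentiableAt ℝ (christoffel G k i j) x :=
    (hG.contDiff_christoffel k i j).differentiable (by simp) x
  have da (i j : Fin n) : DifferentiableAt ℝ (densInv G i j) x :=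
    (hG.asymptotic_densInv i j).differentiableAt
  have h1 : divergence (massField G) x =
      ∑ k, ∑ i, ∑ j, (pd k (densInv G i j) x * christoffel G k i j x -
        pd k (densInv G i k) x * christoffel G j i j x) +
      (∑ k, ∑ i, ∑ j, densInv G i j x * pd k (christoffel G k i j) x -
        ∑ k, ∑ i, ∑ j, densInv G i k x * pd k (christoffel G j i j) x) := by
    simp only [← Finset.sum_sub_distrib, ← Finset.sum_add_distrib, divergence]
    refine Finset.sum_congr rfl fun k _ => ?_
    unfold massField
    rw [pd_sum fun i _ => by fun_prop]
    refine Finset.sum_congr rfl fun i _ => ?_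
    rw [pd_sum fun j _ => by fun_prop]
    refine Finset.sum_congr rfl fun j _ => ?_
    rw [pd_sub (by fun_prop) (by fun_prop), pd_mul (da _ _) (dΓ _ _ _), pd_mul (da _ _) (dΓ _ _ _)]
    ring
  have h2 : scalarCurvature G x * √(G x).det =
      ∑ i, ∑ j, ∑ k, densInv G i j x * pd k (christoffel G k i j) x -
        ∑ i, ∑ j, ∑ k, densInv G i j x * pd j (christoffel G k i k) x +
      ∑ i, ∑ j, densInv G i j x * ∑ k, ∑ l, (christoffel G k k l x * christoffel G l i j x -
        christoffel G k j l x * christoffel G l i k x) := by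
    rw [scalarCurvature, Finset.sum_mul, ← Finset.sum_sub_distrib, ← Finset.sum_add_distrib]
    refine Finset.sum_congr rfl fun i _ => ?_
    rw [Finset.sum_mul, ← Finset.sum_sub_distrib, ← Finset.sum_add_distrib]
    refine Finset.sum_congr rfl fun j _ => ?_
    rw [ricci, Finset.sum_add_distrib, Finset.sum_sub_distrib, ← Finset.mul_sum, ← Finset.mul_sum,
      densInv]
    ring
  have h3 : ∑ k, ∑ i, ∑ j, densInv G i j x * pd k (christoffel G k i j) x =
      ∑ i, ∑ j, ∑ k, densInv G i j x * pd k (christoffel G k i j) x := by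
    rw [Finset.sum_comm]
    exact Finset.sum_congr rfl fun i _ => Finset.sum_comm
  have h4 : ∑ k, ∑ i, ∑ j, densInv G i k x * pd k (christoffel G j i j) x =
      ∑ i, ∑ j, ∑ k, densInv G i j x * pd j (christoffel G k i k) x := Finset.sum_comm
  rw [h1, h2, h3, h4]
  ring

lemma contDiff_one_massField (hG : IsAFMetric p G) (k : Fin n) : ContDiff ℝ 1 (massField G k) :=
  (hG.contDiff_massField k).of_le (by simp)

/-- The divergence of the mass vector field is integrable, because `R √g` is and the quadratic
terms are `O(|x|⁻²ᵖ⁻²)`. -/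
lemma integrable_divergence_massField (hG : IsAFMetric p G) :
    Integrable (divergence (massField G)) := by
  have hrate := hG.rate
  have hp := hG.pos
  have hd : Decays (-2 * p - 2)
      (fun x => divergence (massField G) x - scalarCurvature G x * √(G x).det) := by
    simp only [hG.divergence_massField_sub]
    have hΓ := hG.decays_christoffel
    have ha := hG.asymptotic_densInv
    refine Decays.sub (Decays.sum fun k _ => Decays.sum fun i _ => Decays.sum fun j _ =>
      (((ha i j).pd k).mul' (hΓ k i j) (by linarith)).sub
      (((ha i k).pd k).mul' (hΓ j i j) (by linarith))) (Decays.sum fun i _ => Decays.sum fun j _ =>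
      ((ha i j).decays_zero hp).mul' (s := 0) (t := -2 * p - 2) (Decays.sum fun k _ =>
      Decays.sum fun l _ => ?_) (by simp))
    exact ((hΓ _ _ _).mul' (hΓ _ _ _) (by linarith)).sub ((hΓ _ _ _).mul' (hΓ _ _ _) (by linarith))
  have hc : Continuous
      (fun x => divergence (massField G) x - scalarCurvature G x * √(G x).det) := by
    simp only [hG.divergence_massField_sub]
    have hΓ k i j := (hG.contDiff_christoffel k i j).continuous
    have ha i j := (hG.asymptotic_densInv i j).smooth.continuous
    have ha' k i j := (contDiff_pd (hG.asymptotic_densInv i j).smooth k).continuous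
    fun_prop
  have := (hd.integrable (by linarith) hc).add hG.integrable
  simpa [Pi.add_def] using this

end IsAFMetric

/-! ### The divergence theorem at infinity -/

/-- The divergence theorem for compactly supported fields. -/
lemma integral_mul_divergence {u : E n → ℝ} {V : Fin n → E n → ℝ} (hu : ContDiff ℝ 1 u)
    (hc : HasCompactSupport u) (hV : ∀ k, ContDiff ℝ 1 (V k)) :
    ∫ x, u x * divergence V x = -∫ x, ∑ k, pd k u x * V k x := by
  simp only [divergence, Finset.mul_sum]
  rw [integral_finsetSum, integral_finsetSum, ← Finset.sum_neg_distrib]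
  · exact Finset.sum_congr rfl fun k _ => integral_mul_pd_eq_neg hu (hV k) hc k
  · exact fun k _ => ((continuous_pd hu k).mul (hV k).continuous).integrable_of_hasCompactSupport
      (hasCompactSupport_pd hc k).mul_right
  · exact fun k _ => (hu.continuous.mul (continuous_pd (hV k) k)).integrable_of_hasCompactSupport
      hc.mul_right

/-- Integration in polar coordinates, with the angular integral inside. -/
lemma integral_polar (hn : 0 < n) {F : E n → ℝ} (hF : Integrable F) :
    ∫ x, F x = ∫ s in Ioi (0 : ℝ), s ^ (n - 1) *
      ∫ ν : Metric.sphere (0 : E n) 1, F (s • (ν : E n)) ∂(volume : Measure (E n)).toSphere := by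
  have : Nontrivial (E n) := by
    have : Nonempty (Fin n) := ⟨⟨0, hn⟩⟩
    infer_instance
  have hdim : Module.finrank ℝ (E n) = n := by simp
  have hmp := (volume : Measure (E n)).measurePreserving_homeomorphUnitSphereProd
  have hemb := (homeomorphUnitSphereProd (E n)).measurableEmbedding
  set g : Metric.sphere (0 : E n) 1 × Ioi (0 : ℝ) → ℝ := fun z => F (z.2.1 • z.1.1) with hg
  have hgF (x : ({0}ᶜ : Set (E n))) : g (homeomorphUnitSphereProd (E n) x) = F x.1 := by
    have hx : ‖x.1‖ ≠ 0 := norm_ne_zero_iff.2 x.2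
    simp [hg, smul_smul, mul_inv_cancel₀ hx]
  have h1 : ∫ x, F x = ∫ z, g z ∂((volume : Measure (E n)).toSphere.prod
      (Measure.volumeIoiPow (n - 1))) := by
    have h2 := hmp.integral_comp hemb g
    rw [hdim] at h2
    rw [← h2]
    simp only [hgF]
    rw [integral_subtype_comap (measurableSet_singleton _).compl fun x ↦ F x,
      restrict_compl_singleton]
  have hgi : Integrable g ((volume : Measure (E n)).toSphere.prod
      (Measure.volumeIoiPow (n - 1))) := by
    have h2 := hmp.integrable_comp_emb hemb (g := g)
    rw [hdim] at h2
    rw [← h2]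
    have h3 : g ∘ homeomorphUnitSphereProd (E n) = fun x => F x.1 := funext hgF
    rw [h3]
    rw [show (fun x : ({0}ᶜ : Set (E n)) => F x.1) = F ∘ Subtype.val from rfl,
      ← integrableOn_iff_comap_subtypeVal (measurableSet_singleton _).compl]
    exact hF.integrableOn
  rw [h1, integral_prod_symm _ hgi]
  simp only [Measure.volumeIoiPow, ENNReal.ofReal]
  rw [integral_withDensity_eq_integral_smul,
    integral_subtype_comap measurableSet_Ioi fun a ↦ Real.toNNReal (a ^ (n - 1)) •
      ∫ ν : Metric.sphere (0 : E n) 1, F (a • (ν : E n)) ∂(volume : Measure (E n)).toSphere,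
    setIntegral_congr_fun measurableSet_Ioi fun x hx ↦ ?_]
  · simp only [NNReal.smul_def, Real.coe_toNNReal _ (pow_nonneg hx.out.le _), smul_eq_mul]
  · exact (measurable_subtype_coe.pow_const _).real_toNNReal

/-- The flux of a vector field through the sphere of radius `r`. -/
noncomputable def flux (V : Fin n → E n → ℝ) (r : ℝ) : ℝ :=
  r ^ (n - 1) * ∫ ν : Metric.sphere (0 : E n) 1, (∑ i, V i (r • (ν : E n)) * (ν : E n) i)
    ∂(volume : Measure (E n)).toSphere

lemma integrable_sphere {F : Metric.sphere (0 : E n) 1 → ℝ} (hF : Continuous F) :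
    Integrable F (volume : Measure (E n)).toSphere :=
  hF.integrable_of_hasCompactSupport (HasCompactSupport.of_compactSpace F)

lemma continuous_flux {V : Fin n → E n → ℝ} (hV : ∀ k, Continuous (V k)) :
    Continuous (flux V) := by
  refine (continuous_pow _).mul (continuous_parametric_integral_of_continuous (s := univ) ?_
    isCompact_univ |>.congr fun r => by rw [setIntegral_univ])
  fun_prop

lemma hasFDerivAt_norm {x : E n} (hx : x ≠ 0) :
    HasFDerivAt (fun y : E n => ‖y‖) (‖x‖⁻¹ • innerSL ℝ x) x := by
  have hx' : ‖x‖ ≠ 0 := norm_ne_zero_iff.2 hx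
  have h := (hasStrictFDerivAt_norm_sq x).hasFDerivAt.sqrt (pow_ne_zero 2 hx')
  simp only [Real.sqrt_sq (norm_nonneg _)] at h
  refine h.congr_fderiv ?_
  ext v
  simp
  field_simp

/-- For every radius there is a cutoff function against which the divergence of `V` integrates to
nearly the flux of `V`: minus its radial derivative is a bump function concentrated near the
radius. -/
lemma exists_cutoff_flux (hn : 0 < n) {V : Fin n → E n → ℝ} (hV : ∀ k, ContDiff ℝ 1 (V k))
    {r : ℝ} (hr : 1 < r) :
    ∃ u : E n → ℝ, Continuous u ∧ (∀ x, |u x| ≤ 1) ∧ (∀ x, ‖x‖ < r - 1 → u x = 1) ∧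
      |(∫ x, u x * divergence V x) - flux V r| ≤ 1 / r := by
  have hr0 : 0 < r := by linarith
  have hVc k : Continuous (V k) := (hV k).continuous
  obtain ⟨ε, hε, hεr⟩ := Metric.continuousAt_iff.1 (continuous_flux hVc).continuousAt (1 / r)
    (by positivity)
  set η := min ε 1
  have hη : 0 < η := by positivity
  have hη1 : η ≤ 1 := min_le_right _ _
  let b : ContDiffBump r := ⟨η / 2, η, by positivity, by linarith⟩
  set ψ : ℝ → ℝ := b.normed volume
  have hψc : Continuous ψ := b.continuous_normed
  have hψ0 (s : ℝ) : 0 ≤ ψ s := b.nonneg_normed s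
  have hψi : Integrable ψ := b.integrable_normed
  have hψ1 : ∫ s, ψ s = 1 := b.integral_normed
  have hψs (s : ℝ) (hs : η ≤ |s - r|) : ψ s = 0 := by
    by_contra h
    have : s ∈ Function.support ψ := h
    rw [b.support_normed_eq, Metric.mem_ball, Real.dist_eq] at this
    exact absurd this (not_lt.2 hs)
  -- the radial profile
  set φ : ℝ → ℝ := fun s => 1 - ∫ t in (0 : ℝ)..s, ψ t with hφ
  have hφd (s : ℝ) : HasDerivAt φ (-ψ s) s := by
    simpa using (intervalIntegral.integral_hasDerivAt_right (hψc.intervalIntegrable _ _)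
      (hψc.stronglyMeasurableAtFilter _ _) hψc.continuousAt).const_sub 1
  have hφC : ContDiff ℝ 1 φ := by
    refine contDiff_one_iff_deriv.2 ⟨fun s => (hφd s).differentiableAt, ?_⟩
    rw [show deriv φ = fun s => -ψ s from funext fun s => (hφd s).deriv]
    exact hψc.neg
  have hφin (s : ℝ) (hs0 : 0 ≤ s) (hs : s ≤ r - η) : φ s = 1 := by
    have : ∫ t in (0 : ℝ)..s, ψ t = 0 := by
      rw [intervalIntegral.integral_congr (g := fun _ => (0 : ℝ))]
      · simp
      · intro t ht
        rw [uIcc_of_le hs0] at ht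
        refine hψs t ?_
        rw [abs_sub_comm]
        exact le_trans (by linarith [ht.2]) (le_abs_self _)
    simp [hφ, this]
  have hφout (s : ℝ) (hs : r + η ≤ s) : φ s = 0 := by
    have hs0 : 0 ≤ s := by linarith
    have : ∫ t in (0 : ℝ)..s, ψ t = 1 := by
      rw [intervalIntegral.integral_of_le hs0, setIntegral_eq_integral_of_forall_compl_eq_zero,
        hψ1]
      intro t ht
      refine hψs t ?_
      rw [mem_Ioc, not_and_or, not_lt, not_le] at ht
      rcases ht with ht | ht
      · rw [abs_sub_comm]
        exact le_trans (by linarith) (le_abs_self _)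
      · exact le_trans (by linarith) (le_abs_self _)
    simp [hφ, this]
  have hφ01 (s : ℝ) (hs0 : 0 ≤ s) : |φ s| ≤ 1 := by
    have h0 : 0 ≤ ∫ t in (0 : ℝ)..s, ψ t :=
      intervalIntegral.integral_nonneg hs0 fun t _ => hψ0 t
    have h1 : ∫ t in (0 : ℝ)..s, ψ t ≤ 1 := by
      rw [intervalIntegral.integral_of_le hs0, ← hψ1]
      exact setIntegral_le_integral hψi (ae_of_all _ hψ0)
    rw [abs_le]
    constructor <;> simp only [hφ] <;> linarith
  have hpd (x : E n) : HasFDerivAt (fun y : E n => φ ‖y‖)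
      ((-ψ ‖x‖) • (‖x‖⁻¹ • innerSL ℝ x)) x := by
    rcases lt_or_ge ‖x‖ (r - η) with hx | hx
    · rw [hψs ‖x‖ (by rw [abs_sub_comm]; exact le_trans (by linarith) (le_abs_self _)), neg_zero,
        zero_smul]
      refine (hasFDerivAt_const (1 : ℝ) x).congr_of_eventuallyEq ?_
      filter_upwards [continuous_norm.continuousAt.eventually (gt_mem_nhds hx)] with y hy
      exact hφin _ (norm_nonneg y) (le_of_lt hy)
    · have hx0 : x ≠ 0 := by
        rintro rfl
        rw [norm_zero] at hx
        linarith
      exact (hφd ‖x‖).comp_hasFDerivAt x (hasFDerivAt_norm hx0)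
  have huC : ContDiff ℝ 1 (fun y : E n => φ ‖y‖) := by
    refine contDiff_iff_contDiffAt.2 fun x => ?_
    rcases lt_or_ge ‖x‖ (r - η) with hx | hx
    · refine (contDiffAt_const (c := (1 : ℝ))).congr_of_eventuallyEq ?_
      filter_upwards [continuous_norm.continuousAt.eventually (gt_mem_nhds hx)] with y hy
      exact hφin _ (norm_nonneg y) (le_of_lt hy)
    · have hx0 : x ≠ 0 := by
        rintro rfl
        rw [norm_zero] at hx
        linarith
      exact hφC.contDiffAt.comp x (contDiffAt_norm ℝ hx0)
  have huK : HasCompactSupport (fun y : E n => φ ‖y‖) := by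
    refine HasCompactSupport.intro (isCompact_closedBall 0 (r + η)) fun x hx => ?_
    rw [mem_closedBall_zero_iff, not_le] at hx
    exact hφout _ hx.le
  have hpdk (k : Fin n) (x : E n) : pd k (fun y : E n => φ ‖y‖) x = -ψ ‖x‖ * (‖x‖⁻¹ * x k) := by
    simp only [pd, (hpd x).fderiv]
    simp [EuclideanSpace.inner_single_right]
  have key : ∫ x, φ ‖x‖ * divergence V x = ∫ s, ψ s * flux V s := by
    have hF : Integrable fun x : E n => ∑ k, -(pd k (fun y : E n => φ ‖y‖) x * V k x) :=
      integrable_finsetSum _ fun k _ => (((continuous_pd huC k).mul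
        (hVc k)).integrable_of_hasCompactSupport (hasCompactSupport_pd huK k).mul_right).neg
    calc ∫ x, φ ‖x‖ * divergence V x =
          ∫ x, ∑ k, -(pd k (fun y : E n => φ ‖y‖) x * V k x) := by
          simp only [integral_mul_divergence huC huK hV, Finset.sum_neg_distrib, integral_neg]
      _ = ∫ s in Ioi (0 : ℝ), ψ s * flux V s := by
          rw [integral_polar hn hF]
          refine setIntegral_congr_fun measurableSet_Ioi fun s hs => ?_
          simp only [flux]
          rw [mul_left_comm]
          congr 1
          rw [← integral_const_mul]
          refine integral_congr_ae (ae_of_all _ fun ν => ?_)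
          have hν : ‖(ν : E n)‖ = 1 := by simp
          have hs' : ‖s • (ν : E n)‖ = s := by
            rw [norm_smul, hν, mul_one, Real.norm_of_nonneg hs.out.le]
          simp only [Finset.mul_sum]
          refine Finset.sum_congr rfl fun k _ => ?_
          rw [hpdk, hs', PiLp.smul_apply, smul_eq_mul, inv_mul_cancel_left₀ hs.out.ne']
          ring
      _ = ∫ s, ψ s * flux V s := by
          refine setIntegral_eq_integral_of_forall_compl_eq_zero fun s hs => ?_
          rw [hψs s, zero_mul]
          rw [mem_Ioi, not_lt] at hs
          rw [abs_sub_comm]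
          exact le_trans (by linarith) (le_abs_self _)
  refine ⟨fun y => φ ‖y‖, huC.continuous, fun x => hφ01 _ (norm_nonneg x),
    fun x hx => hφin _ (norm_nonneg x) (by linarith), ?_⟩
  have hψK : HasCompactSupport ψ := b.hasCompactSupport_normed
  have h1 : (∫ s, ψ s * flux V s) - flux V r = ∫ s, ψ s * (flux V s - flux V r) := by
    simp only [mul_sub]
    rw [integral_sub, integral_mul_const (flux V r) ψ, hψ1, one_mul]
    · exact (hψc.mul (continuous_flux hVc)).integrable_of_hasCompactSupport hψK.mul_right
    · exact hψi.mul_const _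
  simp only
  rw [key, h1, ← Real.norm_eq_abs]
  calc ‖∫ s, ψ s * (flux V s - flux V r)‖ ≤ ∫ s, ψ s * (1 / r) := by
        refine norm_integral_le_of_norm_le (hψi.mul_const _) (ae_of_all _ fun s => ?_)
        rw [norm_mul, Real.norm_of_nonneg (hψ0 s)]
        by_cases hs : η ≤ |s - r|
        · simp [hψs s hs]
        · refine mul_le_mul_of_nonneg_left (le_of_lt ?_) (hψ0 s)
          exact hεr (lt_of_lt_of_le (not_le.1 hs) (min_le_left _ _))
    _ = 1 / r := by rw [integral_mul_const (1 / r) ψ, hψ1, one_mul]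

/-- Integrating against cutoff functions that exhaust the space. -/
lemma tendsto_integral_cutoff {F : E n → ℝ} (hF : Integrable F) {u : ℝ → E n → ℝ}
    (hu : ∀ᶠ R in atTop, Continuous (u R)) (hu1 : ∀ᶠ R in atTop, ∀ x, |u R x| ≤ 1)
    (hlim : ∀ x, ∀ᶠ R in atTop, u R x = 1) :
    Tendsto (fun R => ∫ x, u R x * F x) atTop (𝓝 (∫ x, F x)) := by
  refine tendsto_integral_filter_of_dominated_convergence (fun x => ‖F x‖) ?_ ?_ hF.norm ?_
  · filter_upwards [hu] with R hR using hR.aestronglyMeasurable.mul hF.aestronglyMeasurable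
  · filter_upwards [hu1] with R hR
    refine ae_of_all _ fun x => ?_
    rw [norm_mul]
    exact mul_le_of_le_one_left (norm_nonneg _) (hR x)
  · refine ae_of_all _ fun x => tendsto_const_nhds.congr' ?_
    filter_upwards [hlim x] with R hR
    rw [hR, one_mul]

/-- The divergence theorem on all of space. -/
lemma tendsto_flux (hn : 0 < n) {V : Fin n → E n → ℝ} (hV : ∀ k, ContDiff ℝ 1 (V k))
    (hi : Integrable (divergence V)) :
    Tendsto (flux V) atTop (𝓝 (∫ x, divergence V x)) := by
  have hex (r : ℝ) : ∃ u : E n → ℝ, 1 < r → Continuous u ∧ (∀ x, |u x| ≤ 1) ∧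
      (∀ x, ‖x‖ < r - 1 → u x = 1) ∧ |(∫ x, u x * divergence V x) - flux V r| ≤ 1 / r := by
    by_cases hr : 1 < r
    · obtain ⟨u, hu⟩ := exists_cutoff_flux hn hV hr
      exact ⟨u, fun _ => hu⟩
    · exact ⟨0, fun h => absurd h hr⟩
  choose u hu using hex
  have h1 : Tendsto (fun R => ∫ x, u R x * divergence V x) atTop (𝓝 (∫ x, divergence V x)) := by
    refine tendsto_integral_cutoff hi ?_ ?_ fun x => ?_
    · filter_upwards [eventually_gt_atTop 1] with R hR using (hu R hR).1
    · filter_upwards [eventually_gt_atTop 1] with R hR using (hu R hR).2.1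
    · filter_upwards [eventually_gt_atTop 1, eventually_gt_atTop (‖x‖ + 1)] with R hR hR'
      exact (hu R hR).2.2.1 x (by linarith)
  have h2 : Tendsto (fun R => (∫ x, u R x * divergence V x) - flux V R) atTop (𝓝 0) := by
    refine squeeze_zero_norm' ?_ (tendsto_const_nhds.div_atTop tendsto_id : Tendsto
      (fun r : ℝ => 1 / r) atTop (𝓝 0))
    filter_upwards [eventually_gt_atTop 1] with R hR using (hu R hR).2.2.2
  simpa using h1.sub h2

lemma abs_coord_le_norm (x : E n) (i : Fin n) : |x i| ≤ ‖x‖ := PiLp.norm_apply_le x i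

/-- Fields that decay fast enough have no flux at infinity. -/
lemma tendsto_flux_zero {s : ℝ} {V : Fin n → E n → ℝ} (hn : 0 < n)
    (hd : ∀ k, Decays s (V k)) (hs : s + ((n : ℝ) - 1) < 0) :
    Tendsto (flux V) atTop (𝓝 0) := by
  choose C r hC hr h using fun k => (hd k).exists_bound
  set μ := (volume : Measure (E n)).toSphere
  have hlim : Tendsto (fun t : ℝ => (∑ k, C k) * μ.real univ * t ^ (-(-(s + ((n : ℝ) - 1)))))
      atTop (𝓝 0) := by
    simpa using (tendsto_rpow_neg_atTop (y := -(s + ((n : ℝ) - 1))) (by linarith)).const_mul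
      ((∑ k, C k) * μ.real univ)
  refine squeeze_zero_norm' ?_ hlim
  filter_upwards [eventually_gt_atTop (∑ k, r k), eventually_gt_atTop 0] with t ht ht0
  have hb (ν : Metric.sphere (0 : E n) 1) :
      ‖∑ i, V i (t • (ν : E n)) * (ν : E n) i‖ ≤ (∑ k, C k) * t ^ s := by
    have hν : ‖(ν : E n)‖ = 1 := by simp
    have hνt : ‖t • (ν : E n)‖ = t := by rw [norm_smul, hν, mul_one, Real.norm_of_nonneg ht0.le]
    rw [Finset.sum_mul]
    refine norm_sum_le_of_le _ fun k _ => ?_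
    have h1 : |(ν : E n) k| ≤ 1 := (abs_coord_le_norm _ k).trans_eq hν
    have h2 : r k < t := lt_of_le_of_lt
      (Finset.single_le_sum (f := r) (fun i _ => by linarith [hr i]) (Finset.mem_univ k)) ht
    have h3 := h k (t • (ν : E n)) (by rwa [hνt])
    rw [hνt] at h3
    rw [norm_mul]
    exact (mul_le_of_le_one_right (norm_nonneg _) h1).trans h3
  have h1 := norm_integral_le_of_norm_le_const (μ := μ) (ae_of_all _ hb)
  rw [flux, norm_mul, Real.norm_of_nonneg (by positivity : (0 : ℝ) ≤ t ^ (n - 1))]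
  calc t ^ (n - 1) * _ ≤ t ^ (n - 1) * ((∑ k, C k) * t ^ s * μ.real univ) := by gcongr
    _ = _ := by
      rw [neg_neg, Real.rpow_add ht0, ← Nat.cast_pred hn, Real.rpow_natCast]
      ring

lemma flux_sub {V W : Fin n → E n → ℝ} (hV : ∀ k, Continuous (V k)) (hW : ∀ k, Continuous (W k))
    (r : ℝ) : flux (fun k x => V k x - W k x) r = flux V r - flux W r := by
  simp only [flux, sub_mul, Finset.sum_sub_distrib]
  rw [integral_sub, mul_sub]
  · exact integrable_sphere (by fun_prop)
  · exact integrable_sphere (by fun_prop)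

lemma admFlux_eq (G : E n → Matrix (Fin n) (Fin n) ℝ) (r : ℝ) :
    admFlux G r = 1 / (2 * ((n : ℝ) - 1) * sphereArea n) * flux (linearField G) r := by
  simp only [admFlux, flux, linearField, Finset.sum_mul]

/-- The mass of an asymptotically flat metric on `ℝⁿ` is, up to a constant, the integral of the
divergence of the mass vector field. -/
lemma IsAFMetric.tendsto_admFlux (hn : 0 < n) {p : ℝ} {G : E n → Matrix (Fin n) (Fin n) ℝ}
    (hG : IsAFMetric p G) : Tendsto (admFlux G) atTop
      (𝓝 (1 / (2 * ((n : ℝ) - 1) * sphereArea n) * ∫ x, divergence (massField G) x)) := by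
  have h1 := tendsto_flux hn hG.contDiff_one_massField hG.integrable_divergence_massField
  have h2 := tendsto_flux_zero hn hG.decays_massField_sub (by linarith [hG.rate])
  have h3 := h1.sub h2
  simp only [flux_sub (fun k => (hG.contDiff_massField k).continuous)
    (fun k => (hG.contDiff_linearField k).continuous), sub_sub_cancel, sub_zero] at h3
  exact (h3.const_mul _).congr fun r => (admFlux_eq G r).symm

/-! ### Functions with decaying gradient -/

lemma norm_fderiv_le_sum (u : E n → ℝ) (x : E n) : ‖fderiv ℝ u x‖ ≤ ∑ k, |pd k u x| := by
  refine ContinuousLinearMap.opNorm_le_bound _ (Finset.sum_nonneg fun _ _ => abs_nonneg _)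
    fun v => ?_
  rw [fderiv_apply_eq_sum, Finset.sum_mul]
  refine norm_sum_le_of_le _ fun k _ => ?_
  rw [norm_mul, mul_comm]
  exact mul_le_mul_of_nonneg_left (abs_coord_le_norm v k) (abs_nonneg _)

lemma Decays.norm_fderiv {s : ℝ} {u : E n → ℝ} (h : ∀ k, Decays s (pd k u)) :
    Decays s (fun x => ‖fderiv ℝ u x‖) := by
  refine (Decays.sum (S := Finset.univ) fun k _ => (h k).abs).of_abs_le
    (.of_forall fun x => ?_)
  rw [abs_of_nonneg (norm_nonneg _)]
  exact (norm_fderiv_le_sum u x).trans (le_abs_self _)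

/-- A function with bounded gradient grows at most linearly. -/
lemma Decays.of_pd_zero {u : E n → ℝ} (hu : ContDiff ℝ ∞ u) (h : ∀ k, Decays 0 (pd k u)) :
    Decays 1 u := by
  obtain ⟨C, r, hC, hr, hb⟩ := (Decays.norm_fderiv h).exists_bound
  obtain ⟨K, hK⟩ := (isCompact_closedBall (0 : E n) r).exists_bound_of_continuousOn
    (hu.continuous_fderiv (by simp)).continuousOn
  have hL (x : E n) : ‖fderiv ℝ u x‖ ≤ max C K := by
    rcases le_or_gt ‖x‖ r with hx | hx
    · exact (hK x (by simpa using hx)).trans (le_max_right _ _)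
    · have := hb x hx
      simp only [Real.rpow_zero, mul_one, abs_norm] at this
      exact this.trans (le_max_left _ _)
  have hC' : 0 < max C K := lt_max_of_lt_left hC
  refine Asymptotics.IsBigO.of_bound (|u 0| + max C K) ?_
  filter_upwards [eventually_norm_gt 1] with x hx
  have h1 := convex_univ.norm_image_sub_le_of_norm_fderiv_le (𝕜 := ℝ)
    (fun y _ => hu.differentiable (by simp) y) (fun y _ => hL y) (mem_univ (0 : E n)) (mem_univ x)
  rw [sub_zero, Real.norm_eq_abs] at h1
  have h2 : |u x| ≤ |u 0| + |u x - u 0| := by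
    have := abs_add_le (u 0) (u x - u 0)
    rwa [add_sub_cancel] at this
  rw [Real.rpow_one, norm_norm, Real.norm_eq_abs, add_mul]
  nlinarith [abs_nonneg (u 0)]

/-- Two vectors have a common orthogonal vector of any given length, for which
`n ≥ 3` is needed. -/
lemma exists_orthogonal_pair (hn : 3 ≤ n) (x y : E n) {ρ : ℝ} (hρ : 0 ≤ ρ) :
    ∃ z : E n, ‖z‖ = ρ ∧ inner ℝ z x = 0 ∧ inner ℝ z y = 0 := by
  classical
  set S := Submodule.span ℝ (({x, y} : Finset (E n)) : Set (E n))
  have h1 : Module.finrank ℝ S ≤ 2 := (finrank_span_finset_le_card _).trans Finset.card_le_two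
  have h2 := S.finrank_add_finrank_orthogonal
  rw [finrank_euclideanSpace_fin] at h2
  have h3 : Sᗮ ≠ ⊥ := by
    intro h
    rw [h, finrank_bot] at h2
    omega
  obtain ⟨z, hz, hz0⟩ := Submodule.exists_mem_ne_zero_of_ne_bot h3
  have hzn : ‖z‖ ≠ 0 := norm_ne_zero_iff.2 hz0
  have hx : inner ℝ z x = 0 :=
    (Submodule.mem_orthogonal' S z).1 hz x (Submodule.subset_span (by simp))
  have hy : inner ℝ z y = 0 :=
    (Submodule.mem_orthogonal' S z).1 hz y (Submodule.subset_span (by simp))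
  refine ⟨(ρ / ‖z‖) • z, ?_, ?_, ?_⟩
  · rw [norm_smul, norm_div, norm_norm, div_mul_cancel₀ _ hzn, Real.norm_of_nonneg hρ]
  · rw [real_inner_smul_left, hx, mul_zero]
  · rw [real_inner_smul_left, hy, mul_zero]

/-- A function whose gradient is `O(|x|⁻ᵖ⁻¹)` has a limit at infinity, at the rate `|x|⁻ᵖ`. Points
are compared along rays, and along segments between orthogonal vectors of the same length. -/
lemma exists_limit_of_decays_pd (hn : 3 ≤ n) {p : ℝ} (hp : 0 < p) {u : E n → ℝ}
    (hu : ContDiff ℝ ∞ u) (h : ∀ k, Decays (-p - 1) (pd k u)) :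
    ∃ a : ℝ, Decays (-p) (fun x => u x - a) := by
  obtain ⟨C, r, hC, hr, hb⟩ := (Decays.norm_fderiv h).exists_bound
  simp only [abs_norm] at hb
  have hud (y : E n) : DifferentiableAt ℝ u y := hu.differentiable (by simp) y
  -- orthogonal vectors of the same length lie in a half-space away from the origin
  have horth (x y : E n) (ρ : ℝ) (hρ : 2 * r < ρ) (hx : ‖x‖ = ρ) (hy : ‖y‖ = ρ)
      (hxy : inner ℝ x y = 0) : |u x - u y| ≤ C * 2 ^ (p + 2) * ρ ^ (-p) := by
    have hρ0 : 0 < ρ := by linarith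
    have hs : Convex ℝ {z : E n | ρ ^ 2 ≤ inner ℝ (x + y) z} :=
      convex_halfSpace_ge (innerSL ℝ (x + y)).isLinear _
    have hnorm : ‖x + y‖ ≤ 2 * ρ := (norm_add_le x y).trans (by linarith)
    have hz (z : E n) (hz : z ∈ {z : E n | ρ ^ 2 ≤ inner ℝ (x + y) z}) : ρ / 2 ≤ ‖z‖ := by
      have h1 : ρ ^ 2 ≤ ‖x + y‖ * ‖z‖ := le_trans hz (real_inner_le_norm _ _)
      have h2 : ‖x + y‖ * ‖z‖ ≤ 2 * ρ * ‖z‖ := by gcongr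
      by_contra hcon
      push Not at hcon
      nlinarith
    have h1 := hs.norm_image_sub_le_of_norm_fderiv_le (𝕜 := ℝ) (f := u)
      (C := C * (ρ / 2) ^ (-p - 1)) (fun z _ => hud z)
      (fun z hzm => (hb z (by linarith [hz z hzm])).trans (mul_le_mul_of_nonneg_left
        (Real.rpow_le_rpow_of_nonpos (by positivity) (hz z hzm) (by linarith)) hC.le))
      (x := y) (y := x)
      (by simp [inner_add_left, hxy, hy])
      (by simp [inner_add_left, real_inner_comm, hxy, hx])
    have h2 : ‖x - y‖ ≤ 2 * ρ := (norm_sub_le x y).trans (by linarith)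
    refine h1.trans ((mul_le_mul_of_nonneg_left h2
      (mul_nonneg hC.le (Real.rpow_nonneg (by linarith) _))).trans_eq ?_)
    rw [Real.div_rpow hρ0.le (by norm_num : (0 : ℝ) ≤ 2), show -p - 1 = -p + (-1) by ring,
      Real.rpow_add hρ0, Real.rpow_neg_one, show (-p + -1 : ℝ) = -(p + 1) by ring,
      Real.rpow_neg (by norm_num : (0 : ℝ) ≤ 2), show p + 2 = (p + 1) + 1 by ring,
      Real.rpow_add (by norm_num : (0 : ℝ) < 2) (p + 1) 1, Real.rpow_one]
    field_simp
  have hsphere (x y : E n) (ρ : ℝ) (hρ : 2 * r < ρ) (hx : ‖x‖ = ρ) (hy : ‖y‖ = ρ) :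
      |u x - u y| ≤ 2 * (C * 2 ^ (p + 2)) * ρ ^ (-p) := by
    obtain ⟨z, hz, hzx, hzy⟩ := exists_orthogonal_pair hn x y (by linarith : 0 ≤ ρ)
    have h1 := horth z x ρ hρ hz hx hzx
    have h2 := horth z y ρ hρ hz hy hzy
    rw [abs_sub_comm] at h1
    have := abs_sub_le (u x) (u z) (u y)
    linarith
  have hray (x : E n) (hx : 2 * r < ‖x‖) (t : ℝ) (ht : 1 ≤ t) :
      |u (t • x) - u x| ≤ C / p * ‖x‖ ^ (-p) := by
    have hx0 : 0 < ‖x‖ := by linarith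
    have hg (s : ℝ) : HasDerivAt (fun s : ℝ => u (s • x) - u x) (fderiv ℝ u (s • x) x) s := by
      have h1 : HasDerivAt (fun s : ℝ => s • x) x s := by
        simpa using (hasDerivAt_id s).smul_const x
      exact ((hud (s • x)).hasFDerivAt.comp_hasDerivAt s h1).sub_const _
    have hB (s : ℝ) (hs : 0 < s) : HasDerivAt (fun s : ℝ => C / p * ‖x‖ ^ (-p) * (1 - s ^ (-p)))
        (C * ‖x‖ ^ (-p) * s ^ (-p - 1)) s := by
      have := ((Real.hasDerivAt_rpow_const (x := s) (p := -p)
        (Or.inl hs.ne')).const_sub 1).const_mul (C / p * ‖x‖ ^ (-p))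
      refine this.congr_deriv ?_
      rw [show C / p * ‖x‖ ^ (-p) * -(-p * s ^ (-p - 1)) =
        C * ‖x‖ ^ (-p) * s ^ (-p - 1) * (p / p) by ring, div_self hp.ne', mul_one]
    have := image_norm_le_of_norm_deriv_right_le_deriv_boundary' (a := 1) (b := t)
      (f := fun s : ℝ => u (s • x) - u x) (f' := fun s => fderiv ℝ u (s • x) x)
      (B := fun s : ℝ => C / p * ‖x‖ ^ (-p) * (1 - s ^ (-p)))
      (B' := fun s => C * ‖x‖ ^ (-p) * s ^ (-p - 1))
      (fun s _ => (hg s).continuousAt.continuousWithinAt) (fun s _ => (hg s).hasDerivWithinAt)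
      (by simp) (fun s hs => (hB s (by linarith [hs.1])).continuousAt.continuousWithinAt)
      (fun s hs => (hB s (by linarith [hs.1])).hasDerivWithinAt) (fun s hs => ?_)
      (right_mem_Icc.2 ht)
    · refine this.trans (mul_le_of_le_one_right (by positivity) ?_)
      have : 0 ≤ t ^ (-p) := by positivity
      linarith
    · have hs0 : 0 < s := by linarith [hs.1]
      have hsx : ‖s • x‖ = s * ‖x‖ := by rw [norm_smul, Real.norm_of_nonneg hs0.le]
      have h1 := hb (s • x) (by rw [hsx]; nlinarith [hs.1])
      refine (ContinuousLinearMap.le_opNorm _ _).trans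
        ((mul_le_mul_of_nonneg_right h1 (norm_nonneg x)).trans_eq ?_)
      rw [hsx, Real.mul_rpow hs0.le hx0.le, show -p - 1 = -p + (-1) by ring,
        Real.rpow_add hx0, Real.rpow_neg_one]
      field_simp
  set K := 2 * (C * 2 ^ (p + 2)) + C / p
  have hK : 0 < K := by positivity
  have hmain (x y : E n) (hx : 2 * r < ‖x‖) (hxy : ‖x‖ ≤ ‖y‖) : |u y - u x| ≤ K * ‖x‖ ^ (-p) := by
    have hx0 : 0 < ‖x‖ := by linarith
    have ht : 1 ≤ ‖y‖ / ‖x‖ := (one_le_div hx0).2 hxy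
    have hn' : ‖(‖y‖ / ‖x‖) • x‖ = ‖y‖ := by
      rw [norm_smul, norm_div, norm_norm, norm_norm, div_mul_cancel₀ _ hx0.ne']
    have h1 := hray x hx _ ht
    have h2 := hsphere y ((‖y‖ / ‖x‖) • x) ‖y‖ (hx.trans_le hxy) rfl hn'
    have h3 : ‖y‖ ^ (-p) ≤ ‖x‖ ^ (-p) := Real.rpow_le_rpow_of_nonpos hx0 hxy (by linarith)
    have h4 := abs_sub_le (u y) (u ((‖y‖ / ‖x‖) • x)) (u x)
    have h5 : 2 * (C * 2 ^ (p + 2)) * ‖y‖ ^ (-p) ≤ 2 * (C * 2 ^ (p + 2)) * ‖x‖ ^ (-p) := by gcongr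
    calc _ ≤ _ := h4
      _ ≤ 2 * (C * 2 ^ (p + 2)) * ‖x‖ ^ (-p) + C / p * ‖x‖ ^ (-p) := by linarith
      _ = _ := by ring
  have : Nontrivial (E n) := by
    have : Nonempty (Fin n) := ⟨⟨0, by omega⟩⟩
    infer_instance
  have hz : Tendsto (fun x : E n => K * ‖x‖ ^ (-p)) (cobounded (E n)) (𝓝 0) :=
    ((Decays.norm_rpow (-p)).const_mul K).tendsto_zero (by linarith)
  -- `|u y - u x| ≤ K |x|⁻ᵖ` for `|x| ≤ |y|` is a Cauchy condition, and controls the rate as well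
  have hcauchy : Cauchy (map u (cobounded (E n))) := by
    rw [Metric.cauchy_iff]
    refine ⟨inferInstance, fun ε hε => ?_⟩
    have hev := (hz.eventually (gt_mem_nhds hε)).and (eventually_norm_gt (2 * r))
    refine ⟨u '' {x | K * ‖x‖ ^ (-p) < ε ∧ 2 * r < ‖x‖}, image_mem_map hev, ?_⟩
    rintro _ ⟨x, hx, rfl⟩ _ ⟨y, hy, rfl⟩
    rcases le_total ‖x‖ ‖y‖ with hxy | hxy
    · rw [dist_comm, Real.dist_eq]
      exact (hmain x y hx.2 hxy).trans_lt hx.1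
    · rw [Real.dist_eq]
      exact (hmain y x hy.2 hxy).trans_lt hy.1
  obtain ⟨a, ha⟩ := cauchy_map_iff_exists_tendsto.1 hcauchy
  refine ⟨a, Asymptotics.IsBigO.of_bound K ?_⟩
  filter_upwards [eventually_norm_gt (2 * r)] with x hx
  have h1 : |a - u x| ≤ K * ‖x‖ ^ (-p) := by
    refine le_of_tendsto (f := fun y => |u y - u x|) (x := cobounded (E n))
      ((ha.sub_const _).abs) ?_
    filter_upwards [eventually_norm_gt ‖x‖] with y hy using hmain x y hx hy.le
  rw [Real.norm_eq_abs, abs_sub_comm, Real.norm_of_nonneg (by positivity)]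
  exact h1

/-! ### Changes of asymptotically flat coordinates -/

/-- The Jacobian matrix `∂ᵢ tᵏ` of a map `t` of `ℝⁿ`. -/
noncomputable def jac (t : E n → E n) (x : E n) : Matrix (Fin n) (Fin n) ℝ :=
  Matrix.of fun k i => pd i (fun y => t y k) x

/-- Near infinity, `t` is a smooth local isometry from `G` to `G'`, and infinity is mapped to
infinity. -/
structure IsEndIsometry (G G' : E n → Matrix (Fin n) (Fin n) ℝ) (t : E n → E n) : Prop where
  smooth : ContDiff ℝ ∞ t
  tendsto : Tendsto t (cobounded (E n)) (cobounded (E n))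
  pullback : ∀ᶠ x in cobounded (E n), ∀ i j,
    G x i j = ∑ k, ∑ l, G' (t x) k l * (jac t x k i * jac t x l j)

namespace IsEndIsometry

variable {p : ℝ} {G G' : E n → Matrix (Fin n) (Fin n) ℝ} {t s : E n → E n}

lemma contDiff_jac (h : IsEndIsometry G G' t) (k i : Fin n) :
    ContDiff ℝ ∞ (fun x => jac t x k i) :=
  contDiff_pd (contDiff_coord h.smooth k) i

lemma differentiableAt (h : IsEndIsometry G G' t) (x : E n) : DifferentiableAt ℝ t x :=
  h.smooth.differentiable (by simp) x

lemma differentiableAt_jac (h : IsEndIsometry G G' t) (k i : Fin n) (x : E n) :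
    DifferentiableAt ℝ (fun x => jac t x k i) x :=
  (h.contDiff_jac k i).differentiable (by simp) x

lemma tendsto_comp (h : IsEndIsometry G G' t) (hG' : IsAFMetric p G') (k l : Fin n) :
    Tendsto (fun x => G' (t x) k l) (cobounded (E n)) (𝓝 ((1 : Matrix (Fin n) (Fin n) ℝ) k l)) :=
  ((hG'.asymptotic k l).tendsto hG'.pos).comp h.tendsto

/-- The Jacobian is bounded, since both metrics are uniformly equivalent to the Euclidean one. -/
lemma decays_jac (h : IsEndIsometry G G' t) (hG : IsAFMetric p G) (hG' : IsAFMetric p G')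
    (k i : Fin n) : Decays 0 (fun x => jac t x k i) := by
  have hn : 0 < (n : ℝ) := by exact_mod_cast k.pos
  have h1 : ∀ᶠ x in cobounded (E n), ∀ k l,
      |G' (t x) k l - (1 : Matrix (Fin n) (Fin n) ℝ) k l| < 1 / (2 * n) := by
    refine eventually_all.2 fun k => eventually_all.2 fun l => ?_
    have := (h.tendsto_comp hG' k l).sub_const ((1 : Matrix (Fin n) (Fin n) ℝ) k l)
    rw [sub_self] at this
    have := this.abs
    rw [abs_zero] at this
    exact this.eventually (gt_mem_nhds (by positivity))
  have h2 : ∀ᶠ x in cobounded (E n), G x i i < 2 := by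
    have := (hG.asymptotic i i).tendsto hG.pos
    rw [Matrix.one_apply_eq] at this
    exact this.eventually (gt_mem_nhds (by norm_num))
  refine Asymptotics.IsBigO.of_bound 2 ?_
  filter_upwards [h1, h2, h.pullback] with x hx1 hx2 hx3
  set v : Fin n → ℝ := fun k => jac t x k i
  have h3 : G x i i = ∑ k, v k ^ 2 +
      ∑ k, ∑ l, (G' (t x) k l - (1 : Matrix (Fin n) (Fin n) ℝ) k l) * (v k * v l) := by
    rw [hx3 i i]
    simp only [sub_mul, Finset.sum_sub_distrib]
    have : ∑ k, ∑ l, (1 : Matrix (Fin n) (Fin n) ℝ) k l * (v k * v l) = ∑ k, v k ^ 2 := by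
      simp [Matrix.one_apply, sq]
    rw [this]
    ring
  have h4 : |∑ k, ∑ l, (G' (t x) k l - (1 : Matrix (Fin n) (Fin n) ℝ) k l) * (v k * v l)| ≤
      1 / (2 * n) * (∑ k, |v k|) ^ 2 := by
    rw [sq, Finset.sum_mul_sum, Finset.mul_sum]
    refine (Finset.abs_sum_le_sum_abs _ _).trans (Finset.sum_le_sum fun k _ => ?_)
    rw [Finset.mul_sum]
    refine (Finset.abs_sum_le_sum_abs _ _).trans (Finset.sum_le_sum fun l _ => ?_)
    rw [abs_mul, abs_mul]
    exact mul_le_mul_of_nonneg_right (hx1 k l).le (by positivity)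
  have h5 : (∑ k, |v k|) ^ 2 ≤ n * ∑ k, v k ^ 2 := by
    have := sq_sum_le_card_mul_sum_sq (s := Finset.univ) (f := fun k => |v k|)
    simpa [sq_abs] using this
  have h6 : 1 / (2 * n) * (∑ k, |v k|) ^ 2 ≤ 1 / 2 * ∑ k, v k ^ 2 := by
    calc _ ≤ 1 / (2 * n) * (n * ∑ k, v k ^ 2) := by gcongr
      _ = _ := by field_simp
  have h7 : v k ^ 2 ≤ ∑ k, v k ^ 2 :=
    Finset.single_le_sum (f := fun k => v k ^ 2) (fun _ _ => sq_nonneg _) (Finset.mem_univ k)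
  have h8 := (abs_le.1 h4).1
  rw [Real.rpow_zero, norm_one, mul_one, Real.norm_eq_abs]
  exact abs_le_of_sq_le_sq (by linarith) (by norm_num)

lemma decays_one (h : IsEndIsometry G G' t) (hG : IsAFMetric p G) (hG' : IsAFMetric p G') :
    (fun x => ‖t x‖) =O[cobounded (E n)] fun x => ‖x‖ := by
  have h1 (k : Fin n) : Decays 1 (fun x => t x k) :=
    Decays.of_pd_zero (contDiff_coord h.smooth k) fun i => h.decays_jac hG hG' k i
  have h2 : Decays 1 (fun x => ‖t x‖) := by
    refine (Decays.sum (S := Finset.univ) fun k _ => (h1 k).abs).of_abs_le (.of_forall fun x => ?_)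
    rw [abs_of_nonneg (norm_nonneg _)]
    refine le_trans ?_ (le_abs_self _)
    conv_lhs => rw [single_sum_eq (t x)]
    refine (norm_sum_le _ _).trans (Finset.sum_le_sum fun k _ => ?_)
    rw [norm_smul]
    simp
  simpa [Decays] using h2

/-- Lengths are comparable under a change of coordinates, because its inverse grows at most
linearly as well. -/
lemma norm_isBigO (hs : IsEndIsometry G' G s) (ht : Tendsto t (cobounded (E n)) (cobounded (E n)))
    (hst : ∀ᶠ x in cobounded (E n), s (t x) = x) (hG : IsAFMetric p G) (hG' : IsAFMetric p G') :
    (fun x : E n => ‖x‖) =O[cobounded (E n)] fun x => ‖t x‖ := by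
  refine ((hs.decays_one hG' hG).comp_tendsto ht).congr' ?_ EventuallyEq.rfl
  filter_upwards [hst] with x hx
  simp [hx]

end IsEndIsometry

lemma Decays.comp {r : ℝ} {u : E n → ℝ} {t : E n → E n} (hu : Decays r u) (hr : r ≤ 0)
    (ht : Tendsto t (cobounded (E n)) (cobounded (E n)))
    (hb : (fun x : E n => ‖x‖) =O[cobounded (E n)] fun x => ‖t x‖) :
    Decays r (fun x => u (t x)) := by
  refine (Asymptotics.IsBigO.comp_tendsto hu ht).trans ?_
  obtain ⟨C, hC, h⟩ := hb.exists_pos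
  refine Asymptotics.IsBigO.of_bound (C ^ (-r)) ?_
  filter_upwards [h.bound, eventually_norm_gt 0] with x hx hx0
  rw [norm_norm, norm_norm] at hx
  have ht0 : 0 < ‖t x‖ := by
    by_contra hcon
    have : ‖t x‖ = 0 := le_antisymm (not_lt.1 hcon) (norm_nonneg _)
    rw [this, mul_zero] at hx
    linarith
  rw [Function.comp_apply, Real.norm_of_nonneg (by positivity), Real.norm_of_nonneg (by positivity)]
  have h1 := Real.rpow_le_rpow_of_nonpos hx0 hx hr
  rw [Real.mul_rpow hC.le ht0.le] at h1
  calc ‖t x‖ ^ r = C ^ (-r) * (C ^ r * ‖t x‖ ^ r) := by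
        rw [← mul_assoc, ← Real.rpow_add hC]
        simp
    _ ≤ _ := by gcongr

namespace IsEndIsometry

variable {p : ℝ} {G G' : E n → Matrix (Fin n) (Fin n) ℝ} {t : E n → E n}

/-- The derivative of the transformation rule of the metric. -/
lemma pd_pullback (h : IsEndIsometry G G' t) (hG' : IsAFMetric p G') :
    ∀ᶠ x in cobounded (E n), ∀ i j m, pd m (fun y => G y i j) x =
      ∑ k, ∑ l, (∑ q, pd q (fun y => G' y k l) (t x) * jac t x q m) *
        (jac t x k i * jac t x l j) +
      ∑ k, ∑ l, G' (t x) k l * (pd m (fun y => jac t y k i) x * jac t x l j) +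
      ∑ k, ∑ l, G' (t x) k l * (pd m (fun y => jac t y k j) x * jac t x l i) := by
  filter_upwards [eventually_nhds_cobounded h.pullback] with x hx i j m
  have hd (k l : Fin n) : DifferentiableAt ℝ (fun y => G' (t y) k l) x :=
    ((hG'.smooth k l).differentiable (by simp) (t x)).comp x (h.differentiableAt x)
  have hJ := fun k i => h.differentiableAt_jac k i x
  have hterm (k l : Fin n) : DifferentiableAt ℝ
      (fun y => G' (t y) k l * (jac t y k i * jac t y l j)) x :=
    (hd k l).fun_mul ((hJ k i).fun_mul (hJ l j))
  rw [pd_congr (hx.mono fun y hy => hy i j),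
    pd_sum fun k _ => DifferentiableAt.fun_sum fun l _ => hterm k l]
  have e3 : ∑ k, ∑ l, G' (t x) k l * (pd m (fun y => jac t y k j) x * jac t x l i) =
      ∑ k, ∑ l, G' (t x) k l * (jac t x k i * pd m (fun y => jac t y l j) x) := by
    rw [Finset.sum_comm]
    refine Finset.sum_congr rfl fun k _ => Finset.sum_congr rfl fun l _ => ?_
    rw [hG'.symm]
    ring
  rw [e3]
  simp only [← Finset.sum_add_distrib]
  refine Finset.sum_congr rfl fun k _ => ?_
  rw [pd_sum fun l _ => hterm k l]
  refine Finset.sum_congr rfl fun l _ => ?_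
  rw [pd_mul (hd k l) ((hJ k i).fun_mul (hJ l j)), pd_mul (hJ k i) (hJ l j),
    pd_comp ((hG'.smooth k l).differentiable (by simp) _) (h.differentiableAt x)]
  simp only [jac, Matrix.of_apply]
  ring

lemma pd_jac_comm (h : IsEndIsometry G G' t) (k i m : Fin n) (x : E n) :
    pd m (fun y => jac t y k i) x = pd i (fun y => jac t y k m) x :=
  pd_comm (contDiff_coord h.smooth k).contDiffAt m i

/-- Second derivatives of a change of asymptotically flat coordinates are `O(|x|⁻ᵖ⁻¹)`: they are
determined by first derivatives of the two metrics, as in the computation of the Christoffel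
symbols. -/
lemma decays_pd_jac (h : IsEndIsometry G G' t) (hG : IsAFMetric p G) (hG' : IsAFMetric p G')
    (hb : (fun x : E n => ‖x‖) =O[cobounded (E n)] fun x => ‖t x‖) (k i m : Fin n) :
    Decays (-p - 1) (pd m (fun x => jac t x k i)) := by
  have hp := hG.pos
  have hJ := h.decays_jac hG hG'
  set C : Fin n → Fin n → Fin n → E n → ℝ := fun i j m x => pd m (fun y => G y i j) x -
    ∑ k, ∑ l, (∑ q, pd q (fun y => G' y k l) (t x) * jac t x q m) *
        (jac t x k i * jac t x l j) with hC
  have hCd (i j m : Fin n) : Decays (-p - 1) (C i j m) := by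
    refine (hG.decays_pd i j m).sub (Decays.sum fun k _ => Decays.sum fun l _ => ?_)
    refine Decays.mul' (s := -p - 1) (t := 0) (Decays.sum fun q _ => ?_) ?_ (by simp)
    · exact ((hG'.decays_pd k l q).comp (by linarith) h.tendsto hb).mul' (hJ q m) (by simp)
    · exact (hJ k i).mul' (hJ l j) (by simp)
  -- the second derivatives with one index lowered
  set B : Fin n → Fin n → Fin n → E n → ℝ := fun i m j x =>
    ∑ k, ∑ l, G' (t x) k l * (pd m (fun y => jac t y k i) x * jac t x l j) with hB
  have hBd (i m j : Fin n) : Decays (-p - 1) (B i m j) := by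
    refine ((((hCd i j m).add (hCd m j i)).sub (hCd i m j)).const_mul (1 / 2)).congr' ?_
    filter_upwards [h.pd_pullback hG'] with x hx
    have hsymm (i m j : Fin n) : B i m j x = B m i j x := by
      simp only [hB, h.pd_jac_comm _ i m]
    have hC' (i j m : Fin n) : C i j m x = B i m j x + B j m i x := by
      simp only [hC, hB, hx i j m]
      ring
    rw [hC', hC', hC', hsymm j i m, hsymm m i j, hsymm m j i]
    ring
  -- raising the index again: `J G⁻¹ Jᵀ G' = 1`
  refine (Decays.sum (S := Finset.univ) fun a _ => Decays.sum (S := Finset.univ) fun b _ =>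
    ((hJ k a).mul' ((hG.asymptotic_inv a b).decays_zero hp) (r := 0) (by simp)).mul' (hBd i m b)
    (r := -p - 1) (by simp)).congr' ?_
  filter_upwards [h.pullback] with x hx
  have h1 : (jac t x).transpose * G' (t x) * jac t x = G x := by
    ext i j
    rw [hx i j, Matrix.mul_assoc]
    simp only [Matrix.mul_apply, Matrix.transpose_apply, Finset.mul_sum]
    exact Finset.sum_congr rfl fun k _ => Finset.sum_congr rfl fun l _ => by ring
  have h2 : (G x)⁻¹ * G x = 1 := Matrix.nonsing_inv_mul _ (hG.det_pos x).ne'.isUnit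
  have h3 : jac t x * ((G x)⁻¹ * ((jac t x).transpose * G' (t x))) = 1 := by
    rw [mul_eq_one_comm, Matrix.mul_assoc, h1, h2]
  set w : Fin n → ℝ := fun k => pd m (fun y => jac t y k i) x
  have h4 (b : Fin n) : B i m b x = ((jac t x).transpose.mulVec ((G' (t x)).mulVec w)) b := by
    simp only [hB, Matrix.mulVec, dotProduct, Matrix.transpose_apply, Finset.mul_sum]
    rw [Finset.sum_comm]
    refine Finset.sum_congr rfl fun l _ => Finset.sum_congr rfl fun k _ => ?_
    rw [hG'.symm]
    ring
  have h5 : (jac t x).mulVec ((G x)⁻¹.mulVec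
      ((jac t x).transpose.mulVec ((G' (t x)).mulVec w))) = w := by
    simp only [Matrix.mulVec_mulVec]
    rw [h3, Matrix.one_mulVec]
  have h6 := congrFun h5 k
  rw [show pd m (fun y => jac t y k i) x = w k from rfl, ← h6]
  conv_rhs => rw [Matrix.mulVec]
  simp only [dotProduct]
  refine Finset.sum_congr rfl fun a _ => ?_
  conv_rhs => rw [Matrix.mulVec]
  simp only [dotProduct, Finset.mul_sum, h4]
  exact Finset.sum_congr rfl fun b _ => by ring

/-- A change of asymptotically flat coordinates is asymptotic to an orthogonal map. -/
lemma exists_orthogonal (hn : 3 ≤ n) (h : IsEndIsometry G G' t) (hG : IsAFMetric p G)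
    (hG' : IsAFMetric p G')
    (hb : (fun x : E n => ‖x‖) =O[cobounded (E n)] fun x => ‖t x‖) :
    ∃ A : Matrix (Fin n) (Fin n) ℝ, A * A.transpose = 1 ∧
      ∀ k i, AsymptoticTo p (A k i) (fun x => jac t x k i) := by
  have hd := h.decays_pd_jac hG hG' hb
  choose A hA using fun k i => exists_limit_of_decays_pd hn hG.pos (h.contDiff_jac k i) (hd k i)
  have hJ (k i : Fin n) : AsymptoticTo p (A k i) (fun x => jac t x k i) :=
    ⟨h.contDiff_jac k i, hA k i, hd k i⟩
  refine ⟨Matrix.of A, ?_, hJ⟩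
  rw [mul_eq_one_comm]
  have : Nontrivial (E n) := by
    have : Nonempty (Fin n) := ⟨⟨0, by omega⟩⟩
    infer_instance
  ext i j
  have h1 : Tendsto (fun x => ∑ k, ∑ l, G' (t x) k l * (jac t x k i * jac t x l j))
      (cobounded (E n))
      (𝓝 (∑ k, ∑ l, (1 : Matrix (Fin n) (Fin n) ℝ) k l * (A k i * A l j))) :=
    tendsto_finsetSum _ fun k _ => tendsto_finsetSum _ fun l _ => (h.tendsto_comp hG' k l).mul
      (((hJ k i).tendsto hG.pos).mul ((hJ l j).tendsto hG.pos))
  have h2 := tendsto_nhds_unique (h1.congr' (h.pullback.mono fun x hx => (hx i j).symm))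
    ((hG.asymptotic i j).tendsto hG.pos)
  rw [← h2, Matrix.mul_apply]
  simp [Matrix.one_apply]

end IsEndIsometry

/-- The identity behind the transformation law of the ADM integrand: with `g q k l` standing for
the derivatives of the metric in the new coordinates and `d k i j` for second derivatives of the
coordinate change. The terms linear in `d` form the divergence of an antisymmetric tensor. -/
lemma linear_transformation_identity {A : Matrix (Fin n) (Fin n) ℝ} (hA : A * A.transpose = 1)
    (g : Fin n → Fin n → Fin n → ℝ) (d : Fin n → Fin n → Fin n → ℝ)
    (hd : ∀ k i j, d k i j = d k j i) (i : Fin n) :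
    ∑ j, ((∑ k, ∑ l, ∑ q, g q k l * (A q j * (A k i * A l j)) + ∑ k, d k i j * A k j +
      ∑ k, d k j j * A k i) - (∑ k, ∑ l, ∑ q, g q k l * (A q i * (A k j * A l j)) +
      ∑ k, d k j i * A k j + ∑ k, d k j i * A k j)) =
    ∑ k, A k i * ∑ j, (g j k j - g k j j) + ∑ j, ∑ k, (A k i * d k j j - A k j * d k i j) := by
  have hAA (a b : Fin n) : ∑ j, A a j * A b j = (1 : Matrix (Fin n) (Fin n) ℝ) a b := by
    rw [← hA, Matrix.mul_apply]
    rfl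
  have e1 : ∑ j, ∑ k, ∑ l, ∑ q, g q k l * (A q j * (A k i * A l j)) =
      ∑ k, ∑ l, A k i * g l k l := by
    rw [Finset.sum_comm]
    refine Finset.sum_congr rfl fun k _ => ?_
    rw [Finset.sum_comm]
    refine Finset.sum_congr rfl fun l _ => ?_
    rw [Finset.sum_comm]
    calc ∑ q, ∑ j, g q k l * (A q j * (A k i * A l j)) =
          ∑ q, A k i * g q k l * ∑ j, A q j * A l j := by
          refine Finset.sum_congr rfl fun q _ => ?_
          rw [Finset.mul_sum]
          exact Finset.sum_congr rfl fun j _ => by ring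
      _ = _ := by simp [hAA, Matrix.one_apply]
  have e2 : ∑ j, ∑ k, ∑ l, ∑ q, g q k l * (A q i * (A k j * A l j)) =
      ∑ k, ∑ l, A k i * g k l l := by
    rw [Finset.sum_comm]
    calc ∑ k, ∑ j, ∑ l, ∑ q, g q k l * (A q i * (A k j * A l j)) =
          ∑ k, ∑ l, (∑ q, g q k l * A q i) * ∑ j, A k j * A l j := by
          refine Finset.sum_congr rfl fun k _ => ?_
          rw [Finset.sum_comm]
          refine Finset.sum_congr rfl fun l _ => ?_
          rw [Finset.sum_comm, Finset.sum_mul]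
          refine Finset.sum_congr rfl fun q _ => ?_
          rw [Finset.mul_sum]
          exact Finset.sum_congr rfl fun j _ => by ring
      _ = ∑ k, ∑ q, g q k k * A q i := by simp [hAA, Matrix.one_apply]
      _ = _ := by
          rw [Finset.sum_comm]
          exact Finset.sum_congr rfl fun k _ => Finset.sum_congr rfl fun l _ => mul_comm _ _
  have e3 (j : Fin n) : ∑ k, d k j i * A k j = ∑ k, d k i j * A k j :=
    Finset.sum_congr rfl fun k _ => by rw [hd]
  simp only [Finset.sum_sub_distrib, Finset.sum_add_distrib, e1, e2, e3, Finset.mul_sum, mul_sub]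
  simp only [mul_comm (A _ _) (d _ _ _)]
  ring

namespace IsEndIsometry

variable {p : ℝ} {G G' : E n → Matrix (Fin n) (Fin n) ℝ} {t s : E n → E n}

/-- The first order difference of the two mass vector fields is the divergence of an
antisymmetric tensor field. -/
lemma decays_massField_transformation (h : IsEndIsometry G G' t) (hG : IsAFMetric p G)
    (hG' : IsAFMetric p G') (hb : (fun x : E n => ‖x‖) =O[cobounded (E n)] fun x => ‖t x‖)
    {A : Matrix (Fin n) (Fin n) ℝ} (hA : A * A.transpose = 1)
    (hJ : ∀ k i, AsymptoticTo p (A k i) (fun x => jac t x k i)) (i : Fin n) :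
    Decays (-2 * p - 1) (fun x => massField G i x - (∑ k, A k i * linearField G' k (t x) +
      ∑ j, pd j (fun y => ∑ k, (A k i * jac t y k j - A k j * jac t y k i)) x)) := by
  have hp := hG.pos
  set g : Fin n → Fin n → Fin n → E n → ℝ := fun q k l x => pd q (fun y => G' y k l) (t x)
  set d : Fin n → Fin n → Fin n → E n → ℝ := fun k i m x => pd m (fun y => jac t y k i) x
  have hg (q k l : Fin n) : Decays (-p - 1) (g q k l) :=
    (hG'.decays_pd k l q).comp (by linarith) h.tendsto hb
  have hd (k i m : Fin n) : Decays (-p - 1) (d k i m) := (hJ k i).pd m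
  have hG't (k l : Fin n) :
      Decays (-p) (fun x => G' (t x) k l - (1 : Matrix (Fin n) (Fin n) ℝ) k l) :=
    (hG'.asymptotic k l).sub.comp (by linarith) h.tendsto hb
  set P : Fin n → Fin n → Fin n → E n → ℝ := fun i j m x =>
    ∑ k, ∑ l, ∑ q, g q k l x * (A q m * (A k i * A l j)) + ∑ k, d k i m x * A k j +
      ∑ k, d k j m x * A k i with hP
  have hGJ (k l j : Fin n) : Decays (-p) (fun x => G' (t x) k l * jac t x l j -
      (1 : Matrix (Fin n) (Fin n) ℝ) k l * A l j) := by
    refine (((hG't k l).mul' ((hJ l j).decays_zero hp) (r := -p) (by simp)).add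
      ((hJ l j).sub.const_mul ((1 : Matrix (Fin n) (Fin n) ℝ) k l))).congr'
      (.of_forall fun x => ?_)
    simp only
    ring
  have hPd (i j m : Fin n) :
      Decays (-2 * p - 1) (fun x => pd m (fun y => G y i j) x - P i j m x) := by
    have h1 : Decays (-2 * p - 1) (fun x => ∑ k, ∑ l, ∑ q, g q k l x *
        (jac t x q m * (jac t x k i * jac t x l j) - A q m * (A k i * A l j))) :=
      Decays.sum fun k _ => Decays.sum fun l _ => Decays.sum fun q _ =>
        (hg q k l).mul' ((hJ q m).mul hp ((hJ k i).mul hp (hJ l j))).sub (by linarith)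
    have h2 (i j : Fin n) : Decays (-2 * p - 1) (fun x => ∑ k, ∑ l, d k i m x *
        (G' (t x) k l * jac t x l j - (1 : Matrix (Fin n) (Fin n) ℝ) k l * A l j)) :=
      Decays.sum fun k _ => Decays.sum fun l _ => (hd k i m).mul' (hGJ k l j) (by linarith)
    have h3 (i j : Fin n) (x : E n) :
        ∑ k, ∑ l, d k i m x * ((1 : Matrix (Fin n) (Fin n) ℝ) k l * A l j) =
          ∑ k, d k i m x * A k j := by simp [Matrix.one_apply]
    refine ((h1.add (h2 i j)).add (h2 j i)).congr' ?_
    filter_upwards [h.pd_pullback hG'] with x hx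
    rw [hx i j m]
    simp only [hP, mul_sub, Finset.sum_sub_distrib, h3]
    have e1 : ∑ k, ∑ l, (∑ q, pd q (fun y => G' y k l) (t x) * jac t x q m) *
        (jac t x k i * jac t x l j) = ∑ k, ∑ l, ∑ q, g q k l x *
        (jac t x q m * (jac t x k i * jac t x l j)) := by
      refine Finset.sum_congr rfl fun k _ => Finset.sum_congr rfl fun l _ => ?_
      rw [Finset.sum_mul]
      exact Finset.sum_congr rfl fun q _ => by simp only [g]; ring
    have e2 (i j : Fin n) : ∑ k, ∑ l, G' (t x) k l *
        (pd m (fun y => jac t y k i) x * jac t x l j) =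
        ∑ k, ∑ l, d k i m x * (G' (t x) k l * jac t x l j) :=
      Finset.sum_congr rfl fun k _ => Finset.sum_congr rfl fun l _ => by simp only [d]; ring
    rw [e1, e2, e2]
    ring
  refine ((hG.decays_massField_sub i).add (Decays.sum (S := Finset.univ) fun j _ =>
    (hPd i j j).sub (hPd j j i))).congr' (.of_forall fun x => ?_)
  have key := linear_transformation_identity hA (fun q k l => g q k l x) (fun k i m => d k i m x)
    (fun k i m => h.pd_jac_comm k i m x) i
  have e4 (j : Fin n) : pd j (fun y => ∑ k, (A k i * jac t y k j - A k j * jac t y k i)) x =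
      ∑ k, (A k i * d k j j x - A k j * d k i j x) := by
    have hdJ := fun k i => h.differentiableAt_jac k i x
    rw [pd_sum fun k _ => ((hdJ k j).const_mul _).fun_sub ((hdJ k i).const_mul _)]
    refine Finset.sum_congr rfl fun k _ => ?_
    rw [pd_sub ((hdJ k j).const_mul _) ((hdJ k i).const_mul _), pd_const_mul _ (hdJ k j),
      pd_const_mul _ (hdJ k i)]
  have e5 : ∑ j, (pd j (fun y => G y i j) x - P i j j x - (pd i (fun y => G y j j) x - P j j i x)) =
      linearField G i x - ∑ j, (P i j j x - P j j i x) := by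
    rw [linearField, ← Finset.sum_sub_distrib]
    exact Finset.sum_congr rfl fun j _ => by ring
  simp only [e4, e5]
  simp only [hP]
  rw [key]
  simp only [linearField, g]
  ring

end IsEndIsometry

/-! ### Pairing with cutoff functions -/

/-- Cutoff functions, equal to `1` on the ball of radius `R` and to `0` outside the ball of
radius `2R`. -/
noncomputable def cutoff (R : ℝ) (y : E n) : ℝ :=
  (⟨1, 2, one_pos, one_lt_two⟩ : ContDiffBump (0 : E n)) (R⁻¹ • y)

lemma contDiff_cutoff (R : ℝ) : ContDiff ℝ ∞ (cutoff R : E n → ℝ) :=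
  (ContDiffBump.contDiff _).comp (contDiff_const_smul R⁻¹)

lemma abs_cutoff_le (R : ℝ) (y : E n) : |cutoff R y| ≤ 1 := by
  rw [cutoff, abs_of_nonneg (ContDiffBump.nonneg _)]
  exact ContDiffBump.le_one _

lemma cutoff_eq_one {R : ℝ} (hR : 0 < R) {y : E n} (hy : ‖y‖ ≤ R) : cutoff R y = 1 := by
  refine ContDiffBump.one_of_mem_closedBall _ ?_
  rw [mem_closedBall_zero_iff, norm_smul, norm_inv, Real.norm_of_nonneg hR.le]
  exact (inv_mul_le_one₀ hR).2 hy

lemma cutoff_eq_zero {R : ℝ} (hR : 0 < R) {y : E n} (hy : 2 * R ≤ ‖y‖) : cutoff R y = 0 := by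
  refine ContDiffBump.zero_of_le_dist _ ?_
  rw [dist_zero_right, norm_smul, norm_inv, Real.norm_of_nonneg hR.le, inv_mul_eq_div,
    le_div_iff₀ hR]
  exact hy

lemma pd_cutoff_eq_zero {R : ℝ} (hR : 0 < R) {y : E n} (hy : ‖y‖ < R) (k : Fin n) :
    pd k (cutoff R) y = 0 := by
  rw [pd_congr (v := fun _ => 1), pd_const]
  filter_upwards [continuous_norm.continuousAt.eventually (gt_mem_nhds hy)] with z hz
  exact cutoff_eq_one hR (le_of_lt hz)

/-- The gradient of the cutoff functions is `O(1/|y|)` uniformly in the radius. -/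
lemma exists_pd_cutoff_bound (k : Fin n) :
    ∃ C : ℝ, 0 < C ∧ ∀ R : ℝ, 0 < R → ∀ y : E n, y ≠ 0 → |pd k (cutoff R) y| ≤ C * ‖y‖⁻¹ := by
  set b : ContDiffBump (0 : E n) := ⟨1, 2, one_pos, one_lt_two⟩
  have hbC : ContDiff ℝ ∞ (b : E n → ℝ) := b.contDiff
  have hc : Continuous fun z : E n => ‖z‖ * pd k b z :=
    continuous_norm.mul (contDiff_pd hbC k).continuous
  have hs : HasCompactSupport fun z : E n => ‖z‖ * pd k b z :=
    (hasCompactSupport_pd b.hasCompactSupport k).mul_left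
  obtain ⟨C, hC⟩ := hc.bounded_above_of_compact_support hs
  refine ⟨max C 1, by positivity, fun R hR y hy => ?_⟩
  have hy0 : 0 < ‖y‖ := norm_pos_iff.2 hy
  have h1 : pd k (cutoff R) y = R⁻¹ * pd k b (R⁻¹ • y) := by
    have h2 : HasFDerivAt (cutoff R) ((fderiv ℝ b (R⁻¹ • y)).comp
        (R⁻¹ • ContinuousLinearMap.id ℝ (E n))) y :=
      (hbC.differentiable (by simp) (R⁻¹ • y)).hasFDerivAt.comp y
        ((hasFDerivAt_id y).const_smul R⁻¹)
    rw [pd, h2.fderiv]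
    simp [pd]
  have h3 := hC (R⁻¹ • y)
  rw [norm_mul, norm_norm, norm_smul, norm_inv, Real.norm_of_nonneg hR.le, Real.norm_eq_abs] at h3
  rw [h1, abs_mul, abs_of_pos (inv_pos.2 hR), ← div_eq_mul_inv, le_div_iff₀ hy0]
  calc _ = R⁻¹ * ‖y‖ * |pd k b (R⁻¹ • y)| := by ring
    _ ≤ C := h3
    _ ≤ _ := le_max_left _ _

lemma continuous_pd_cutoff (R : ℝ) (k : Fin n) : Continuous (pd k (cutoff R)) :=
  (contDiff_pd (contDiff_cutoff R) k).continuous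

lemma hasCompactSupport_of_bounded {u : E n → ℝ} (h : ∀ᶠ x in cobounded (E n), u x = 0) :
    HasCompactSupport u := by
  obtain ⟨r, -, hr⟩ := eventually_cobounded_iff.1 h
  refine HasCompactSupport.intro (isCompact_closedBall 0 r) fun x hx => hr x ?_
  simpa using hx

lemma eventually_cutoff_comp_eq_zero {R : ℝ} (hR : 0 < R) {t : E n → E n}
    (ht : Tendsto t (cobounded (E n)) (cobounded (E n))) :
    ∀ᶠ x in cobounded (E n), cutoff R (t x) = 0 :=
  (ht.eventually (eventually_norm_gt (2 * R))).mono fun _ hx => cutoff_eq_zero hR (le_of_lt hx)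

lemma eventually_pd_cutoff_comp_eq_zero {R : ℝ} (hR : 0 < R) {t : E n → E n}
    (ht : Tendsto t (cobounded (E n)) (cobounded (E n))) (k : Fin n) :
    ∀ᶠ x in cobounded (E n), pd k (cutoff R) (t x) = 0 := by
  refine ht.eventually (p := fun y => pd k (cutoff R) y = 0) ?_
  have : (cutoff R : E n → ℝ) =ᶠ[cobounded (E n)] fun _ => 0 :=
    eventually_cutoff_comp_eq_zero hR tendsto_id
  filter_upwards [eventually_pd_congr this k] with y hy
  rw [hy, pd_const]

/-- The integral of a divergence as a limit of pairings with gradients of cutoff functions,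
possibly transported by a proper map. -/
lemma tendsto_neg_integral_cutoff {V : Fin n → E n → ℝ} (hV : ∀ k, ContDiff ℝ 1 (V k))
    (hi : Integrable (divergence V)) {t : E n → E n} (ht : ContDiff ℝ ∞ t)
    (htt : Tendsto t (cobounded (E n)) (cobounded (E n))) :
    Tendsto (fun R => -∫ x, ∑ k, pd k (fun y => cutoff R (t y)) x * V k x) atTop
      (𝓝 (∫ x, divergence V x)) := by
  have hC (R : ℝ) : ContDiff ℝ ∞ fun x => cutoff R (t x) := (contDiff_cutoff R).comp ht
  have h1 : Tendsto (fun R => ∫ x, cutoff R (t x) * divergence V x) atTop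
      (𝓝 (∫ x, divergence V x)) := by
    refine tendsto_integral_cutoff hi (.of_forall fun R => (hC R).continuous)
      (.of_forall fun R x => abs_cutoff_le _ _) fun x => ?_
    filter_upwards [eventually_gt_atTop 0, eventually_ge_atTop ‖t x‖] with R hR hx
    exact cutoff_eq_one hR hx
  refine h1.congr' ?_
  filter_upwards [eventually_gt_atTop 0] with R hR
  exact integral_mul_divergence ((hC R).of_le (by simp))
    (hasCompactSupport_of_bounded (eventually_cutoff_comp_eq_zero hR htt)) hV

/-- A divergence of an antisymmetric tensor does not contribute. -/
lemma integral_pd_mul_divergence_antisymm {u : E n → ℝ} (hu : ContDiff ℝ ∞ u)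
    (hc : HasCompactSupport u) {B : Fin n → Fin n → E n → ℝ} (hB : ∀ i j, ContDiff ℝ 1 (B i j))
    (hanti : ∀ i j x, B i j x = -B j i x) :
    ∫ x, ∑ i, pd i u x * ∑ j, pd j (B i j) x = 0 := by
  have hc1 := hasCompactSupport_pd hc
  have hu1 (i : Fin n) : ContDiff ℝ 1 (pd i u) := (contDiff_pd hu i).of_le (by simp)
  have h1 (i : Fin n) : ∫ x, pd i u x * ∑ j, pd j (B i j) x =
      -∫ x, ∑ j, pd j (pd i u) x * B i j x := integral_mul_divergence (hu1 i) (hc1 i) (hB i)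
  have hint (i : Fin n) : Integrable fun x => ∑ j, pd j (pd i u) x * B i j x := by
    refine integrable_finsetSum _ fun j _ => ?_
    refine ((continuous_pd (hu1 i) j).mul (hB i j).continuous).integrable_of_hasCompactSupport ?_
    exact (hasCompactSupport_pd (hc1 i) j).mul_right
  rw [integral_finsetSum, Finset.sum_congr rfl fun i _ => h1 i, Finset.sum_neg_distrib,
    ← integral_finsetSum _ fun i _ => hint i]
  · have h2 (x : E n) : ∑ i, ∑ j, pd j (pd i u) x * B i j x = 0 := by
      have h3 : ∑ i, ∑ j, pd j (pd i u) x * B i j x =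
          -∑ i, ∑ j, pd j (pd i u) x * B i j x := by
        conv_lhs => rw [Finset.sum_comm]
        simp only [← Finset.sum_neg_distrib]
        refine Finset.sum_congr rfl fun i _ => Finset.sum_congr rfl fun j _ => ?_
        rw [pd_comm hu.contDiffAt, hanti j i]
        ring
      linarith
    simp [h2]
  · intro i _
    refine Continuous.integrable_of_hasCompactSupport ?_ (hc1 i).mul_right
    exact (contDiff_pd hu i).continuous.mul
      (continuous_finsetSum _ fun j _ => continuous_pd (hB i j) j)

/-- Pairings of gradients of cutoff functions with terms of lower order vanish in the limit. -/
lemma tendsto_integral_pd_cutoff_mul {s : ℝ} {w : E n → ℝ} (hw : Decays s w)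
    (hs : s - 1 < -(n : ℝ)) (hwc : Continuous w) {t : E n → E n} (ht : Continuous t)
    (hb : (fun x : E n => ‖x‖) =O[cobounded (E n)] fun x => ‖t x‖) (k : Fin n) :
    Tendsto (fun R => ∫ x, pd k (cutoff R) (t x) * w x) atTop (𝓝 0) := by
  obtain ⟨C, hC, hbound⟩ := exists_pd_cutoff_bound k
  obtain ⟨K, hK, hKb⟩ := hb.exists_pos
  obtain ⟨ρ, hρ, hKρ⟩ := eventually_cobounded_iff.1 hKb.bound
  refine tendsto_integral_mul_of_decays (C := C * K) (ρ := ρ) hw hs hwc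
    (fun R _ => (continuous_pd_cutoff R k).comp ht) (fun R hR x hx => ?_) fun r => ?_
  · have hx0 : 0 < ‖x‖ := hρ.trans hx
    have h1 := hKρ x hx
    rw [norm_norm, norm_norm] at h1
    have ht0 : 0 < ‖t x‖ := pos_of_mul_pos_right (hx0.trans_le h1) hK.le
    refine (hbound R hR (t x) (norm_pos_iff.1 ht0)).trans ?_
    rw [Real.rpow_neg_one, mul_assoc]
    refine mul_le_mul_of_nonneg_left ?_ hC.le
    rw [← div_eq_mul_inv, le_div_iff₀ hx0, inv_mul_le_iff₀ ht0, mul_comm]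
    exact h1
  · obtain ⟨M, hM⟩ := (isCompact_closedBall (0 : E n) r).exists_bound_of_continuousOn
      ht.continuousOn
    filter_upwards [eventually_gt_atTop 0, eventually_gt_atTop M] with R hR hRM x hx
    exact pd_cutoff_eq_zero hR ((hM x (by simpa using hx)).trans_lt hRM) k

/-! ### Coordinate invariance of the mass -/

lemma det_fderiv_eq {t : E n → E n} {x : E n} (ht : DifferentiableAt ℝ t x) :
    (fderiv ℝ t x).det = (jac t x).det := by
  have h1 : LinearMap.toMatrix (EuclideanSpace.basisFun (Fin n) ℝ).toBasis
      (EuclideanSpace.basisFun (Fin n) ℝ).toBasis (fderiv ℝ t x : E n →ₗ[ℝ] E n) = jac t x := by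
    ext k i
    have h2 : HasFDerivAt (fun y => t y k)
        ((EuclideanSpace.proj k : E n →L[ℝ] ℝ).comp (fderiv ℝ t x)) x :=
      (EuclideanSpace.proj k : E n →L[ℝ] ℝ).hasFDerivAt.comp x ht.hasFDerivAt
    rw [LinearMap.toMatrix_apply, jac, Matrix.of_apply, pd, h2.fderiv]
    simp
  rw [← h1, LinearMap.det_toMatrix]

/-- Change of variables for a map that is only known to be invertible near infinity: it applies to
functions that vanish on a large ball. -/
lemma eventually_integral_eq_comp {t s : E n → E n} (ht : ContDiff ℝ ∞ t)
    (htend : Tendsto s (cobounded (E n)) (cobounded (E n)))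
    (hst : ∀ᶠ x in cobounded (E n), s (t x) = x) (hts : ∀ᶠ y in cobounded (E n), t (s y) = y) :
    ∀ᶠ R : ℝ in atTop, ∀ F : E n → ℝ, (∀ y, ‖y‖ < R → F y = 0) →
      ∫ y, F y = ∫ x, |(jac t x).det| * F (t x) := by
  obtain ⟨r₁, -, h₁⟩ := eventually_cobounded_iff.1 hst
  obtain ⟨r₂, -, h₂⟩ := eventually_cobounded_iff.1
    (hts.and (htend.eventually (eventually_norm_gt r₁)))
  obtain ⟨M, hM⟩ := (isCompact_closedBall (0 : E n) r₁).exists_bound_of_continuousOn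
    ht.continuous.continuousOn
  filter_upwards [eventually_gt_atTop r₂, eventually_gt_atTop M] with R hR₂ hRM F hF
  set S : Set (E n) := {x | r₁ < ‖x‖}
  have hS : MeasurableSet S := measurableSet_lt measurable_const measurable_norm
  have hinj : InjOn t S := fun x hx y hy hxy => by rw [← h₁ x hx, ← h₁ y hy, hxy]
  have hdiff (x : E n) : DifferentiableAt ℝ t x := ht.differentiable (by simp) x
  have h3 := integral_image_eq_integral_abs_det_fderiv_smul volume hS
    (fun x _ => (hdiff x).hasFDerivAt.hasFDerivWithinAt) hinj F
  rw [setIntegral_eq_integral_of_forall_compl_eq_zero,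
    setIntegral_eq_integral_of_forall_compl_eq_zero] at h3
  · simpa only [det_fderiv_eq (hdiff _), smul_eq_mul] using h3
  · intro x hx
    have hx' : ‖x‖ ≤ r₁ := not_lt.1 hx
    rw [hF (t x) ((hM x (by simpa using hx')).trans_lt hRM), smul_zero]
  · intro y hy
    refine hF y (lt_of_not_ge fun hcon => hy ?_)
    have := h₂ y (hR₂.trans_le hcon)
    exact ⟨s y, this.2, this.1⟩

/-- Algebra for comparing pairings before and after a change of coordinates with Jacobian `J`
close to `A`: `a` is the gradient of the cutoff, `V` and `L` are the mass vector fields, and `D` is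
the divergence of an antisymmetric tensor. -/
lemma pairing_identity (a : Fin n → ℝ) (J A : Matrix (Fin n) (Fin n) ℝ) (e L D V : Fin n → ℝ)
    (c : ℝ) (hV : ∀ i, V i = e i + (∑ k, A k i * L k + D i)) :
    ∑ i, (∑ q, a q * J q i) * V i = (∑ q, a q * (∑ i, J q i * e i +
      ∑ k, (∑ i, J q i * A k i - (1 : Matrix (Fin n) (Fin n) ℝ) q k) * L k + (1 - c) * L q) +
      ∑ q, c * (a q * L q)) + ∑ i, (∑ q, a q * J q i) * D i := by
  have e2 (e : Fin n → ℝ) : ∑ i, (∑ q, a q * J q i) * e i = ∑ q, a q * ∑ i, J q i * e i := by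
    simp only [Finset.sum_mul, Finset.mul_sum]
    rw [Finset.sum_comm]
    exact Finset.sum_congr rfl fun q _ => Finset.sum_congr rfl fun i _ => by ring
  have e3 (q : Fin n) : ∑ i, J q i * ∑ k, A k i * L k = ∑ k, (∑ i, J q i * A k i) * L k := by
    simp only [Finset.sum_mul, Finset.mul_sum]
    rw [Finset.sum_comm]
    exact Finset.sum_congr rfl fun k _ => Finset.sum_congr rfl fun i _ => by ring
  have e4 (q : Fin n) : ∑ k, (∑ i, J q i * A k i - (1 : Matrix (Fin n) (Fin n) ℝ) q k) * L k =
      ∑ k, (∑ i, J q i * A k i) * L k - L q := by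
    simp only [sub_mul, Finset.sum_sub_distrib]
    simp [Matrix.one_apply]
  simp only [hV, e4, mul_add, Finset.sum_add_distrib, e2, e3]
  rw [← add_assoc]
  congr 1
  simp only [← Finset.sum_add_distrib]
  refine Finset.sum_congr rfl fun q _ => ?_
  ring

set_option maxHeartbeats 1000000 in
/-- The mass does not depend on the asymptotically flat coordinates. -/
theorem IsEndIsometry.integral_divergence_eq (hn : 3 ≤ n) {p : ℝ}
    {G G' : E n → Matrix (Fin n) (Fin n) ℝ} {t s : E n → E n} (h : IsEndIsometry G G' t)
    (hs : IsEndIsometry G' G s) (hst : ∀ᶠ x in cobounded (E n), s (t x) = x)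
    (hts : ∀ᶠ y in cobounded (E n), t (s y) = y) (hG : IsAFMetric p G) (hG' : IsAFMetric p G') :
    ∫ x, divergence (massField G) x = ∫ x, divergence (massField G') x := by
  have hp := hG.pos
  have hexp : -2 * p - 1 - 1 < -(n : ℝ) := by linarith [hG.rate]
  have hb := hs.norm_isBigO h.tendsto hst hG hG'
  obtain ⟨A, hA, hJ⟩ := h.exists_orthogonal hn hG hG' hb
  set L := linearField G'
  set B : Fin n → Fin n → E n → ℝ := fun i j y => ∑ k, (A k i * jac t y k j - A k j * jac t y k i)
    with hB
  set e : Fin n → E n → ℝ := fun i x =>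
    massField G i x - (∑ k, A k i * L k (t x) + ∑ j, pd j (B i j) x) with he
  have hed (i : Fin n) : Decays (-2 * p - 1) (e i) :=
    h.decays_massField_transformation hG hG' hb hA hJ i
  have hJc (k i : Fin n) : Continuous fun x => jac t x k i := (h.contDiff_jac k i).continuous
  have hLc (k : Fin n) : Continuous (L k) := (hG'.contDiff_linearField k).continuous
  have htc : Continuous t := h.smooth.continuous
  have hVc (k : Fin n) : Continuous (massField G k) := (hG.contDiff_massField k).continuous
  have hV'c (k : Fin n) : Continuous (massField G' k) := (hG'.contDiff_massField k).continuous
  have hBs (i j : Fin n) : ContDiff ℝ ∞ (B i j) := ContDiff.sum fun k _ =>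
    (contDiff_const.mul (h.contDiff_jac k j)).sub (contDiff_const.mul (h.contDiff_jac k i))
  have hB1 (i j : Fin n) : ContDiff ℝ 1 (B i j) := (hBs i j).of_le (by simp)
  have hBanti (i j : Fin n) (x : E n) : B i j x = -B j i x := by
    simp only [hB, ← Finset.sum_neg_distrib]
    exact Finset.sum_congr rfl fun k _ => by ring
  have hBc (i j k : Fin n) : Continuous (pd k (B i j)) := (contDiff_pd (hBs i j) k).continuous
  have hec (i : Fin n) : Continuous (e i) := by
    simp only [he]
    fun_prop
  have hLd (k : Fin n) : Decays (-p - 1) (fun x => L k (t x)) :=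
    (hG'.decays_linearField k).comp (by linarith) h.tendsto hb
  -- `|det J| = 1 + O(|x|⁻ᵖ)`
  have hdet : AsymptoticTo p A.det (fun x => (jac t x).det) := AsymptoticTo.det hp hJ
  have hdetA : |A.det| = 1 := by
    have := congrArg Matrix.det hA
    rw [Matrix.det_mul, Matrix.det_transpose, Matrix.det_one] at this
    exact (abs_eq zero_le_one).2 (mul_self_eq_one_iff.1 this)
  have hdetd : Decays (-p) (fun x => 1 - |(jac t x).det|) := by
    refine hdet.sub.of_abs_le (.of_forall fun x => ?_)
    rw [← hdetA, abs_sub_comm]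
    exact abs_abs_sub_abs_le _ _
  have hdetc : Continuous fun x => (jac t x).det := hdet.smooth.continuous
  -- the terms of lower order
  set w : Fin n → E n → ℝ := fun q x => ∑ i, jac t x q i * e i x +
    ∑ k, (∑ i, jac t x q i * A k i - (1 : Matrix (Fin n) (Fin n) ℝ) q k) * L k (t x) +
    (1 - |(jac t x).det|) * L q (t x) with hw
  have hwd (q : Fin n) : Decays (-2 * p - 1) (w q) := by
    refine ((Decays.sum fun i _ => ?_).add (Decays.sum fun k _ => ?_)).add ?_
    · exact ((hJ q i).decays_zero hp).mul' (hed i) (by simp)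
    · have h1 : AsymptoticTo p (∑ i, A q i * A k i) (fun x => ∑ i, jac t x q i * A k i) :=
        AsymptoticTo.sum fun i _ => (hJ q i).mul hp (AsymptoticTo.const p _)
      have h2 : ∑ i, A q i * A k i = (1 : Matrix (Fin n) (Fin n) ℝ) q k := by
        rw [← hA, Matrix.mul_apply]
        rfl
      rw [h2] at h1
      exact h1.sub.mul' (hLd k) (by linarith)
    · exact hdetd.mul' (hLd q) (by linarith)
  have hwc (q : Fin n) : Continuous (w q) := by
    simp only [hw]
    fun_prop
  clear_value w e B
  have hlim1 := tendsto_neg_integral_cutoff hG.contDiff_one_massField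
    hG.integrable_divergence_massField h.smooth h.tendsto
  have hlim2 := tendsto_neg_integral_cutoff hG'.contDiff_one_massField
    hG'.integrable_divergence_massField contDiff_id tendsto_id
  have hlim3 : Tendsto (fun R => ∑ q, ∫ x, pd q (cutoff R) (t x) * w q x) atTop (𝓝 0) := by
    simpa using tendsto_finsetSum Finset.univ fun q _ =>
      tendsto_integral_pd_cutoff_mul (hwd q) hexp (hwc q) htc hb q
  have hlim4 : Tendsto (fun R => ∑ q, ∫ y, pd q (cutoff R) y * (massField G' q y - L q y)) atTop
      (𝓝 0) := by
    simpa using tendsto_finsetSum Finset.univ fun q _ =>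
      tendsto_integral_pd_cutoff_mul (hG'.decays_massField_sub q) hexp
        ((hV'c q).sub (hLc q)) continuous_id (Asymptotics.isBigO_refl _ _) q
  -- change variables in the pairing with the cutoff transported by `t`
  have hkey : ∀ᶠ R in atTop, (∫ x, ∑ i, pd i (fun y => cutoff R (t y)) x * massField G i x) =
      (∑ q, ∫ x, pd q (cutoff R) (t x) * w q x) +
      ((∫ y, ∑ q, pd q (fun y => cutoff R y) y * massField G' q y) -
        ∑ q, ∫ y, pd q (cutoff R) y * (massField G' q y - L q y)) := by
    filter_upwards [eventually_gt_atTop 0,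
      eventually_integral_eq_comp h.smooth hs.tendsto hst hts] with R hR hchange
    have hac (q : Fin n) : Continuous fun x => pd q (cutoff R) (t x) :=
      (continuous_pd_cutoff R q).comp htc
    have hac' (q : Fin n) : Continuous (pd q (cutoff R : E n → ℝ)) := continuous_pd_cutoff R q
    have hak (q : Fin n) : HasCompactSupport fun x => pd q (cutoff R) (t x) :=
      hasCompactSupport_of_bounded (eventually_pd_cutoff_comp_eq_zero hR h.tendsto q)
    have hak' (q : Fin n) : HasCompactSupport (pd q (cutoff R : E n → ℝ)) :=
      hasCompactSupport_of_bounded (eventually_pd_cutoff_comp_eq_zero hR tendsto_id q)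
    have hcut : ContDiff ℝ ∞ fun x => cutoff R (t x) := (contDiff_cutoff R).comp h.smooth
    have hpd (i : Fin n) (x : E n) : pd i (fun y => cutoff R (t y)) x =
        ∑ q, pd q (cutoff R) (t x) * jac t x q i :=
      pd_comp ((contDiff_cutoff R).differentiable (by simp) _) (h.differentiableAt x)
    have hcutk : HasCompactSupport fun x => cutoff R (t x) :=
      hasCompactSupport_of_bounded (eventually_cutoff_comp_eq_zero hR h.tendsto)
    have hpoint (x : E n) : ∑ i, pd i (fun y => cutoff R (t y)) x * massField G i x =
        (∑ q, pd q (cutoff R) (t x) * w q x +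
        ∑ q, |(jac t x).det| * (pd q (cutoff R) (t x) * L q (t x))) +
        ∑ i, pd i (fun y => cutoff R (t y)) x * ∑ j, pd j (B i j) x := by
      simp only [hpd, hw]
      exact pairing_identity (fun q => pd q (cutoff R) (t x)) (jac t x) A (fun i => e i x)
        (fun k => L k (t x)) (fun i => ∑ j, pd j (B i j) x) (fun i => massField G i x)
        |(jac t x).det| fun i => by simp only [he]; ring
    have hint1 (q : Fin n) : Integrable fun x => pd q (cutoff R) (t x) * w q x :=
      ((hac q).mul (hwc q)).integrable_of_hasCompactSupport (hak q).mul_right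
    have hint2 (q : Fin n) :
        Integrable fun x => |(jac t x).det| * (pd q (cutoff R) (t x) * L q (t x)) :=
      (hdetc.abs.mul ((hac q).mul ((hLc q).comp htc))).integrable_of_hasCompactSupport
        (HasCompactSupport.mul_left (hak q).mul_right)
    have hint3 : Integrable fun x =>
        ∑ i, pd i (fun y => cutoff R (t y)) x * ∑ j, pd j (B i j) x := by
      refine integrable_finsetSum _ fun i _ => Continuous.integrable_of_hasCompactSupport
        ((contDiff_pd hcut i).continuous.mul (continuous_finsetSum _ fun j _ => hBc i j j)) ?_
      exact (hasCompactSupport_pd hcutk i).mul_right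
    have hint4 (q : Fin n) : Integrable fun y => pd q (cutoff R) y * massField G' q y :=
      ((hac' q).mul (hV'c q)).integrable_of_hasCompactSupport (hak' q).mul_right
    have hint5 (q : Fin n) : Integrable fun y => pd q (cutoff R) y * L q y :=
      ((hac' q).mul (hLc q)).integrable_of_hasCompactSupport (hak' q).mul_right
    have hanti : ∫ x, ∑ i, pd i (fun y => cutoff R (t y)) x * ∑ j, pd j (B i j) x = 0 :=
      integral_pd_mul_divergence_antisymm hcut hcutk hB1 hBanti
    simp only [hpoint]
    rw [integral_add _ hint3, hanti, add_zero, integral_add,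
      integral_finsetSum _ fun q _ => hint1 q, integral_finsetSum _ fun q _ => hint2 q]
    · congr 1
      rw [integral_finsetSum _ fun q _ => hint4 q, ← Finset.sum_sub_distrib]
      refine Finset.sum_congr rfl fun q _ => ?_
      rw [← hchange (fun y => pd q (cutoff R) y * L q y)
        (fun y hy => by rw [pd_cutoff_eq_zero hR hy, zero_mul])]
      simp only [mul_sub]
      rw [integral_sub (hint4 q) (hint5 q)]
      ring
    · exact integrable_finsetSum _ fun q _ => hint1 q
    · exact integrable_finsetSum _ fun q _ => hint2 q
    · exact (integrable_finsetSum _ fun q _ => hint1 q).add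
        (integrable_finsetSum _ fun q _ => hint2 q)
  -- the fluxes of `G` and of `G'` differ by the terms in `hlim3` and `hlim4`, which tend to `0`
  refine tendsto_nhds_unique hlim1 ?_
  have h5 := (hlim2.sub hlim3).add hlim4
  rw [sub_zero, add_zero] at h5
  refine h5.congr' ?_
  filter_upwards [hkey] with R hR
  rw [hR]
  simp only [id]
  ring

/-! ### The mass vector field of a graph -/

/-- The metric `δᵢⱼ + fᵢ fⱼ` induced on the graph of `f`. -/
noncomputable def graphMetric (f : E n → ℝ) (x : E n) : Matrix (Fin n) (Fin n) ℝ :=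
  Matrix.of fun i j => (1 : Matrix (Fin n) (Fin n) ℝ) i j + pd i f x * pd j f x

/-- `1 + |Df|²` -/
noncomputable def graphDet (f : E n → ℝ) (x : E n) : ℝ := 1 + ∑ i, pd i f x ^ 2

/-- `|Df|² Δf - fᵢ fⱼ fᵢⱼ`, which is `|Df|³` times the mean curvature of the level set. -/
noncomputable def levelForm (f : E n → ℝ) (x : E n) : ℝ :=
  ∑ i, ∑ j, (pd i f x ^ 2 * pd j (pd j f) x - pd i f x * pd j f x * pd i (pd j f) x)

lemma graphDet_pos (f : E n → ℝ) (x : E n) : 0 < graphDet f x := by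
  have : 0 ≤ ∑ i, pd i f x ^ 2 := Finset.sum_nonneg fun _ _ => sq_nonneg _
  unfold graphDet
  linarith

lemma graphMetric_symm (f : E n → ℝ) (x : E n) (i j : Fin n) :
    graphMetric f x i j = graphMetric f x j i := by
  simp only [graphMetric, Matrix.of_apply, Matrix.one_apply, eq_comm (a := i), mul_comm]

lemma det_graphMetric (f : E n → ℝ) (x : E n) : (graphMetric f x).det = graphDet f x := by
  have h : graphMetric f x = 1 + Matrix.replicateCol Unit (fun i => pd i f x) *
      Matrix.replicateRow Unit (fun i => pd i f x) := by
    ext i j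
    simp [graphMetric, Matrix.mul_apply]
  rw [h, Matrix.det_one_add_replicateCol_mul_replicateRow, graphDet]
  simp [dotProduct, sq]

lemma inv_graphMetric (f : E n → ℝ) (x : E n) (i j : Fin n) : (graphMetric f x)⁻¹ i j =
    (1 : Matrix (Fin n) (Fin n) ℝ) i j - pd i f x * pd j f x * (graphDet f x)⁻¹ := by
  have hS := (graphDet_pos f x).ne'
  have h : graphMetric f x * Matrix.of (fun i j => (1 : Matrix (Fin n) (Fin n) ℝ) i j -
      pd i f x * pd j f x * (graphDet f x)⁻¹) = 1 := by
    ext i j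
    rw [Matrix.mul_apply]
    simp only [graphMetric, Matrix.of_apply, add_mul, mul_sub, Finset.sum_add_distrib,
      Finset.sum_sub_distrib]
    have e : ∑ k, pd i f x * pd k f x * (pd k f x * pd j f x * (graphDet f x)⁻¹) =
        pd i f x * pd j f x * (graphDet f x)⁻¹ * (graphDet f x - 1) := by
      rw [graphDet, add_sub_cancel_left, Finset.mul_sum]
      exact Finset.sum_congr rfl fun k _ => by ring
    rw [e]
    simp only [Matrix.one_apply, ite_mul, mul_ite, one_mul, zero_mul, mul_one, mul_zero,
      Finset.sum_ite_eq, Finset.sum_ite_eq', Finset.mem_univ, if_true]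
    field_simp
    ring
  rw [Matrix.inv_eq_right_inv h, Matrix.of_apply]

lemma contDiff_graphMetric {f : E n → ℝ} (hf : ContDiff ℝ ∞ f) (i j : Fin n) :
    ContDiff ℝ ∞ (fun x => graphMetric f x i j) :=
  contDiff_const.add ((contDiff_pd hf i).mul (contDiff_pd hf j))

lemma differentiableAt_pd {f : E n → ℝ} (hf : ContDiff ℝ ∞ f) (i : Fin n) (x : E n) :
    DifferentiableAt ℝ (pd i f) x := (contDiff_pd hf i).differentiable (by simp) x

lemma differentiableAt_pd_pd {f : E n → ℝ} (hf : ContDiff ℝ ∞ f) (i j : Fin n) (x : E n) :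
    DifferentiableAt ℝ (pd i (pd j f)) x := differentiableAt_pd (contDiff_pd hf j) i x

lemma pd_graphMetric {f : E n → ℝ} (hf : ContDiff ℝ ∞ f) (i j k : Fin n) (x : E n) :
    pd k (fun y => graphMetric f y i j) x =
      pd i f x * pd k (pd j f) x + pd k (pd i f) x * pd j f x := by
  have hi := differentiableAt_pd hf i x
  have hj := differentiableAt_pd hf j x
  simp only [graphMetric, Matrix.of_apply]
  rw [pd_add (by fun_prop) (hi.fun_mul hj), pd_const, zero_add, pd_mul hi hj]

/-- `Γᵏᵢⱼ = fₖ fᵢⱼ / (1 + |Df|²)` -/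
lemma christoffel_graphMetric {f : E n → ℝ} (hf : ContDiff ℝ ∞ f) (k i j : Fin n) (x : E n) :
    christoffel (graphMetric f) k i j x =
      pd k f x * pd i (pd j f) x * (graphDet f x)⁻¹ := by
  have hS := (graphDet_pos f x).ne'
  have hcomm (a b : Fin n) : pd a (pd b f) x = pd b (pd a f) x := pd_comm hf.contDiffAt a b
  have e1 (l : Fin n) : pd i (fun y => graphMetric f y j l) x +
      pd j (fun y => graphMetric f y i l) x - pd l (fun y => graphMetric f y i j) x =
      2 * pd i (pd j f) x * pd l f x := by
    rw [pd_graphMetric hf, pd_graphMetric hf, pd_graphMetric hf, hcomm j i, hcomm l j, hcomm l i]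
    ring
  have e2 : ∑ l, (graphMetric f x)⁻¹ k l * pd l f x = pd k f x * (graphDet f x)⁻¹ := by
    simp only [inv_graphMetric, sub_mul, Finset.sum_sub_distrib]
    have e : ∑ l, pd k f x * pd l f x * (graphDet f x)⁻¹ * pd l f x =
        pd k f x * (graphDet f x)⁻¹ * (graphDet f x - 1) := by
      rw [graphDet, add_sub_cancel_left, Finset.mul_sum]
      exact Finset.sum_congr rfl fun k _ => by ring
    rw [e]
    simp only [Matrix.one_apply, ite_mul, one_mul, zero_mul, Finset.sum_ite_eq,
      Finset.mem_univ, if_true]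
    field_simp
    ring
  simp only [christoffel, e1]
  rw [Finset.sum_congr rfl fun l _ => show (graphMetric f x)⁻¹ k l *
    (2 * pd i (pd j f) x * pd l f x) = 2 * pd i (pd j f) x * ((graphMetric f x)⁻¹ k l * pd l f x)
    by ring, ← Finset.mul_sum, e2]
  ring

/-- The mass vector field of a graph is `(fₖ Δf - fⱼ fⱼₖ) / √(1 + |Df|²)`. -/
lemma massField_graphMetric {f : E n → ℝ} (hf : ContDiff ℝ ∞ f) (k : Fin n) (x : E n) :
    massField (graphMetric f) k x = √(graphDet f x) * (graphDet f x)⁻¹ *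
      ∑ j, (pd k f x * pd j (pd j f) x - pd j f x * pd j (pd k f) x) := by
  have hcomm (a b : Fin n) : pd a (pd b f) x = pd b (pd a f) x := pd_comm hf.contDiffAt a b
  simp only [massField, densInv, det_graphMetric, christoffel_graphMetric hf, inv_graphMetric]
  have e1 : ∑ i, ∑ j, (1 : Matrix (Fin n) (Fin n) ℝ) i j * (pd k f x * pd i (pd j f) x) =
      ∑ j, pd k f x * pd j (pd j f) x := by simp [Matrix.one_apply]
  have e2 : ∑ i, ∑ j, (1 : Matrix (Fin n) (Fin n) ℝ) i k * (pd j f x * pd i (pd j f) x) =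
      ∑ j, pd j f x * pd j (pd k f) x := by
    simp [Matrix.one_apply, hcomm k]
  rw [Finset.sum_sub_distrib, ← e1, ← e2, ← Finset.sum_sub_distrib, Finset.mul_sum]
  refine Finset.sum_congr rfl fun i _ => ?_
  rw [← Finset.sum_sub_distrib, Finset.mul_sum]
  refine Finset.sum_congr rfl fun j _ => ?_
  ring

lemma sum_mul_massField_graphMetric {f : E n → ℝ} (hf : ContDiff ℝ ∞ f) (x : E n) :
    ∑ k, pd k f x * massField (graphMetric f) k x =
      √(graphDet f x) * (graphDet f x)⁻¹ * levelForm f x := by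
  have hcomm (a b : Fin n) : pd a (pd b f) x = pd b (pd a f) x := pd_comm hf.contDiffAt a b
  simp only [massField_graphMetric hf, levelForm, Finset.mul_sum]
  refine Finset.sum_congr rfl fun k _ => Finset.sum_congr rfl fun j _ => ?_
  rw [hcomm j k]
  ring

lemma contDiff_graphDet {f : E n → ℝ} (hf : ContDiff ℝ ∞ f) : ContDiff ℝ ∞ (graphDet f) :=
  contDiff_const.add (ContDiff.sum fun i _ => (contDiff_pd hf i).pow 2)

lemma continuous_levelForm {f : E n → ℝ} (hf : ContDiff ℝ ∞ f) : Continuous (levelForm f) := by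
  have h1 i := (contDiff_pd hf i).continuous
  have h2 i j := (contDiff_pd (contDiff_pd hf j) i).continuous
  unfold levelForm
  fun_prop

/-- At a critical point of `f`, the divergence of the mass vector field of the graph is
`(Δf)² - |D²f|²`. -/
lemma divergence_massField_graphMetric {f : E n → ℝ} (hf : ContDiff ℝ ∞ f) {x : E n}
    (hx : ∀ i, pd i f x = 0) :
    divergence (massField (graphMetric f)) x = √(graphDet f x) * (graphDet f x)⁻¹ *
      ∑ k, ∑ j, (pd k (pd k f) x * pd j (pd j f) x - pd k (pd j f) x ^ 2) := by
  rw [divergence, Finset.mul_sum]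
  refine Finset.sum_congr rfl fun k _ => ?_
  have hS : ContDiff ℝ ∞ fun y => √(graphDet f y) * (graphDet f y)⁻¹ :=
    ((contDiff_graphDet hf).sqrt fun y => (graphDet_pos f y).ne').mul
      ((contDiff_graphDet hf).inv fun y => (graphDet_pos f y).ne')
  have h1 i := differentiableAt_pd hf i x
  have h2 i j := differentiableAt_pd_pd hf i j x
  have h3 (j : Fin n) : DifferentiableAt ℝ
      (fun y => pd k f y * pd j (pd j f) y - pd j f y * pd j (pd k f) y) x :=
    ((h1 k).fun_mul (h2 j j)).fun_sub ((h1 j).fun_mul (h2 j k))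
  rw [show massField (graphMetric f) k = fun y => √(graphDet f y) * (graphDet f y)⁻¹ *
      ∑ j, (pd k f y * pd j (pd j f) y - pd j f y * pd j (pd k f) y) from
    funext fun y => massField_graphMetric hf k y, pd_mul (hS.differentiable (by simp) x)
    (DifferentiableAt.fun_sum fun j _ => h3 j), pd_sum fun j _ => h3 j]
  simp only [hx, zero_mul, sub_zero, Finset.sum_const_zero, mul_zero, add_zero]
  congr 1
  refine Finset.sum_congr rfl fun j _ => ?_
  rw [pd_sub ((h1 k).fun_mul (h2 j j)) ((h1 j).fun_mul (h2 j k)), pd_mul (h1 k) (h2 j j),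
    pd_mul (h1 j) (h2 j k), hx, hx, pd_comm hf.contDiffAt j k]
  ring

/-! ### A maximum principle for functions with mean convex level sets -/

lemma pd_eq_zero_of_isLocalMax {u : E n → ℝ} {x : E n} (h : IsLocalMax u x) (i : Fin n) :
    pd i u x = 0 := by
  simp [pd, h.fderiv_eq_zero]

/-- The Hessian is negative semidefinite at a local maximum. -/
lemma sum_pd_pd_nonpos_of_isLocalMax {u : E n → ℝ} (hu : ContDiff ℝ ∞ u) {x : E n}
    (h : IsLocalMax u x) (v : E n) : ∑ j, v j * ∑ i, v i * pd i (pd j u) x ≤ 0 := by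
  have hline (w : E n → ℝ) (hw : ContDiff ℝ ∞ w) (t : ℝ) :
      HasDerivAt (fun t : ℝ => w (x + t • v)) (∑ i, v i * pd i w (x + t • v)) t := by
    have h1 : HasDerivAt (fun t : ℝ => x + t • v) v t := by
      simpa using ((hasDerivAt_id t).smul_const v).const_add x
    have h2 := (hw.differentiable (by simp) (x + t • v)).hasFDerivAt.comp_hasDerivAt t h1
    rwa [fderiv_apply_eq_sum] at h2
  set g : ℝ → ℝ := fun t => u (x + t • v)
  have hg1 : deriv g = fun t => ∑ j, v j * pd j u (x + t • v) :=
    funext fun t => (hline u hu t).deriv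
  have hg2 : deriv (deriv g) 0 = ∑ j, v j * ∑ i, v i * pd i (pd j u) x := by
    rw [hg1]
    have h1 : HasDerivAt (fun t : ℝ => ∑ j, v j * pd j u (x + t • v))
        (∑ j, v j * ∑ i, v i * pd i (pd j u) (x + (0 : ℝ) • v)) 0 :=
      HasDerivAt.fun_sum fun j _ => (hline (pd j u) (contDiff_pd hu j) 0).const_mul (v j)
    rw [h1.deriv]
    simp
  have hmax : IsLocalMax g 0 := by
    have hc : ContinuousAt (fun t : ℝ => x + t • v) 0 := by fun_prop
    have h0 : Tendsto (fun t : ℝ => x + t • v) (𝓝 0) (𝓝 x) := by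
      simpa using hc.tendsto
    filter_upwards [h0.eventually h] with t ht
    simpa [g] using ht
  by_contra hcon
  push Not at hcon
  have hmin : IsLocalMin g 0 := by
    refine isLocalMin_of_deriv_deriv_pos (by rw [hg2]; exact hcon) hmax.deriv_eq_zero ?_
    exact (hline u hu 0).continuousAt
  have hconst : g =ᶠ[𝓝 0] fun _ => g 0 := by
    filter_upwards [hmin, hmax] with t h1 h2 using le_antisymm h2 h1
  have h0 : deriv (deriv g) 0 = 0 := by
    rw [hconst.deriv.deriv_eq]
    simp
  rw [hg2] at h0
  linarith

/-- `(tr S)² ≥ |S|²` for the Hessian `S` at a local maximum. -/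
lemma sum_minors_nonneg_of_isLocalMax {u : E n → ℝ} (hu : ContDiff ℝ ∞ u) {x : E n}
    (h : IsLocalMax u x) :
    0 ≤ ∑ k, ∑ j, (pd k (pd k u) x * pd j (pd j u) x - pd k (pd j u) x ^ 2) := by
  refine Finset.sum_nonneg fun k _ => Finset.sum_nonneg fun j _ => ?_
  have hq (a b : ℝ) : a * a * pd k (pd k u) x + 2 * (a * b) * pd k (pd j u) x +
      b * b * pd j (pd j u) x ≤ 0 := by
    have h1 := sum_pd_pd_nonpos_of_isLocalMax hu h
      (EuclideanSpace.single k a + EuclideanSpace.single j b)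
    simp only [PiLp.add_apply, PiLp.single_apply, add_mul, Finset.sum_add_distrib, mul_add,
      ite_mul, zero_mul, Finset.sum_ite_eq', Finset.mem_univ, if_true] at h1
    rw [pd_comm hu.contDiffAt j k] at h1
    linarith
  have h2 := discrim_le_zero_of_nonpos (a := pd k (pd k u) x) (b := 2 * pd k (pd j u) x)
    (c := pd j (pd j u) x) fun a => by linarith [hq a 1]
  rw [discrim] at h2
  linarith

lemma pd_gaussian (A N c : ℝ) (i : Fin n) (x : E n) :
    pd i (fun y : E n => A * Real.exp (-N * (‖y‖ ^ 2 - c))) x =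
      -2 * N * x i * (A * Real.exp (-N * (‖x‖ ^ 2 - c))) := by
  have h1 : HasFDerivAt (fun y : E n => -N * (‖y‖ ^ 2 - c)) (-N • (2 • innerSL ℝ x)) x :=
    ((hasStrictFDerivAt_norm_sq x).hasFDerivAt.sub_const c).const_mul (-N)
  have h2 := h1.exp.const_mul A
  rw [pd, h2.fderiv]
  simp [EuclideanSpace.inner_single_right]
  ring

lemma contDiff_gaussian (A N c : ℝ) :
    ContDiff ℝ ∞ (fun y : E n => A * Real.exp (-N * (‖y‖ ^ 2 - c))) :=
  contDiff_const.mul ((contDiff_const.mul ((contDiff_norm_sq ℝ).sub contDiff_const)).exp)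

lemma pd_coord (i j : Fin n) (x : E n) : pd i (fun y : E n => y j) x = if j = i then 1 else 0 := by
  have h1 : HasFDerivAt (fun y : E n => y j) (EuclideanSpace.proj j : E n →L[ℝ] ℝ) x :=
    (EuclideanSpace.proj j : E n →L[ℝ] ℝ).hasFDerivAt
  rw [pd, h1.fderiv]
  simp

lemma pd_pd_gaussian (A N c : ℝ) (i j : Fin n) (x : E n) :
    pd i (pd j (fun y : E n => A * Real.exp (-N * (‖y‖ ^ 2 - c)))) x =
      (-2 * N * (if j = i then 1 else 0) + 4 * N ^ 2 * (x i * x j)) *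
        (A * Real.exp (-N * (‖x‖ ^ 2 - c))) := by
  set φ : E n → ℝ := fun y : E n => A * Real.exp (-N * (‖y‖ ^ 2 - c)) with hφ
  have hd : DifferentiableAt ℝ φ x := (contDiff_gaussian A N c).differentiable (by simp) x
  have hc : DifferentiableAt ℝ (fun y : E n => y j) x := by fun_prop
  rw [show pd j φ = fun y => -2 * N * (y j * φ y) from funext fun y => by
    rw [hφ, pd_gaussian]; ring, pd_const_mul _ (hc.fun_mul hd), pd_mul hc hd, pd_coord, hφ,
    pd_gaussian]
  ring

/-- Where a graph is touched from above by a radial barrier that decreases outwards, its level set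
has negative mean curvature. -/
lemma levelForm_neg_of_isLocalMax (hn : 2 ≤ n) {f : E n → ℝ} (hf : ContDiff ℝ ∞ f) {x : E n}
    (hx : x ≠ 0) {A N c : ℝ} (hA : 0 < A) (hN : 0 < N)
    (h : IsLocalMax (fun y => f y - A * Real.exp (-N * (‖y‖ ^ 2 - c))) x) :
    levelForm f x < 0 := by
  set φ : E n → ℝ := fun y : E n => A * Real.exp (-N * (‖y‖ ^ 2 - c)) with hφ
  have hφC : ContDiff ℝ ∞ φ := contDiff_gaussian A N c
  have hφ0 : 0 < φ x := by positivity
  have hpd (u : E n → ℝ) (hu : ContDiff ℝ ∞ u) : DifferentiableAt ℝ u x :=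
    hu.differentiable (by simp) x
  set l : ℝ := -2 * N * φ x with hl
  have hl0 : l < 0 := by
    rw [hl]
    nlinarith
  have h1 (i : Fin n) : pd i f x = l * x i := by
    have := pd_eq_zero_of_isLocalMax h i
    rw [pd_sub (hpd f hf) (hpd φ hφC), hφ, pd_gaussian] at this
    rw [hl, hφ]
    linarith
  have h2 (i j : Fin n) : pd i (pd j (fun y => f y - φ y)) x = pd i (pd j f) x -
      (l * (if j = i then 1 else 0) + 4 * N ^ 2 * (x i * x j) * φ x) := by
    rw [show pd j (fun y => f y - φ y) = fun y => pd j f y - pd j φ y from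
      funext fun y => pd_sub (hf.differentiable (by simp) y) (hφC.differentiable (by simp) y),
      pd_sub (hpd _ (contDiff_pd hf j)) (hpd _ (contDiff_pd hφC j)), hφ, pd_pd_gaussian]
    rw [hl, hφ]
    ring
  -- the second order condition in the direction `x_b e_a - x_a e_b`, which is tangential
  have h3 (a b : Fin n) : x b ^ 2 * pd a (pd a f) x + x a ^ 2 * pd b (pd b f) x -
      2 * (x a * x b) * pd a (pd b f) x ≤
        l * (x a ^ 2 + x b ^ 2 - 2 * (x a * x b) * (if a = b then 1 else 0)) := by
    have h4 := sum_pd_pd_nonpos_of_isLocalMax (hf.sub hφC) h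
      (EuclideanSpace.single a (x b) - EuclideanSpace.single b (x a))
    simp only [PiLp.sub_apply, PiLp.single_apply, sub_mul, Finset.sum_sub_distrib, mul_sub,
      ite_mul, zero_mul, Finset.sum_ite_eq', Finset.mem_univ, if_true, mul_ite, mul_zero,
      h2] at h4
    rw [pd_comm hf.contDiffAt b a] at h4
    by_cases hab : a = b
    · subst hab
      simp only [if_true, mul_one] at h4 ⊢
      nlinarith
    · rw [if_neg hab, if_neg (Ne.symm hab)] at h4
      rw [if_neg hab]
      nlinarith
  -- `levelForm`, symmetrized, is a sum of such second derivatives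
  have h5 : 2 * levelForm f x = l ^ 2 * ∑ a, ∑ b, (x b ^ 2 * pd a (pd a f) x +
      x a ^ 2 * pd b (pd b f) x - 2 * (x a * x b) * pd a (pd b f) x) := by
    have e1 : ∑ a, ∑ b, x b ^ 2 * pd a (pd a f) x = ∑ a, ∑ b, x a ^ 2 * pd b (pd b f) x :=
      Finset.sum_comm
    simp only [Finset.sum_sub_distrib, Finset.sum_add_distrib, e1]
    rw [levelForm]
    simp only [h1, Finset.sum_sub_distrib, mul_sub, mul_add, Finset.mul_sum]
    rw [← Finset.sum_add_distrib, ← Finset.sum_sub_distrib, ← Finset.sum_sub_distrib]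
    refine Finset.sum_congr rfl fun a _ => ?_
    rw [← Finset.sum_add_distrib, ← Finset.sum_sub_distrib, ← Finset.sum_sub_distrib]
    refine Finset.sum_congr rfl fun b _ => ?_
    ring
  have h6 : ∑ a, ∑ b, l * (x a ^ 2 + x b ^ 2 - 2 * (x a * x b) * (if a = b then 1 else 0)) =
      l * (2 * (n - 1) * ‖x‖ ^ 2) := by
    rw [EuclideanSpace.real_norm_sq_eq]
    simp only [← Finset.mul_sum, Finset.sum_sub_distrib, Finset.sum_add_distrib, mul_ite, mul_one,
      mul_zero, Finset.sum_ite_eq, Finset.mem_univ, if_true, Finset.sum_const, Finset.card_univ,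
      Fintype.card_fin, nsmul_eq_mul, ← sq]
    ring
  have h7 := Finset.sum_le_sum fun a (_ : a ∈ Finset.univ) =>
    Finset.sum_le_sum fun b (_ : b ∈ Finset.univ) => h3 a b
  rw [h6] at h7
  have hn' : (2 : ℝ) ≤ n := by exact_mod_cast hn
  have hx0 : 0 < ‖x‖ := norm_pos_iff.2 hx
  have h8 : l * (2 * (n - 1) * ‖x‖ ^ 2) < 0 :=
    mul_neg_of_neg_of_pos hl0 (mul_pos (by linarith) (by positivity))
  have h9 : 0 < l ^ 2 := by positivity
  nlinarith

/-- Maximum principle: if the level sets are mean convex outside a ball, `f` does not exceed there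
its upper limit at infinity. Otherwise a Gaussian barrier, steep near the ball, would touch the
graph from above at an interior point. -/
lemma le_of_levelForm_nonneg (hn : 2 ≤ n) {f : E n → ℝ} (hf : ContDiff ℝ ∞ f) {a l : ℝ}
    (ha : 0 < a) (hQ : ∀ x, a < ‖x‖ → 0 ≤ levelForm f x)
    (hl : ∀ᶠ x in cobounded (E n), f x < l) {z : E n} (hz : a < ‖z‖) : f z ≤ l := by
  by_contra hcon
  push Not at hcon
  set c := ‖z‖
  -- the height of the barrier over `z`, chosen so that `f z - A > l`
  set A := (f z - l) / 2 with hA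
  have hA0 : 0 < A := by
    rw [hA]
    linarith
  set a₁ := (a + c) / 2 with ha₁
  have ha₁a : a < a₁ := by linarith
  have ha₁c : a₁ < c := by linarith
  obtain ⟨M, hM⟩ := (isCompact_closedBall (0 : E n) a₁).exists_bound_of_continuousOn
    hf.continuous.continuousOn
  have hd : 0 < c ^ 2 - a₁ ^ 2 := by nlinarith
  obtain ⟨N, hN0, hN⟩ : ∃ N : ℝ, 0 < N ∧ M - f z + A < A * Real.exp (N * (c ^ 2 - a₁ ^ 2)) := by
    have h1 : Tendsto (fun N : ℝ => A * Real.exp (N * (c ^ 2 - a₁ ^ 2))) atTop atTop :=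
      (Real.tendsto_exp_atTop.comp (tendsto_id.atTop_mul_const hd)).const_mul_atTop hA0
    exact ((eventually_gt_atTop 0).and (h1.eventually (eventually_gt_atTop _))).exists
  set F : E n → ℝ := fun y => f y - A * Real.exp (-N * (‖y‖ ^ 2 - c ^ 2)) with hF
  have hFc : Continuous F := (hf.sub (contDiff_gaussian A N _)).continuous
  have hFz : F z = f z - A := by simp [hF, c]
  obtain ⟨b, hb0, hb⟩ := eventually_cobounded_iff.1 hl
  set b' := max b c + 1
  have hK : IsCompact (Metric.closedBall (0 : E n) b' ∩ {y | a₁ ≤ ‖y‖}) :=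
    (isCompact_closedBall _ _).inter_right (isClosed_le continuous_const continuous_norm)
  have hzK : z ∈ Metric.closedBall (0 : E n) b' ∩ {y | a₁ ≤ ‖y‖} :=
    ⟨by simpa using (le_max_right b c).trans (by linarith : max b c ≤ b'), ha₁c.le⟩
  obtain ⟨x, hx, hxmax⟩ := hK.exists_isMaxOn ⟨z, hzK⟩ hFc.continuousOn
  have hxz : F z ≤ F x := hxmax hzK
  -- by the choice of `N`, the maximum is not attained on the inner sphere
  have hx1 : a₁ < ‖x‖ := by
    refine lt_of_le_of_ne hx.2 fun heq => ?_
    have h1 : f x ≤ M := (le_abs_self _).trans (hM x (by simp [heq]))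
    have h2 : F x = f x - A * Real.exp (N * (c ^ 2 - a₁ ^ 2)) := by
      simp only [hF, ← heq]
      congr 3
      ring
    linarith
  -- far out, `f < l` while the barrier is positive
  have hx2 : ‖x‖ < b' := by
    by_contra hcon2
    have h1 : b < ‖x‖ := by linarith [le_max_left b c]
    have h2 := hb x h1
    have h3 : 0 < A * Real.exp (-N * (‖x‖ ^ 2 - c ^ 2)) := by positivity
    have h4 : F x < f x := by simp only [hF]; linarith
    linarith
  have hloc : IsLocalMax F x := by
    have h1 : ∀ᶠ y : E n in 𝓝 x, a₁ < ‖y‖ ∧ ‖y‖ < b' :=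
      (continuous_norm.continuousAt.eventually (lt_mem_nhds hx1)).and
        (continuous_norm.continuousAt.eventually (gt_mem_nhds hx2))
    filter_upwards [h1] with y hy
    exact hxmax ⟨by simpa using hy.2.le, hy.1.le⟩
  have hx0 : x ≠ 0 := norm_pos_iff.1 (by linarith)
  exact absurd (levelForm_neg_of_isLocalMax hn hf hx0 hA0 hN0 hloc)
    (not_lt.2 (hQ x (by linarith)))

/-! ### Nonnegativity of the mass of a graph -/

/-- Smooth decreasing functions that vanish near `L` and converge to the indicator function of
`(-∞, L)`. -/
lemma exists_profiles {L : EReal} (hL : L ≠ ⊥) : ∃ ψ : ℕ → ℝ → ℝ,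
    (∀ k, ContDiff ℝ ∞ (ψ k)) ∧ (∀ k, Antitone (ψ k)) ∧ (∀ k t, |ψ k t| ≤ 1) ∧
    (∀ k, ∃ l : ℝ, (l : EReal) < L ∧ ∀ t, l ≤ t → ψ k t = 0) ∧
    ∀ t : ℝ, (t : EReal) < L → ∀ᶠ k in atTop, ψ k t = 1 := by
  have habs (t : ℝ) : |Real.smoothTransition t| ≤ 1 := by
    rw [abs_of_nonneg (Real.smoothTransition.nonneg t)]
    exact Real.smoothTransition.le_one t
  induction L with
  | bot => exact absurd rfl hL
  | top =>
    refine ⟨fun k t => Real.smoothTransition (k - t),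
      fun k => Real.smoothTransition.contDiff.comp (contDiff_const.sub contDiff_id),
      fun k s t hst => Real.smoothTransition.monotone (by linarith), fun k t => habs _,
      fun k => ⟨k, EReal.coe_lt_top _, fun t ht =>
        Real.smoothTransition.zero_of_nonpos (by linarith)⟩, fun t _ => ?_⟩
    filter_upwards [tendsto_natCast_atTop_atTop.eventually (eventually_ge_atTop (t + 1))] with k hk
    exact Real.smoothTransition.one_of_one_le (by linarith)
  | coe l =>
    refine ⟨fun k t => Real.smoothTransition ((k + 1) * (l - t) - 1),
      fun k => Real.smoothTransition.contDiff.comp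
        ((contDiff_const.mul (contDiff_const.sub contDiff_id)).sub contDiff_const),
      fun k s t hst => Real.smoothTransition.monotone ?_, fun k t => habs _, fun k => ?_,
      fun t ht => ?_⟩
    · have : (0 : ℝ) ≤ k + 1 := by positivity
      nlinarith
    · have hk : (0 : ℝ) < k + 1 := by positivity
      refine ⟨l - 1 / (k + 1), ?_, fun t ht => Real.smoothTransition.zero_of_nonpos ?_⟩
      · rw [EReal.coe_lt_coe_iff]
        have : (0 : ℝ) < 1 / (k + 1) := by positivity
        linarith
      · have h1 : l - t ≤ 1 / (k + 1) := by linarith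
        rw [le_div_iff₀ hk] at h1
        linarith
    · rw [EReal.coe_lt_coe_iff] at ht
      have h0 : 0 < l - t := by linarith
      filter_upwards [tendsto_natCast_atTop_atTop.eventually
        (eventually_ge_atTop (2 / (l - t)))] with k hk
      refine Real.smoothTransition.one_of_one_le ?_
      rw [div_le_iff₀ h0] at hk
      nlinarith

/-- If the level sets of `f` are mean convex near infinity and `f` approaches its limit `L` at
infinity from below, the mass is nonnegative: in the divergence theorem, the superlevel sets of `f`
serve as neighbourhoods of infinity. On the set `{f = L}`, which they miss, the divergence is
nonnegative since its points are maxima. -/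
lemma integral_divergence_massField_nonneg {f : E n → ℝ} (hf : ContDiff ℝ ∞ f) {a : ℝ}
    (ha : 0 < a) (hQ : ∀ x, a < ‖x‖ → 0 ≤ levelForm f x) {L : EReal} (hLbot : L ≠ ⊥)
    (hL : Tendsto (fun x => (f x : EReal)) (cobounded (E n)) (𝓝 L))
    (hle : ∀ x, a < ‖x‖ → (f x : EReal) ≤ L)
    (hVs : ∀ k, ContDiff ℝ ∞ (massField (graphMetric f) k))
    (hi : Integrable (divergence (massField (graphMetric f)))) :
    0 ≤ ∫ x, divergence (massField (graphMetric f)) x := by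
  set V := massField (graphMetric f)
  have hV1 (k : Fin n) : ContDiff ℝ 1 (V k) := (hVs k).of_le (by simp)
  have hVd (k : Fin n) (x : E n) : DifferentiableAt ℝ (V k) x := (hVs k).differentiable (by simp) x
  -- cut the field off inside a ball
  have ha1 : 0 < a + 1 := by linarith
  set χ : E n → ℝ := cutoff (a + 1)
  have hχone (x : E n) (hx : ‖x‖ ≤ a) : χ x = 1 := cutoff_eq_one ha1 (by linarith)
  have hχpd (x : E n) (hx : ‖x‖ ≤ a) (k : Fin n) : pd k χ x = 0 :=
    pd_cutoff_eq_zero ha1 (by linarith) k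
  have hχ : ContDiff ℝ ∞ χ := contDiff_cutoff _
  have hχd (x : E n) : DifferentiableAt ℝ χ x := hχ.differentiable (by simp) x
  have hχ1 : ContDiff ℝ 1 χ := hχ.of_le (by simp)
  have hχc : HasCompactSupport χ :=
    hasCompactSupport_of_bounded (eventually_cutoff_comp_eq_zero ha1 tendsto_id)
  set W : Fin n → E n → ℝ := fun k x => (1 - χ x) * V k x with hW
  have hW1 (k : Fin n) : ContDiff ℝ 1 (W k) := (contDiff_const.sub hχ1).mul (hV1 k)
  have hdivW (x : E n) : divergence W x =
      (1 - χ x) * divergence V x - ∑ k, pd k χ x * V k x := by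
    simp only [divergence, hW, Finset.mul_sum, ← Finset.sum_sub_distrib]
    refine Finset.sum_congr rfl fun k _ => ?_
    rw [pd_mul ((hχd x).const_sub 1) (hVd k x), pd_sub (by fun_prop) (hχd x), pd_const]
    ring
  have hVdiv : Continuous (divergence V) := continuous_divergence hV1
  have hint1 : Integrable fun x => χ x * divergence V x :=
    (hχ.continuous.mul hVdiv).integrable_of_hasCompactSupport hχc.mul_right
  have hint2 : Integrable fun x => ∑ k, pd k χ x * V k x := by
    exact integrable_finsetSum _ fun k _ => Continuous.integrable_of_hasCompactSupport
      ((continuous_pd hχ1 k).mul (hVs k).continuous) (hasCompactSupport_pd hχc k).mul_right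
  have hdivW' : divergence W = fun x =>
      (divergence V x - χ x * divergence V x) - ∑ k, pd k χ x * V k x :=
    funext fun x => by rw [hdivW]; ring
  have hint3 : Integrable fun x => divergence V x - χ x * divergence V x := hi.sub hint1
  have hWi : Integrable (divergence W) := by
    rw [hdivW']
    exact hint3.sub hint2
  have hWV : ∫ x, divergence W x = ∫ x, divergence V x := by
    simp only [hdivW']
    rw [integral_sub hint3 hint2, integral_sub hi hint1,
      integral_mul_divergence hχ1 hχc hV1]
    ring
  have hWc : Continuous (divergence W) := continuous_divergence hW1
  have hW0 (x : E n) (hx : ‖x‖ ≤ a) : divergence W x = 0 := by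
    simp [hdivW, hχone x hx, hχpd x hx]
  have hpair (x : E n) : 0 ≤ ∑ k, pd k f x * W k x := by
    have h1 : ∑ k, pd k f x * W k x = (1 - χ x) * ∑ k, pd k f x * V k x := by
      rw [Finset.mul_sum]
      exact Finset.sum_congr rfl fun k _ => by simp only [hW]; ring
    rw [h1]
    rcases le_or_gt ‖x‖ a with hx | hx
    · simp [hχone x hx]
    · have h2 : χ x ≤ 1 := (le_abs_self _).trans (abs_cutoff_le _ _)
      rw [sum_mul_massField_graphMetric hf]
      have h3 := graphDet_pos f x
      have h4 := hQ x hx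
      have h5 : 0 ≤ 1 - χ x := by linarith
      positivity
  have hmax (x : E n) (hx : a < ‖x‖) (hfx : (f x : EReal) = L) : 0 ≤ divergence W x := by
    have hloc : IsLocalMax f x := by
      filter_upwards [continuous_norm.continuousAt.eventually (lt_mem_nhds hx)] with y hy
      have := hle y hy
      rw [← hfx] at this
      exact_mod_cast this
    have hpd0 (i : Fin n) : pd i f x = 0 := pd_eq_zero_of_isLocalMax hloc i
    have hV0 (k : Fin n) : V k x = 0 := by
      simp [V, massField_graphMetric hf, hpd0]
    have h2 : χ x ≤ 1 := (le_abs_self _).trans (abs_cutoff_le _ _)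
    rw [hdivW, divergence_massField_graphMetric hf hpd0]
    simp only [hV0, mul_zero, Finset.sum_const_zero, sub_zero]
    have h3 := graphDet_pos f x
    have h4 := sum_minors_nonneg_of_isLocalMax hf hloc
    have h5 : 0 ≤ 1 - χ x := by linarith
    positivity
  -- `ψ ∘ f` has compact support since `f → L`
  obtain ⟨ψ, hψC, hψa, hψ1, hψ0, hψlim⟩ := exists_profiles hLbot
  have hk (k : ℕ) : 0 ≤ ∫ x, ψ k (f x) * divergence W x := by
    obtain ⟨l, hl, hl0⟩ := hψ0 k
    have hu : ContDiff ℝ ∞ fun x => ψ k (f x) := (hψC k).comp hf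
    have huc : HasCompactSupport fun x => ψ k (f x) := by
      refine hasCompactSupport_of_bounded ?_
      filter_upwards [hL.eventually (lt_mem_nhds hl)] with x hx
      exact hl0 _ (by exact_mod_cast hx.le)
    rw [integral_mul_divergence (hu.of_le (by simp)) huc hW1, ← integral_neg]
    refine integral_nonneg fun x => ?_
    have h1 : -∑ i, pd i (fun y => ψ k (f y)) x * W i x =
        -deriv (ψ k) (f x) * ∑ i, pd i f x * W i x := by
      rw [Finset.mul_sum, ← Finset.sum_neg_distrib]
      refine Finset.sum_congr rfl fun i _ => ?_
      rw [pd_comp_real ((hψC k).differentiable (by simp) _) (hf.differentiable (by simp) x)]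
      ring
    rw [Pi.zero_apply, h1]
    exact mul_nonneg (neg_nonneg.2 (hψa k).deriv_nonpos) (hpair x)
  classical
  set g : E n → ℝ := fun x => if (f x : EReal) < L ∧ a < ‖x‖ then divergence W x else 0 with hg
  have hlim : Tendsto (fun k => ∫ x, ψ k (f x) * divergence W x) atTop (𝓝 (∫ x, g x)) := by
    refine tendsto_integral_of_dominated_convergence (fun x => ‖divergence W x‖)
      (fun k => (((hψC k).continuous.comp hf.continuous).mul hWc).aestronglyMeasurable) hWi.norm
      (fun k => ae_of_all _ fun x => ?_) (ae_of_all _ fun x => tendsto_const_nhds.congr' ?_)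
    · rw [norm_mul]
      exact mul_le_of_le_one_left (norm_nonneg _) (hψ1 k _)
    · rcases le_or_gt ‖x‖ a with hx | hx
      · simp [hg, hW0 x hx]
      · rcases (hle x hx).lt_or_eq with hlt | heq
        · filter_upwards [hψlim (f x) hlt] with k hk1
          simp [hg, hlt, hx, hk1]
        · refine .of_forall fun k => ?_
          obtain ⟨l, hl, hl0⟩ := hψ0 k
          rw [← heq] at hl
          have hψx : ψ k (f x) = 0 := hl0 (f x) (by exact_mod_cast hl.le)
          simp [hg, heq, hψx]
  have hgm : ∀ x, g x ≤ divergence W x := by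
    intro x
    rcases le_or_gt ‖x‖ a with hx | hx
    · simp [hg, hW0 x hx]
    · rcases (hle x hx).lt_or_eq with hlt | heq
      · simp [hg, hlt, hx]
      · simpa [hg, heq] using hmax x hx heq
  have hgi : Integrable g := by
    have hms : MeasurableSet {x : E n | (f x : EReal) < L ∧ a < ‖x‖} :=
      (measurableSet_lt (measurable_coe_real_ereal.comp hf.continuous.measurable)
        measurable_const).inter (measurableSet_lt measurable_const measurable_norm)
    have : g = {x : E n | (f x : EReal) < L ∧ a < ‖x‖}.indicator (divergence W) := by
      ext x
      simp [hg, indicator]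
    rw [this]
    exact hWi.indicator hms
  rw [← hWV]
  exact (ge_of_tendsto' hlim hk).trans (integral_mono hgi hWi hgm)

/-! ### Consequences of mean convexity of the level sets -/

lemma gradient_apply (f : E n → ℝ) (x : E n) (i : Fin n) : gradient f x i = pd i f x := by
  have h : inner ℝ (gradient f x) (EuclideanSpace.single i (1 : ℝ)) =
      fderiv ℝ f x (EuclideanSpace.single i 1) := by
    rw [gradient, InnerProductSpace.toDual_symm_apply]
  rw [pd, ← h, EuclideanSpace.inner_single_right]
  simp

lemma norm_gradient (f : E n → ℝ) (x : E n) : ‖gradient f x‖ = √(∑ i, pd i f x ^ 2) := by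
  simp [EuclideanSpace.norm_eq, gradient_apply]

lemma levelForm_eq_zero {f : E n → ℝ} {x : E n} (h : gradient f x = 0) : levelForm f x = 0 := by
  have h0 (i : Fin n) : pd i f x = 0 := by rw [← gradient_apply, h, PiLp.zero_apply]
  simp [levelForm, h0]

/-- `levelForm f = |Df|³ H` -/
lemma levelForm_eq {f : E n → ℝ} (hf : ContDiff ℝ ∞ f) {x : E n} (hx : gradient f x ≠ 0) :
    levelForm f x = ‖gradient f x‖ ^ 3 * levelSetMeanCurvature f x := by
  set T : E n → ℝ := fun y => ∑ j, pd j f y ^ 2 with hT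
  have hd (i : Fin n) : DifferentiableAt ℝ (pd i f) x :=
    (contDiff_pd hf i).differentiable (by simp) x
  have hr0 : 0 < √(T x) := by
    rw [← norm_gradient]
    exact norm_pos_iff.2 hx
  have hT0 : 0 < T x := Real.sqrt_pos.1 hr0
  have hTd : DifferentiableAt ℝ T x := by
    simp only [hT]
    fun_prop
  have hTpd (i : Fin n) : pd i T x = ∑ j, 2 * pd j f x * pd i (pd j f) x := by
    simp only [hT, sq]
    rw [pd_sum (u := fun j y => pd j f y * pd j f y) fun j _ => (hd j).mul (hd j)]
    refine Finset.sum_congr rfl fun j _ => ?_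
    rw [pd_mul (hd j) (hd j)]
    ring
  have hψ : HasDerivAt (fun t => (√t)⁻¹) (-(1 / (2 * √(T x))) / √(T x) ^ 2) (T x) :=
    (Real.hasDerivAt_sqrt hT0.ne').inv hr0.ne'
  have hcomp (i : Fin n) : pd i (fun y => levelSetNormal f y i) x =
      (√(T x))⁻¹ * pd i (pd i f) x +
        -(1 / (2 * √(T x))) / √(T x) ^ 2 * pd i T x * pd i f x := by
    have e : (fun y => levelSetNormal f y i) = fun y => (√(T y))⁻¹ * pd i f y := by
      ext y
      simp [levelSetNormal, norm_gradient, gradient_apply, hT]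
    have hψd : DifferentiableAt ℝ (fun y => (√(T y))⁻¹) x :=
      hψ.differentiableAt.comp x hTd
    rw [e, pd_mul hψd (hd i), pd_comp_real (F := fun t => (√t)⁻¹) hψ.differentiableAt hTd, hψ.deriv]
  have hsq : √(T x) ^ 2 = ∑ j, pd j f x ^ 2 := Real.sq_sqrt hT0.le
  have hmain : ‖gradient f x‖ ^ 3 * levelSetMeanCurvature f x =
      √(T x) ^ 2 * ∑ i, pd i (pd i f) x -
        ∑ i, (∑ j, pd j f x * pd i (pd j f) x) * pd i f x := by
    rw [norm_gradient, levelSetMeanCurvature, Finset.mul_sum, Finset.mul_sum,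
      ← Finset.sum_sub_distrib]
    refine Finset.sum_congr rfl fun i _ => ?_
    rw [hcomp, hTpd]
    simp only [mul_assoc, ← Finset.mul_sum]
    change √(T x) ^ 3 * _ = _
    field_simp
    ring
  rw [hmain, hsq, levelForm, Finset.sum_mul_sum, ← Finset.sum_sub_distrib]
  refine Finset.sum_congr rfl fun i _ => ?_
  rw [Finset.sum_mul, ← Finset.sum_sub_distrib]
  exact Finset.sum_congr rfl fun j _ => by ring

/-- Mean convexity of almost every level set passes to every point, since the values of `f` near a
regular point fill an interval. -/
lemma levelForm_nonneg {f : E n → ℝ} (hf : ContDiff ℝ ∞ f) {a : ℝ}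
    (hmc : ∀ᵐ h : ℝ, IsStrictlyMeanConvexLevelSet {x : E n | a < ‖x‖} f h) {x : E n}
    (hx : a < ‖x‖) : 0 ≤ levelForm f x := by
  by_contra hneg
  push Not at hneg
  have hgrad (y : E n) (hy : levelForm f y < 0) : gradient f y ≠ 0 := fun h =>
    hy.ne (levelForm_eq_zero h)
  have hsurj : (fderiv ℝ f x).range = ⊤ := by
    refine LinearMap.range_eq_top.2 (LinearMap.surjective fun h0 => hgrad x hneg ?_)
    have : fderiv ℝ f x = 0 := by ext v; exact DFunLike.congr_fun h0 v
    simp [gradient, this]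
  -- `f` is open at `x`, so `f x` is interior to the set of nearby values of `f`
  have hmap := (hf.contDiffAt.hasStrictFDerivAt (x := x) (by simp)).map_nhds_eq_of_surj hsurj
  have hO : ∀ᶠ y in 𝓝 x, levelForm f y < 0 ∧ a < ‖y‖ :=
    ((continuous_levelForm hf).continuousAt.eventually (gt_mem_nhds hneg)).and
      (continuous_norm.continuousAt.eventually (lt_mem_nhds hx))
  have himg : f '' {y | levelForm f y < 0 ∧ a < ‖y‖} ∈ 𝓝 (f x) := by
    rw [← hmap]
    exact image_mem_map hO
  obtain ⟨_, hgood, y, ⟨hy, hya⟩, rfl⟩ := (Measure.dense_of_ae hmc).inter_nhds_nonempty himg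
  have := hgood.2 y hya rfl (hgrad y hy)
  rw [levelForm_eq hf (hgrad y hy)] at hy
  have : 0 ≤ ‖gradient f y‖ ^ 3 * levelSetMeanCurvature f y := by positivity
  linarith

lemma isPreconnected_norm_gt (hn : 2 ≤ n) {R : ℝ} (hR : 0 ≤ R) :
    IsPreconnected {x : E n | R < ‖x‖} := by
  have hrank : 1 < Module.rank ℝ (E n) := by
    rw [rank_eq_card_basis (EuclideanSpace.basisFun (Fin n) ℝ).toBasis]
    simp only [Fintype.card_fin]
    exact_mod_cast hn
  have himg : {x : E n | R < ‖x‖} =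
      (fun q : ℝ × E n => q.1 • q.2) '' (Ioi R ×ˢ Metric.sphere 0 1) := by
    ext x
    constructor
    · intro hx
      have hx0 : ‖x‖ ≠ 0 := (hR.trans_lt hx).ne'
      exact ⟨(‖x‖, ‖x‖⁻¹ • x), ⟨hx, by simp [norm_smul, hx0]⟩, by simp [smul_smul, hx0]⟩
    · rintro ⟨⟨r, ν⟩, ⟨hr, hν⟩, rfl⟩
      have hr' : R < r := hr
      have hν' : ‖ν‖ = 1 := by simpa using hν
      simpa [norm_smul, hν', abs_of_pos (hR.trans_lt hr')] using hr'
  rw [himg]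
  exact (isPreconnected_Ioi.prod (isPreconnected_sphere hrank 0 1)).image _
    (by fun_prop)

/-- A function with almost all level sets bounded has a limit at infinity, since outside a large
ball it stays on one side of each such level. -/
lemma exists_tendsto_of_isBounded_levelSet (hn : 2 ≤ n) {f : E n → ℝ} (hf : Continuous f) {a : ℝ}
    (hb : ∀ᵐ h : ℝ, IsBounded {x ∈ {x : E n | a < ‖x‖} | f x = h}) :
    ∃ L : EReal, Tendsto (fun x => (f x : EReal)) (cobounded (E n)) (𝓝 L) := by
  have hside {h : ℝ} (hh : IsBounded {x ∈ {x : E n | a < ‖x‖} | f x = h}) :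
      (∀ᶠ x in cobounded (E n), f x < h) ∨ ∀ᶠ x in cobounded (E n), h < f x := by
    obtain ⟨R, hR⟩ := hh.subset_closedBall 0
    set ρ := max (max R a) 0
    have hne (x : E n) (hx : ρ < ‖x‖) : f x ≠ h := by
      intro hxh
      have h1 : a < ‖x‖ := ((le_max_right _ _).trans (le_max_left _ _)).trans_lt hx
      have h2 : ‖x‖ ≤ R := by simpa using hR ⟨h1, hxh⟩
      exact absurd (((le_max_left _ _).trans (le_max_left _ _)).trans_lt hx) (not_lt.2 h2)
    by_cases hlow : ∃ x, ρ < ‖x‖ ∧ f x < h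
    · obtain ⟨x, hx, hxh⟩ := hlow
      left
      filter_upwards [eventually_norm_gt ρ] with y hy
      by_contra hyh
      obtain ⟨z, hz, hzh⟩ := (isPreconnected_norm_gt hn (le_max_right _ _)).intermediate_value
        hx hy hf.continuousOn ⟨hxh.le, not_lt.1 hyh⟩
      exact hne z hz hzh
    · right
      push Not at hlow
      filter_upwards [eventually_norm_gt ρ] with y hy
      exact (hlow y hy).lt_of_ne (hne y hy).symm
  have hcoe : DenseRange fun r : ℝ => (r : EReal) := by
    refine dense_of_exists_between fun b c hbc => ?_
    obtain ⟨r, hr⟩ := EReal.lt_iff_exists_real_btwn.1 hbc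
    exact ⟨r, mem_range_self r, hr⟩
  -- the limit exists, as `f` does not oscillate across any of a dense set of levels
  have hdense : Dense ((fun r : ℝ => (r : EReal)) ''
      {h | IsBounded {x ∈ {x : E n | a < ‖x‖} | f x = h}}) :=
    hcoe.dense_image continuous_coe_real_ereal (Measure.dense_of_ae hb)
  refine tendsto_of_no_upcrossings hdense ?_
  rintro _ ⟨b, hb, rfl⟩ c - hbc ⟨h1, h2⟩
  rcases hside hb with h | h
  · refine h2 (h.mono fun x hx => ?_)
    exact not_lt.2 ((EReal.coe_lt_coe_iff.2 hx).trans hbc).le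
  · exact h1 (h.mono fun x hx => not_lt.2 (EReal.coe_le_coe_iff.2 hx.le))

/-- The limit at infinity of a graph with mean convex level sets is not `-∞` and is approached from
below. -/
lemma le_limit_of_levelForm_nonneg (hn : 2 ≤ n) {f : E n → ℝ} (hf : ContDiff ℝ ∞ f) {a : ℝ}
    (ha : 0 < a) (hQ : ∀ x, a < ‖x‖ → 0 ≤ levelForm f x) {L : EReal}
    (hL : Tendsto (fun x => (f x : EReal)) (cobounded (E n)) (𝓝 L)) :
    L ≠ ⊥ ∧ ∀ x, a < ‖x‖ → (f x : EReal) ≤ L := by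
  have hle (x : E n) (hx : a < ‖x‖) : (f x : EReal) ≤ L := by
    by_contra hlt
    obtain ⟨l, hl, hlx⟩ := EReal.lt_iff_exists_real_btwn.1 (not_le.1 hlt)
    have := le_of_levelForm_nonneg hn hf ha hQ (l := l)
      ((hL.eventually (gt_mem_nhds hl)).mono fun y hy => by exact_mod_cast hy) hx
    exact absurd (EReal.coe_le_coe_iff.2 this) (not_le.2 hlx)
  refine ⟨?_, hle⟩
  rintro rfl
  have : Nontrivial (E n) := by
    have : Nonempty (Fin n) := ⟨⟨0, by omega⟩⟩
    infer_instance
  obtain ⟨x, hx⟩ := (eventually_norm_gt (n := n) a).exists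
  simpa using hle x hx

/-! ### Extension of data given near infinity -/

lemma contDiff_one_sub_cutoff_smul {F : Type*} [NormedAddCommGroup F] [NormedSpace ℝ F]
    {u : E n → F} {r R : ℝ} (hr : r < R) (hR : 0 < R)
    (hu : ∀ x, r < ‖x‖ → ContDiffAt ℝ ∞ u x) :
    ContDiff ℝ ∞ fun x => (1 - cutoff R x) • u x := by
  refine contDiff_iff_contDiffAt.2 fun x => ?_
  rcases lt_or_ge r ‖x‖ with hx | hx
  · exact (contDiffAt_const.sub (contDiff_cutoff R).contDiffAt).smul (hu x hx)
  · refine (contDiffAt_const (c := (0 : F))).congr_of_eventuallyEq ?_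
    filter_upwards [continuous_norm.continuousAt.eventually (gt_mem_nhds (hx.trans_lt hr))]
      with y hy
    simp [cutoff_eq_one hR hy.le]

lemma eventually_cutoff_eq_zero {R : ℝ} (hR : 0 < R) :
    ∀ᶠ x : E n in cobounded (E n), cutoff R x = 0 :=
  eventually_cutoff_comp_eq_zero hR tendsto_id

/-- Every map that is smooth near infinity agrees near infinity with a smooth one. -/
lemma exists_contDiff_eventuallyEq {F : Type*} [NormedAddCommGroup F] [NormedSpace ℝ F]
    {u : E n → F} (hu : ∀ᶠ x in cobounded (E n), ContDiffAt ℝ ∞ u x) :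
    ∃ v : E n → F, ContDiff ℝ ∞ v ∧ v =ᶠ[cobounded (E n)] u := by
  obtain ⟨r, hr, hs⟩ := eventually_cobounded_iff.1 hu
  have hR : 0 < r + 1 := by linarith
  refine ⟨_, contDiff_one_sub_cutoff_smul (lt_add_one r) hR hs, ?_⟩
  filter_upwards [eventually_cutoff_eq_zero hR] with x hx
  simp [hx]

lemma exists_det_pos_of_abs_sub_one_lt (n : ℕ) : ∃ ε > 0, ∀ A : Matrix (Fin n) (Fin n) ℝ,
    (∀ i j, |A i j - (1 : Matrix (Fin n) (Fin n) ℝ) i j| < ε) → 0 < A.det := by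
  have hc : Continuous fun A : Fin n → Fin n → ℝ => (Matrix.of A).det :=
    Continuous.matrix_det continuous_id
  have h1 : 0 < (Matrix.of (1 : Matrix (Fin n) (Fin n) ℝ)).det := by
    rw [show Matrix.of (1 : Matrix (Fin n) (Fin n) ℝ) = 1 from rfl, Matrix.det_one]
    exact one_pos
  obtain ⟨ε, hε, h⟩ := Metric.eventually_nhds_iff.1 (hc.continuousAt.eventually (lt_mem_nhds h1))
  refine ⟨ε, hε, fun A hA => h ?_⟩
  refine (dist_pi_lt_iff hε).2 fun i => (dist_pi_lt_iff hε).2 fun j => ?_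
  rw [Real.dist_eq]
  exact hA i j

section Locality

variable {G G' : E n → Matrix (Fin n) (Fin n) ℝ} {x : E n}

lemma christoffel_congr (h : G =ᶠ[𝓝 x] G') (k i j : Fin n) :
    christoffel G k i j x = christoffel G' k i j x := by
  have hpd (a b c : Fin n) : pd a (fun y => G y b c) x = pd a (fun y => G' y b c) x :=
    pd_congr (h.mono fun y hy => by simp only [hy])
  simp only [christoffel, h.eq_of_nhds, hpd]

lemma scalarCurvature_congr (h : G =ᶠ[𝓝 x] G') : scalarCurvature G x = scalarCurvature G' x := by
  have hpd (a k i j : Fin n) : pd a (christoffel G k i j) x = pd a (christoffel G' k i j) x :=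
    pd_congr (h.eventuallyEq_nhds.mono fun y hy => christoffel_congr hy k i j)
  simp only [scalarCurvature, ricci, h.eq_of_nhds, hpd, christoffel_congr h]

lemma eventuallyEq_admFlux (h : G =ᶠ[cobounded (E n)] G') : admFlux G =ᶠ[atTop] admFlux G' := by
  obtain ⟨R, hR0, hR⟩ := eventually_cobounded_iff.1 (eventually_nhds_cobounded h)
  filter_upwards [eventually_gt_atTop R] with r hr
  have hpd (ν : Metric.sphere (0 : E n) 1) (a b c : Fin n) :
      pd a (fun y => G y b c) (r • (ν : E n)) = pd a (fun y => G' y b c) (r • (ν : E n)) := by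
    refine pd_congr ((hR _ ?_).mono fun y hy => by simp only [hy])
    have hν : ‖(ν : E n)‖ = 1 := by simp
    rwa [norm_smul, hν, mul_one, Real.norm_of_nonneg (hR0.trans hr).le]
  simp only [admFlux, hpd]

end Locality

/-- Smooth coefficients on `ℝⁿ` that agree near infinity with those of an asymptotically flat
metric. -/
lemma IsAFMetric.of_eventuallyEq {p : ℝ} {G G' : E n → Matrix (Fin n) (Fin n) ℝ} (hp : 0 < p)
    (hrate : ((n : ℝ) - 2) / 2 < p) (h : G =ᶠ[cobounded (E n)] G')
    (hs : ∀ i j, ContDiff ℝ ∞ fun x => G x i j) (hsymm : ∀ x i j, G x i j = G x j i)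
    (hdet : ∀ x, 0 < (G x).det)
    (hdec : ∀ i j, Decays (-p) fun x => G' x i j - (1 : Matrix (Fin n) (Fin n) ℝ) i j)
    (hpd : ∀ i j k, Decays (-p - 1) (pd k fun x => G' x i j))
    (hint : ∃ r : ℝ, IntegrableOn (fun x => scalarCurvature G' x * √(G' x).det) {x | r < ‖x‖}) :
    IsAFMetric p G := by
  have hasymp (i j : Fin n) :
      AsymptoticTo p ((1 : Matrix (Fin n) (Fin n) ℝ) i j) (fun x => G x i j) := by
    refine ⟨hs i j, (hdec i j).congr' (h.mono fun x hx => by simp only [hx]), fun k => ?_⟩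
    exact (hpd i j k).congr' (eventually_pd_congr (h.mono fun x hx => by simp only [hx]) k).symm
  refine ⟨hp, hrate, hsymm, hdet, hasymp, ?_⟩
  have hinv (i j : Fin n) : ContDiff ℝ ∞ fun x => (G x)⁻¹ i j :=
    (AsymptoticTo.matrix_inv hp hasymp (fun x => (hdet x).ne') (by simp) i j).smooth
  have hΓ := contDiff_christoffel_of_inv hinv hs
  have hdets : Continuous fun x => (G x).det :=
    (AsymptoticTo.det hp hasymp).smooth.continuous
  have hric (i j : Fin n) : Continuous (ricci G i j) :=
    continuous_finsetSum _ fun k _ => ((contDiff_pd (hΓ _ _ _) _).continuous.sub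
      (contDiff_pd (hΓ _ _ _) _).continuous).add <| continuous_finsetSum _ fun l _ =>
      ((hΓ _ _ _).continuous.mul (hΓ _ _ _).continuous).sub
        ((hΓ _ _ _).continuous.mul (hΓ _ _ _).continuous)
  have hcont : Continuous fun x => scalarCurvature G x * √(G x).det :=
    (continuous_finsetSum _ fun i _ => continuous_finsetSum _ fun j _ =>
      (hinv i j).continuous.mul (hric i j)).mul hdets.sqrt
  obtain ⟨r, hr⟩ := hint
  obtain ⟨R, -, hR⟩ := eventually_cobounded_iff.1 (eventually_nhds_cobounded h)
  set ρ := max r R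
  have h1 : IntegrableOn (fun x => scalarCurvature G x * √(G x).det) (Metric.closedBall 0 ρ) :=
    hcont.continuousOn.integrableOn_compact (isCompact_closedBall _ _)
  have h2 : IntegrableOn (fun x => scalarCurvature G x * √(G x).det) {x | ρ < ‖x‖} := by
    refine (hr.mono_set fun x hx => (le_max_left r R).trans_lt hx).congr_fun (fun x hx => ?_)
      (measurableSet_lt measurable_const measurable_norm)
    have hx' : G =ᶠ[𝓝 x] G' := hR x ((le_max_right r R).trans_lt hx)
    simp only [scalarCurvature_congr hx', hx'.eq_of_nhds]
  rw [← integrableOn_univ]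
  refine (h1.union h2).mono_set fun x _ => ?_
  rcases le_or_gt ‖x‖ ρ with hx | hx
  · exact Or.inl (by simpa using hx)
  · exact Or.inr hx

/-- Asymptotically flat coefficients near infinity extend to an asymptotically flat metric
on `ℝⁿ`. -/
lemma exists_isAFMetric {p : ℝ} {G : E n → Matrix (Fin n) (Fin n) ℝ} (hp : 0 < p)
    (hrate : ((n : ℝ) - 2) / 2 < p)
    (hs : ∀ᶠ x in cobounded (E n), ∀ i j, ContDiffAt ℝ ∞ (fun y => G y i j) x)
    (hsymm : ∀ x i j, G x i j = G x j i)
    (hdec : ∀ i j, Decays (-p) fun x => G x i j - (1 : Matrix (Fin n) (Fin n) ℝ) i j)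
    (hpd : ∀ i j k, Decays (-p - 1) (pd k fun x => G x i j))
    (hint : ∃ r : ℝ, IntegrableOn (fun x => scalarCurvature G x * √(G x).det) {x | r < ‖x‖}) :
    ∃ G', G' =ᶠ[cobounded (E n)] G ∧ IsAFMetric p G' := by
  obtain ⟨ε, hε, hdet⟩ := exists_det_pos_of_abs_sub_one_lt n
  have hclose : ∀ᶠ x in cobounded (E n), ∀ i j,
      |G x i j - (1 : Matrix (Fin n) (Fin n) ℝ) i j| < ε := by
    refine eventually_all.2 fun i => eventually_all.2 fun j => ?_
    have := ((hdec i j).tendsto_zero (by linarith)).abs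
    rw [abs_zero] at this
    exact this.eventually (gt_mem_nhds hε)
  obtain ⟨r, hr, h⟩ := eventually_cobounded_iff.1 (hs.and hclose)
  have hR : 0 < r + 1 := by linarith
  -- interpolating with the Euclidean metric in the region where `G` is close to it keeps `det > 0`
  set G' : E n → Matrix (Fin n) (Fin n) ℝ := fun x => Matrix.of fun i j =>
    (1 : Matrix (Fin n) (Fin n) ℝ) i j +
      (1 - cutoff (r + 1) x) • (G x i j - (1 : Matrix (Fin n) (Fin n) ℝ) i j)
  have heq : G' =ᶠ[cobounded (E n)] G := by
    filter_upwards [eventually_cutoff_eq_zero hR] with x hx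
    ext i j
    simp [G', hx]
  refine ⟨G', heq, IsAFMetric.of_eventuallyEq hp hrate heq (fun i j => ?_) (fun x i j => ?_)
    (fun x => hdet _ fun i j => ?_) hdec hpd hint⟩
  · exact contDiff_const.add (contDiff_one_sub_cutoff_smul (lt_add_one r) hR
      fun x hx => ((h x hx).1 i j).sub contDiffAt_const)
  · simp only [G', Matrix.of_apply, hsymm x i j, Matrix.one_apply, eq_comm (a := i)]
  · simp only [G', Matrix.of_apply, add_sub_cancel_left, smul_eq_mul]
    rcases le_or_gt ‖x‖ (r + 1) with hx | hx
    · simpa [cutoff_eq_one hR hx] using hε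
    · have h0 : 0 ≤ cutoff (r + 1) x := ContDiffBump.nonneg _
      have h1 : cutoff (r + 1) x ≤ 1 := (le_abs_self _).trans (abs_cutoff_le _ _)
      rw [abs_mul, abs_of_nonneg (by linarith : 0 ≤ 1 - cutoff (r + 1) x)]
      exact (mul_le_of_le_one_left (abs_nonneg _) (by linarith)).trans_lt
        ((h x (by linarith)).2 i j)

/-! ### Metric coefficients in different coordinate systems -/

section Manifold

variable {n : ℕ} {H : Type*} [TopologicalSpace H] {I : ModelWithCorners ℝ (E n) H}
  {M : Type*} [TopologicalSpace M] [ChartedSpace H M] [IsManifold I ∞ M]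
  {g : Bundle.ContMDiffRiemannianMetric I ∞ (E n) (TangentSpace I : M → Type _)}

/-- The bilinear form `F^* g` at `x`, for a map `F` from `ℝⁿ` to `M`. -/
noncomputable def pullbackForm
    (g : Bundle.ContMDiffRiemannianMetric I ∞ (E n) (TangentSpace I : M → Type _))
    (F : E n → M) (x v w : E n) : ℝ :=
  g.inner (F x) (mfderiv 𝓘(ℝ, E n) I F x v) (mfderiv 𝓘(ℝ, E n) I F x w)

lemma metricCoeff_apply (Φ : OpenPartialHomeomorph M (E n)) (x : E n) (i j : Fin n) :
    metricCoeff g Φ x i j = pullbackForm g Φ.symm x (EuclideanSpace.single i 1)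
      (EuclideanSpace.single j 1) := rfl

lemma metricCoeff_symm (Φ : OpenPartialHomeomorph M (E n)) (x : E n) (i j : Fin n) :
    metricCoeff g Φ x i j = metricCoeff g Φ x j i :=
  g.symm _ _ _

lemma pullbackForm_congr {F F' : E n → M} {x : E n} (h : F =ᶠ[𝓝 x] F') (v w : E n) :
    pullbackForm g F x v w = pullbackForm g F' x v w := by
  have key (q q' : M) (hq : q = q') (A A' : E n →L[ℝ] E n) (hA : A = A') :
      g.inner q (A v) (A w) = g.inner q' (A' v) (A' w) := by
    subst hq hA
    rfl
  exact key _ _ h.eq_of_nhds _ _ h.mfderiv_eq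

lemma pullbackForm_comp {F : E n → M} {s : E n → E n} {x : E n}
    (hF : MDifferentiableAt 𝓘(ℝ, E n) I F (s x)) (hs : DifferentiableAt ℝ s x) (v w : E n) :
    pullbackForm g (F ∘ s) x v w = pullbackForm g F (s x) (fderiv ℝ s x v) (fderiv ℝ s x w) := by
  have h (u : E n) : mfderiv 𝓘(ℝ, E n) I (F ∘ s) x u =
      mfderiv 𝓘(ℝ, E n) I F (s x) (fderiv ℝ s x u) := by
    have h0 := mfderiv_comp x hF hs.mdifferentiableAt
    rw [mfderiv_eq_fderiv] at h0
    exact DFunLike.congr_fun h0 u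
  simp only [pullbackForm, h]
  rfl

lemma pullbackForm_sum (F : E n → M) (x v w : E n) :
    pullbackForm g F x v w = ∑ k, ∑ l, pullbackForm g F x (EuclideanSpace.single k 1)
      (EuclideanSpace.single l 1) * (v k * w l) := by
  have key (B : E n →L[ℝ] E n →L[ℝ] ℝ) (A : E n →L[ℝ] E n) : B (A v) (A w) =
      ∑ k, ∑ l, B (A (EuclideanSpace.single k 1)) (A (EuclideanSpace.single l 1)) *
        (v k * w l) := by
    conv_lhs => rw [single_sum_eq v, single_sum_eq w]
    simp only [map_sum, map_smul, sum_apply, smul_apply,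
      smul_eq_mul, Finset.mul_sum]
    rw [Finset.sum_comm]
    exact Finset.sum_congr rfl fun k _ => Finset.sum_congr rfl fun l _ => by ring
  exact key (g.inner (F x)) (mfderiv 𝓘(ℝ, E n) I F x)

namespace IsAsymptoticallyFlatChart

variable {Φ Ψ : OpenPartialHomeomorph M (E n)}

lemma contMDiffAt_symm (hΦ : IsAsymptoticallyFlatChart g Φ) {x : E n} (hx : x ∈ Φ.target) :
    ContMDiffAt 𝓘(ℝ, E n) I ∞ Φ.symm x :=
  hΦ.contMDiffOn_symm.contMDiffAt (Φ.open_target.mem_nhds hx)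

lemma contMDiffAt (hΦ : IsAsymptoticallyFlatChart g Φ) {q : M} (hq : q ∈ Φ.source) :
    ContMDiffAt I 𝓘(ℝ, E n) ∞ Φ q :=
  hΦ.contMDiffOn.contMDiffAt (Φ.open_source.mem_nhds hq)

lemma tendsto_symm (hΦ : IsAsymptoticallyFlatChart g Φ) :
    Tendsto Φ.symm (cobounded (E n)) (cocompact M) :=
  hΦ.map_cobounded.le

lemma source_mem (hΦ : IsAsymptoticallyFlatChart g Φ) : Φ.source ∈ cocompact M := by
  rw [← hΦ.map_cobounded, mem_map]
  exact mem_of_superset hΦ.target_mem fun x hx => Φ.map_target hx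

lemma tendsto (hΦ : IsAsymptoticallyFlatChart g Φ) :
    Tendsto Φ (cocompact M) (cobounded (E n)) := by
  rw [← hΦ.map_cobounded, tendsto_map'_iff]
  refine tendsto_id.congr' ?_
  filter_upwards [hΦ.target_mem] with x hx using (Φ.right_inv hx).symm

/-- Near infinity, points are in the domain of the change of coordinates from `Φ` to `Ψ`. -/
lemma eventually_mem (hΦ : IsAsymptoticallyFlatChart g Φ) (hΨ : IsAsymptoticallyFlatChart g Ψ) :
    ∀ᶠ x in cobounded (E n), x ∈ Φ.target ∧ Φ.symm x ∈ Ψ.source :=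
  (eventually_mem_set.2 hΦ.target_mem).and (hΦ.tendsto_symm hΨ.source_mem)

lemma tendsto_transition (hΦ : IsAsymptoticallyFlatChart g Φ)
    (hΨ : IsAsymptoticallyFlatChart g Ψ) :
    Tendsto (fun x => Ψ (Φ.symm x)) (cobounded (E n)) (cobounded (E n)) :=
  hΨ.tendsto.comp hΦ.tendsto_symm

lemma contDiffAt_transition (hΦ : IsAsymptoticallyFlatChart g Φ)
    (hΨ : IsAsymptoticallyFlatChart g Ψ) {x : E n} (hx : x ∈ Φ.target ∧ Φ.symm x ∈ Ψ.source) :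
    ContDiffAt ℝ ∞ (fun x => Ψ (Φ.symm x)) x :=
  contMDiffAt_iff_contDiffAt.1 ((hΨ.contMDiffAt hx.2).comp x (hΦ.contMDiffAt_symm hx.1))

lemma metricCoeff_eq_sum (hΦ : IsAsymptoticallyFlatChart g Φ)
    (hΨ : IsAsymptoticallyFlatChart g Ψ) {x : E n} (hx : x ∈ Φ.target ∧ Φ.symm x ∈ Ψ.source)
    (i j : Fin n) :
    metricCoeff g Φ x i j = ∑ k, ∑ l, metricCoeff g Ψ (Ψ (Φ.symm x)) k l *
      (jac (fun x => Ψ (Φ.symm x)) x k i * jac (fun x => Ψ (Φ.symm x)) x l j) := by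
  set s : E n → E n := fun x => Ψ (Φ.symm x)
  have hs : DifferentiableAt ℝ s x := (hΦ.contDiffAt_transition hΨ hx).differentiableAt (by simp)
  have heq : Φ.symm =ᶠ[𝓝 x] Ψ.symm ∘ s := by
    filter_upwards [(Φ.symm.continuousAt hx.1).preimage_mem_nhds (Ψ.open_source.mem_nhds hx.2)]
      with y hy
    exact (Ψ.left_inv hy).symm
  have hF : MDifferentiableAt 𝓘(ℝ, E n) I Ψ.symm (s x) :=
    (hΨ.contMDiffAt_symm (Ψ.map_source hx.2)).mdifferentiableAt (by simp)
  have hjac (k i : Fin n) : jac s x k i = fderiv ℝ s x (EuclideanSpace.single i 1) k := by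
    have h1 : HasFDerivAt (fun y => s y k)
        ((EuclideanSpace.proj k : E n →L[ℝ] ℝ).comp (fderiv ℝ s x)) x :=
      (EuclideanSpace.proj k : E n →L[ℝ] ℝ).hasFDerivAt.comp x hs.hasFDerivAt
    simp [jac, pd, h1.fderiv]
  rw [metricCoeff_apply, pullbackForm_congr heq, pullbackForm_comp hF hs, pullbackForm_sum]
  simp only [hjac, metricCoeff_apply, s]

/-- Changes of asymptotically flat coordinates, cut off in a ball, are isometries near infinity. -/
lemma exists_isEndIsometry (hΦ : IsAsymptoticallyFlatChart g Φ)
    (hΨ : IsAsymptoticallyFlatChart g Ψ) {G G' : E n → Matrix (Fin n) (Fin n) ℝ}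
    (hG : G =ᶠ[cobounded (E n)] metricCoeff g Φ) (hG' : G' =ᶠ[cobounded (E n)] metricCoeff g Ψ) :
    ∃ t, t =ᶠ[cobounded (E n)] (fun x => Ψ (Φ.symm x)) ∧ IsEndIsometry G G' t := by
  have hmem := hΦ.eventually_mem hΨ
  obtain ⟨t, ht, heq⟩ := exists_contDiff_eventuallyEq
    (hmem.mono fun x hx => hΦ.contDiffAt_transition hΨ hx)
  have htend := (hΦ.tendsto_transition hΨ).congr' heq.symm
  refine ⟨t, heq, ht, htend, ?_⟩
  filter_upwards [hmem, hG, htend.eventually hG', eventually_nhds_cobounded heq]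
    with x hx hGx hGx' hnhds i j
  have hnhds : t =ᶠ[𝓝 x] fun x => Ψ (Φ.symm x) := hnhds
  have hjac (k i : Fin n) : jac t x k i = jac (fun x => Ψ (Φ.symm x)) x k i :=
    pd_congr (hnhds.mono fun y hy => by simp only [hy])
  rw [hGx, hGx', hΦ.metricCoeff_eq_sum hΨ hx, hnhds.eq_of_nhds]
  simp only [hjac]

lemma eventually_transition_comp (hΦ : IsAsymptoticallyFlatChart g Φ)
    (hΨ : IsAsymptoticallyFlatChart g Ψ) {t s : E n → E n}
    (ht : t =ᶠ[cobounded (E n)] fun x => Ψ (Φ.symm x))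
    (hs : s =ᶠ[cobounded (E n)] fun x => Φ (Ψ.symm x)) :
    ∀ᶠ x in cobounded (E n), s (t x) = x := by
  have htend := (hΦ.tendsto_transition hΨ).congr' ht.symm
  filter_upwards [hΦ.eventually_mem hΨ, ht, htend.eventually hs] with x hx htx hsx
  rw [hsx, htx, Ψ.left_inv hx.2, Φ.right_inv hx.1]

end IsAsymptoticallyFlatChart

/-- In graph coordinates, the metric is `δᵢⱼ + fᵢ fⱼ`. -/
lemma IsGraphRealization.metricCoeff_eq {Φ : OpenPartialHomeomorph M (E n)} {f : E n → ℝ}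
    (hf : IsGraphRealization g Φ f) (hΦ : IsAsymptoticallyFlatChart g Φ) {x : E n}
    (hx : x ∈ Φ.target) : metricCoeff g Φ x = graphMetric f x := by
  have hfx : DifferentiableAt ℝ f x :=
    (hf.contDiffOn.contDiffAt (Φ.open_target.mem_nhds hx)).differentiableAt (by simp)
  have hq : Φ.symm x ∈ Φ.source := Φ.map_target hx
  have hsymm : MDifferentiableAt 𝓘(ℝ, E n) I Φ.symm x :=
    (hΦ.contMDiffAt_symm hx).mdifferentiableAt (by simp)
  have hΦd : MDifferentiableAt I 𝓘(ℝ, E n) Φ (Φ.symm x) :=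
    (hΦ.contMDiffAt hq).mdifferentiableAt (by simp)
  have hpair : DifferentiableAt ℝ (fun y : E n => (y, f y)) x := differentiableAt_id.prodMk hfx
  have hgm : MDifferentiableAt I 𝓘(ℝ, E n × ℝ) (graphMap Φ f) (Φ.symm x) := by
    have h1 : MDifferentiableAt 𝓘(ℝ, E n) 𝓘(ℝ, E n × ℝ) (fun y : E n => (y, f y))
        (Φ (Φ.symm x)) := by
      rw [Φ.right_inv hx]
      exact hpair.mdifferentiableAt
    exact h1.comp (Φ.symm x) hΦd
  have heq : graphMap Φ f ∘ Φ.symm =ᶠ[𝓝 x] fun y => (y, f y) := by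
    filter_upwards [Φ.open_target.mem_nhds hx] with y hy
    simp [graphMap, Φ.right_inv hy]
  have hD (i : Fin n) : mfderiv I 𝓘(ℝ, E n × ℝ) (graphMap Φ f) (Φ.symm x)
      (mfderiv 𝓘(ℝ, E n) I Φ.symm x (EuclideanSpace.single i (1 : ℝ) : E n)) =
      ((EuclideanSpace.single i (1 : ℝ) : E n), pd i f x) := by
    have h0 := mfderiv_comp x hgm hsymm
    rw [heq.mfderiv_eq, mfderiv_eq_fderiv] at h0
    have h1 : fderiv ℝ (fun y : E n => (y, f y)) x =
        (ContinuousLinearMap.id ℝ (E n)).prod (fderiv ℝ f x) :=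
      ((hasFDerivAt_id x).prodMk hfx.hasFDerivAt).fderiv
    exact DFunLike.congr_fun (h0.symm.trans h1) (EuclideanSpace.single i (1 : ℝ) : E n)
  ext i j
  have h := hf.isometric _ hq (mfderiv 𝓘(ℝ, E n) I Φ.symm x (EuclideanSpace.single i (1 : ℝ) : E n))
    (mfderiv 𝓘(ℝ, E n) I Φ.symm x (EuclideanSpace.single j (1 : ℝ) : E n))
  rw [metricCoeff, Matrix.of_apply, h, hD, hD]
  simp [euclideanInner, graphMetric, Matrix.one_apply, EuclideanSpace.inner_single_left,
    eq_comm (a := i)]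

end Manifold

/-! ### The mass of an end with graph coordinates -/

lemma levelSetMeanCurvature_congr {f f' : E n → ℝ} {x : E n} (h : f =ᶠ[𝓝 x] f') :
    levelSetMeanCurvature f x = levelSetMeanCurvature f' x := by
  refine Finset.sum_congr rfl fun i _ => pd_congr (h.eventuallyEq_nhds.mono fun y hy => ?_)
  simp only [levelSetNormal, gradient, hy.fderiv_eq]

lemma IsStrictlyMeanConvexLevelSet.congr {U V : Set (E n)} {f f' : E n → ℝ} {h : ℝ}
    (hmc : IsStrictlyMeanConvexLevelSet U f h) (hV : IsOpen V) (hVU : V ⊆ U) (heq : EqOn f' f V) :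
    IsStrictlyMeanConvexLevelSet V f' h := by
  refine ⟨hmc.1.subset fun x hx => ⟨hVU hx.1, (heq hx.1).symm.trans hx.2⟩, fun x hx hxh hg => ?_⟩
  have hnhds : f' =ᶠ[𝓝 x] f := heq.eventuallyEq_of_mem (hV.mem_nhds hx)
  rw [levelSetMeanCurvature_congr hnhds]
  refine hmc.2 x (hVU hx) ((heq hx).symm.trans hxh) ?_
  rwa [gradient, ← hnhds.fderiv_eq]

lemma IsAFMetric.integral_divergence_massField_graphMetric_nonneg {p : ℝ} {f : E n → ℝ}
    (hn : 2 ≤ n) (hf : ContDiff ℝ ∞ f) (hG : IsAFMetric p (graphMetric f)) {a : ℝ} (ha : 0 < a)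
    (hmc : ∀ᵐ h : ℝ, IsStrictlyMeanConvexLevelSet {x : E n | a < ‖x‖} f h) :
    0 ≤ ∫ x, divergence (massField (graphMetric f)) x := by
  have hQ (x : E n) (hx : a < ‖x‖) : 0 ≤ levelForm f x := levelForm_nonneg hf hmc hx
  obtain ⟨L, hL⟩ := exists_tendsto_of_isBounded_levelSet hn hf.continuous
    (hmc.mono fun h hh => hh.1)
  obtain ⟨hbot, hle⟩ := le_limit_of_levelForm_nonneg hn hf ha hQ hL
  exact integral_divergence_massField_nonneg hf ha hQ hbot hL hle hG.contDiff_massField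
    hG.integrable_divergence_massField

section Manifold

variable {H : Type*} [TopologicalSpace H] {I : ModelWithCorners ℝ (E n) H}
  {M : Type*} [TopologicalSpace M] [ChartedSpace H M] [IsManifold I ∞ M]
  {g : Bundle.ContMDiffRiemannianMetric I ∞ (E n) (TangentSpace I : M → Type _)}
  {Φ Ψ : OpenPartialHomeomorph M (E n)}

/-- If the metric coefficients are smooth in one asymptotically flat coordinate system, they are
smooth in all of them, by the transformation law. -/
lemma IsAsymptoticallyFlatChart.eventually_contDiffAt_metricCoeff
    (hΦ : IsAsymptoticallyFlatChart g Φ) (hΨ : IsAsymptoticallyFlatChart g Ψ)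
    {G : E n → Matrix (Fin n) (Fin n) ℝ} (hG : ∀ i j, ContDiff ℝ ∞ fun x => G x i j)
    (hGΦ : G =ᶠ[cobounded (E n)] metricCoeff g Φ) :
    ∀ᶠ x in cobounded (E n), ∀ i j, ContDiffAt ℝ ∞ (fun y => metricCoeff g Ψ y i j) x := by
  have hmem := hΨ.eventually_mem hΦ
  filter_upwards [hmem, eventually_nhds_cobounded hmem,
    eventually_nhds_cobounded ((hΨ.tendsto_transition hΦ).eventually hGΦ)] with x hx hnhds hGx i j
  set t : E n → E n := fun y => Φ (Ψ.symm y)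
  have ht : ContDiffAt ℝ ∞ t x := hΨ.contDiffAt_transition hΦ hx
  have hjac (k i : Fin n) : ContDiffAt ℝ ∞ (fun y => jac t y k i) x :=
    contDiffAt_pd ((EuclideanSpace.proj k : E n →L[ℝ] ℝ).contDiff.contDiffAt.comp x ht) i
  have h : ContDiffAt ℝ ∞
      (fun y => ∑ k, ∑ l, G (t y) k l * (jac t y k i * jac t y l j)) x :=
    ContDiffAt.sum fun k _ => ContDiffAt.sum fun l _ =>
      ((hG k l).contDiffAt.comp x ht).mul ((hjac k i).mul (hjac l j))
  refine h.congr_of_eventuallyEq ?_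
  filter_upwards [hnhds, hGx] with y hy hGy
  rw [hΨ.metricCoeff_eq_sum hΦ hy, hGy]

/-- The integral that represents the mass is the same in all asymptotically flat coordinates. -/
lemma IsAsymptoticallyFlatChart.integral_divergence_eq (hn : 3 ≤ n)
    (hΦ : IsAsymptoticallyFlatChart g Φ) (hΨ : IsAsymptoticallyFlatChart g Ψ) {p q : ℝ}
    {G G' : E n → Matrix (Fin n) (Fin n) ℝ} (hG : IsAFMetric p G) (hG' : IsAFMetric q G')
    (hGΦ : G =ᶠ[cobounded (E n)] metricCoeff g Φ)
    (hGΨ : G' =ᶠ[cobounded (E n)] metricCoeff g Ψ) :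
    ∫ x, divergence (massField G) x = ∫ x, divergence (massField G') x := by
  obtain ⟨t, ht, hti⟩ := hΦ.exists_isEndIsometry hΨ hGΦ hGΨ
  obtain ⟨s, hs, hsi⟩ := hΨ.exists_isEndIsometry hΦ hGΨ hGΦ
  have h0 : 0 < min p q := lt_min hG.pos hG'.pos
  have hr : ((n : ℝ) - 2) / 2 < min p q := lt_min hG.rate hG'.rate
  exact hti.integral_divergence_eq hn hsi (hΦ.eventually_transition_comp hΨ ht hs)
    (hΨ.eventually_transition_comp hΦ hs ht) (hG.mono h0 hr (min_le_left _ _))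
    (hG'.mono h0 hr (min_le_right _ _))

end Manifold

end GraphMass

theorem mainTheorem8 {n : ℕ} (hn : 3 ≤ n)
    {H : Type*} [TopologicalSpace H] (I : ModelWithCorners ℝ (GraphMass.E n) H)
    {M : Type*} [TopologicalSpace M] [T2Space M] [ChartedSpace H M] [IsManifold I ∞ M]
    (g : Bundle.ContMDiffRiemannianMetric I ∞ (GraphMass.E n) (TangentSpace I : M → Type _))
    (Φ : OpenPartialHomeomorph M (GraphMass.E n))
    (hΦ : GraphMass.IsAsymptoticallyFlatChart g Φ)
    (f : GraphMass.E n → ℝ)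
    (hf : GraphMass.IsGraphRealization g Φ f)
    (hmc : ∀ᵐ h : ℝ, GraphMass.IsStrictlyMeanConvexLevelSet Φ.target f h) :
    ∃ m : ℝ, GraphMass.HasADMMass g m ∧ 0 ≤ m := by
  open GraphMass in
  have hn3 : (3 : ℝ) ≤ n := by exact_mod_cast hn
  -- a smooth function on `ℝⁿ` that agrees with `f` near infinity
  obtain ⟨F, hF, hFf⟩ := exists_contDiff_eventuallyEq (u := f)
    ((eventually_mem_set.2 hΦ.target_mem).mono fun x hx =>
      hf.contDiffOn.contDiffAt (Φ.open_target.mem_nhds hx))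
  obtain ⟨a, ha, hFa⟩ := eventually_cobounded_iff.1
    (hFf.and (eventually_mem_set.2 hΦ.target_mem))
  have hmcF : ∀ᵐ h : ℝ, IsStrictlyMeanConvexLevelSet {x : E n | a < ‖x‖} F h :=
    hmc.mono fun h hh => hh.congr (isOpen_lt continuous_const continuous_norm)
      (fun x hx => (hFa x hx).2) fun x hx => (hFa x hx).1
  have hGF : graphMetric F =ᶠ[cobounded (E n)] metricCoeff g Φ := by
    filter_upwards [eventually_nhds_cobounded hFf, hΦ.target_mem] with x hx hxt
    have hpd (i : Fin n) : pd i F x = pd i f x := pd_congr hx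
    rw [hf.metricCoeff_eq hΦ hxt]
    simp only [graphMetric, hpd]
  obtain ⟨p, hp, hdec, hpd⟩ := hΦ.decay
  have hG : IsAFMetric p (graphMetric F) :=
    .of_eventuallyEq (by linarith) hp hGF (contDiff_graphMetric hF) (graphMetric_symm F)
      (fun x => (det_graphMetric F x).symm ▸ graphDet_pos F x) hdec hpd
      hΦ.integrable_scalarCurvature
  refine ⟨1 / (2 * ((n : ℝ) - 1) * sphereArea n) *
    ∫ x, divergence (massField (graphMetric F)) x, ⟨⟨Φ, hΦ⟩, fun Ψ hΨ => ?_⟩, ?_⟩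
  · obtain ⟨q, hq, hdec', hpd'⟩ := hΨ.decay
    obtain ⟨G', hGΨ, hG'⟩ := exists_isAFMetric (by linarith) hq
      (hΦ.eventually_contDiffAt_metricCoeff hΨ (contDiff_graphMetric hF) hGF)
      (metricCoeff_symm Ψ) hdec' hpd' hΨ.integrable_scalarCurvature
    rw [hΦ.integral_divergence_eq hn hΨ hG hG' hGF hGΨ]
    exact (hG'.tendsto_admFlux (by omega)).congr' (eventuallyEq_admFlux hGΨ)
  · have h1 : 0 ≤ sphereArea n := measureReal_nonneg
    have h2 : 0 ≤ (n : ℝ) - 1 := by linarith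
    have h3 := hG.integral_divergence_massField_graphMetric_nonneg (by omega) hF ha hmcF
    positivity
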